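/- Let $M$ be a smooth manifold (Hausdorff, second countable, without boundary) with a regular foliation $\mathcal F$ of dimension $p$ and codimension $2n$, where $p,n\ge 0$. A smooth differential form $\xi$ on $M$ is *basic* if $\iota_T\xi=0$ and $\mathcal L_T\xi=0$ for every smooth vector field $T$ tangent to the leaves. Let $\Omega^k_B(M,\mathcal F)$ be the space of basic $k$-forms, and let $H^k_B(M,\mathcal F)$ be the cohomology of the complex $(\Omega^*_B(M,\mathcal F),d)$. Let $\omega$ be a transversely symplectic form, that is, a closed basic $2$-form such that $\iota_v\omega=0$ for $v\in T_xM$ only if $v\in T_x\mathcal F$. The transversal symplectic star operator $\star_t:\Omega^k_B(M,\mathcal F)\to\Omega^{2n-k}_B(M,\mathcal F)$ is defined pointwise. The map $v\mapsto\iota_v\omega$ extends to an algebra homomorphism $\flat:\Lambda^*T_xM\to\Lambda^*T_x^*M$, and $(\star_t\xi)_x=\iota_X\omega_x^n$ for any $X\in\Lambda^kT_xM$ with $\flat(X)=\xi_x$, where $(\iota_X\eta)(v_1,\dots,v_l)=\eta(u_1,\dots,u_k,v_1,\dots,v_l)$ for $X=u_1\wedge\dots\wedge u_k$; the result does not depend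 on the choice of $X$. Put $\delta_t\xi=(-1)^k\star_t d\star_t\xi$ for $\xi\in\Omega^k_B(M,\mathcal F)$, and call a basic form $\xi$ *harmonic* if $d\xi=0$ and $\delta_t\xi=0$. Let $L^k[\xi]=[\omega^k\wedge\xi]$ on basic cohomology. Then the following conditions are equivalent: 1. for every $k\ge 0$, every class in $H^k_B(M,\mathcal F)$ has a harmonic representative; 2. for each $k\in\{0,1,\dots,n\}$ the map $L^k:H^{n-k}_B(M,\mathcal F)\to H^{n+k}_B(M,\mathcal F)$ is surjective. -/

import Mathlib

open scoped Manifold ContDiff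
open Module

noncomputable section
namespace BasicHodge

section LinearAlgebra

variable {V : Type*} [AddCommGroup V] [Module ℝ V] [TopologicalSpace V]

/-- The tensor product `(v₁, …, v_c) ↦ α (v₁, …, v_a) * β (v_{a+1}, …, v_c)`, where `c = a + b`. -/
def tensor {a b c : ℕ} (h : a + b = c) (α : V [⋀^Fin a]→L[ℝ] ℝ) (β : V [⋀^Fin b]→L[ℝ] ℝ) :
    ContinuousMultilinearMap ℝ (fun _ : Fin c => V) ℝ where
  toMultilinearMap := ((LinearMap.mul' ℝ ℝ).compMultilinearMap
    (MultilinearMap.domCoprod α.toMultilinearMap β.toMultilinearMap)).domDomCongr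
      (finSumFinEquiv.trans (finCongr h))
  cont := by
    change Continuous fun v : Fin c → V =>
      α (fun i => v (finCongr h (finSumFinEquiv (Sum.inl i)))) *
      β (fun i => v (finCongr h (finSumFinEquiv (Sum.inr i))))
    exact (α.cont.comp (by fun_prop)).mul (β.cont.comp (by fun_prop))

theorem tensor_apply {a b c : ℕ} (h : a + b = c) (α : V [⋀^Fin a]→L[ℝ] ℝ)
    (β : V [⋀^Fin b]→L[ℝ] ℝ) (v : Fin c → V) :
    tensor h α β v = α (fun i => v (Fin.cast h (Fin.castAdd b i))) *
      β (fun i => v (Fin.cast h (Fin.natAdd a i))) := rfl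

/-- The wedge product
`(α ∧ β)(v₁, …, v_c) = (1 / (a! b!)) ∑_σ sign σ · α (v_{σ1}, …, v_{σa}) · β (v_{σ(a+1)}, …, v_{σc})`,
where `c = a + b` and `σ` runs over all permutations. -/
def wedge {a b c : ℕ} (h : a + b = c) (α : V [⋀^Fin a]→L[ℝ] ℝ) (β : V [⋀^Fin b]→L[ℝ] ℝ) :
    V [⋀^Fin c]→L[ℝ] ℝ :=
  ((a.factorial * b.factorial : ℝ)⁻¹) •
    ContinuousMultilinearMap.alternatization (tensor h α β)

theorem wedge_apply {a b c : ℕ} (h : a + b = c) (α : V [⋀^Fin a]→L[ℝ] ℝ)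
    (β : V [⋀^Fin b]→L[ℝ] ℝ) (v : Fin c → V) :
    wedge h α β v = (a.factorial * b.factorial : ℝ)⁻¹ *
      ∑ σ : Equiv.Perm (Fin c), ((Equiv.Perm.sign σ : ℤ) : ℝ) *
        (α (fun i => v (σ (Fin.cast h (Fin.castAdd b i)))) *
        β (fun i => v (σ (Fin.cast h (Fin.natAdd a i))))) := by
  simp [wedge, ContinuousMultilinearMap.alternatization_apply_apply, tensor_apply, Units.smul_def]

theorem wedge_add_left {a b c : ℕ} (h : a + b = c) (α α' : V [⋀^Fin a]→L[ℝ] ℝ)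
    (β : V [⋀^Fin b]→L[ℝ] ℝ) : wedge h (α + α') β = wedge h α β + wedge h α' β := by
  ext v
  simp only [wedge_apply, ContinuousAlternatingMap.add_apply, add_mul, mul_add,
    Finset.sum_add_distrib]

theorem wedge_add_right {a b c : ℕ} (h : a + b = c) (α : V [⋀^Fin a]→L[ℝ] ℝ)
    (β β' : V [⋀^Fin b]→L[ℝ] ℝ) : wedge h α (β + β') = wedge h α β + wedge h α β' := by
  ext v
  simp only [wedge_apply, ContinuousAlternatingMap.add_apply, mul_add,
    Finset.sum_add_distrib]

theorem wedge_smul_left {a b c : ℕ} (h : a + b = c) (r : ℝ) (α : V [⋀^Fin a]→L[ℝ] ℝ)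
    (β : V [⋀^Fin b]→L[ℝ] ℝ) : wedge h (r • α) β = r • wedge h α β := by
  ext v
  simp only [wedge_apply, ContinuousAlternatingMap.smul_apply, smul_eq_mul, Finset.mul_sum]
  refine Finset.sum_congr rfl fun σ _ => ?_
  ring

theorem wedge_smul_right {a b c : ℕ} (h : a + b = c) (r : ℝ) (α : V [⋀^Fin a]→L[ℝ] ℝ)
    (β : V [⋀^Fin b]→L[ℝ] ℝ) : wedge h α (r • β) = r • wedge h α β := by
  ext v
  simp only [wedge_apply, ContinuousAlternatingMap.smul_apply, smul_eq_mul, Finset.mul_sum]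
  refine Finset.sum_congr rfl fun σ _ => ?_
  ring

theorem wedge_comp {W : Type*} [AddCommGroup W] [Module ℝ W] [TopologicalSpace W]
    {a b c : ℕ} (h : a + b = c) (α : V [⋀^Fin a]→L[ℝ] ℝ)
    (β : V [⋀^Fin b]→L[ℝ] ℝ) (f : W →L[ℝ] V) :
    (wedge h α β).compContinuousLinearMap f =
      wedge h (α.compContinuousLinearMap f) (β.compContinuousLinearMap f) := by
  ext v
  simp [wedge_apply, Function.comp_def]

/-- If both factors vanish as soon as `t` is inserted, so does their wedge product. -/
theorem wedge_eq_zero_of_mem {a b c : ℕ} (h : a + b = c) (α : V [⋀^Fin a]→L[ℝ] ℝ)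
    (β : V [⋀^Fin b]→L[ℝ] ℝ) (t : V)
    (hα : ∀ w : Fin a → V, ∀ i, w i = t → α w = 0)
    (hβ : ∀ w : Fin b → V, ∀ i, w i = t → β w = 0)
    (w : Fin c → V) (i : Fin c) (hi : w i = t) : wedge h α β w = 0 := by
  subst h
  rw [wedge_apply, Finset.sum_eq_zero, mul_zero]
  intro σ _
  obtain ⟨j, rfl⟩ := σ.surjective i
  induction j using Fin.addCases with
  | left j => rw [hα _ j (by simpa using hi)]; simp
  | right j => rw [hβ _ j (by simpa using hi)]; simp

section Sums

variable {c : ℕ}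

theorem sum_perm_cycleRange (q : Fin (c + 1)) (H : Fin (c + 1) → (Fin c → Fin (c + 1)) → ℝ) :
    ∑ σ : Equiv.Perm (Fin (c + 1)), ((Equiv.Perm.sign σ : ℤ) : ℝ) *
        H (σ q) (fun j => σ (q.succAbove j)) =
      (-1) ^ (q : ℕ) * ∑ σ : Equiv.Perm (Fin (c + 1)), ((Equiv.Perm.sign σ : ℤ) : ℝ) *
        H (σ 0) (fun j => σ j.succ) := by
  rw [← Equiv.sum_comp (Equiv.mulRight q.cycleRange), Finset.mul_sum]
  refine Finset.sum_congr rfl fun σ _ => ?_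
  simp
  ring

theorem sum_perm_succ (H : Fin (c + 1) → (Fin c → Fin (c + 1)) → ℝ) :
    ∑ p : Fin (c + 1), (-1) ^ (p : ℕ) * ∑ τ : Equiv.Perm (Fin c), ((Equiv.Perm.sign τ : ℤ) : ℝ) *
        H p (fun j => p.succAbove (τ j)) =
      ∑ σ : Equiv.Perm (Fin (c + 1)), ((Equiv.Perm.sign σ : ℤ) : ℝ) *
        H (σ 0) (fun j => σ j.succ) := by
  let e : Fin (c + 1) × Equiv.Perm (Fin c) → Equiv.Perm (Fin (c + 1)) := fun x =>
    x.1.cycleRange⁻¹ * Equiv.Perm.decomposeFin.symm (0, x.2)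
  have h0 : ∀ x, e x 0 = x.1 := fun x => by simp [e]
  have hs : ∀ x j, e x (Fin.succ j) = x.1.succAbove (x.2 j) := fun x j => by simp [e]
  have hinj : Function.Injective e := by
    rintro ⟨p, τ⟩ ⟨p', τ'⟩ hx
    have h1 : p = p' := (h0 (p, τ)).symm.trans ((DFunLike.congr_fun hx 0).trans (h0 (p', τ')))
    subst h1
    have h2 : τ = τ' := by
      ext j
      have := hs (p, τ) j
      rw [hx, hs] at this
      simpa using congrArg Fin.val (Fin.succAbove_right_injective this).symm
    rw [h2]
  have hbij : Function.Bijective e := by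
    rw [Fintype.bijective_iff_injective_and_card]
    refine ⟨hinj, ?_⟩
    simp [Fintype.card_perm, Nat.factorial_succ]
  rw [← (Equiv.ofBijective e hbij).sum_comp, Fintype.sum_prod_type]
  refine Finset.sum_congr rfl fun p _ => ?_
  rw [Finset.mul_sum]
  refine Finset.sum_congr rfl fun τ _ => ?_
  rw [Equiv.ofBijective_apply, h0]
  simp only [hs]
  simp [e]
  ring

end Sums

/-- The map `v ↦ ι_v Ω = Ω (v, ·)`. -/
def flat (Ω : V [⋀^Fin 2]→L[ℝ] ℝ) : V →ₗ[ℝ] Dual ℝ V :=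
  LinearMap.mk₂ ℝ (fun v w => Ω ![v, w])
    (fun v v' w => Ω.toAlternatingMap.map_vecCons_add ![w] v v')
    (fun c v w => Ω.toAlternatingMap.map_vecCons_smul ![w] c v)
    (fun v w w' => by
      have e : ∀ z, Function.update ![v, 0] 1 z = ![v, z] := fun z => by
        ext i; fin_cases i <;> simp
      simpa only [e] using Ω.map_update_add ![v, 0] 1 w w')
    (fun c v w => by
      have e : ∀ z, Function.update ![v, 0] 1 z = ![v, z] := fun z => by
        ext i; fin_cases i <;> simp
      simpa only [e] using Ω.map_update_smul ![v, 0] 1 c w)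

/-- The extension of `v ↦ ι_v Ω` to an algebra homomorphism from multivectors to forms, in degree `k`:
`u₁ ∧ … ∧ u_k ↦ ι_{u₁} Ω ∧ … ∧ ι_{u_k} Ω`. -/
def flatPow (Ω : V [⋀^Fin 2]→L[ℝ] ℝ) (k : ℕ) : ⋀[ℝ]^k V →ₗ[ℝ] V [⋀^Fin k]→ₗ[ℝ] ℝ :=
  exteriorPower.alternatingMapLinearEquiv.symm.toLinearMap ∘ₗ
    exteriorPower.pairingDual ℝ V k ∘ₗ exteriorPower.map k (flat Ω)

theorem flatPow_ιMulti (Ω : V [⋀^Fin 2]→L[ℝ] ℝ) (k : ℕ) (u v : Fin k → V) :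
    flatPow Ω k (exteriorPower.ιMulti ℝ k u) v =
      Matrix.det (.of fun i j => Ω ![u j, v i]) := by
  simp [flatPow, flat]

/-- Left multiplication `Y ↦ X ∧ Y` by a multivector. -/
def mulLeft {k l m : ℕ} (h : k + l = m) (X : ⋀[ℝ]^k V) : ⋀[ℝ]^l V →ₗ[ℝ] ⋀[ℝ]^m V :=
  LinearMap.codRestrict _ ((LinearMap.mulLeft ℝ (X : ExteriorAlgebra ℝ V)).comp
    (Submodule.subtype _)) (fun Y => h ▸ SetLike.mul_mem_graded X.2 Y.2)

/-- Right multiplication `X ↦ X ∧ Y` by a multivector. -/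
def mulRight {k l m : ℕ} (h : k + l = m) (Y : ⋀[ℝ]^l V) : ⋀[ℝ]^k V →ₗ[ℝ] ⋀[ℝ]^m V :=
  LinearMap.codRestrict _ ((LinearMap.mulRight ℝ (Y : ExteriorAlgebra ℝ V)).comp
    (Submodule.subtype _)) (fun X => h ▸ SetLike.mul_mem_graded X.2 Y.2)

/-- The interior product `ι_X η` of a form with a `k`-vector, normalized by
`(ι_{u₁ ∧ … ∧ u_k} η) (v₁, …, v_l) = η (u₁, …, u_k, v₁, …, v_l)`. -/
def contract {k l m : ℕ} (h : k + l = m) (X : ⋀[ℝ]^k V) (η : V [⋀^Fin m]→ₗ[ℝ] ℝ) :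
    V [⋀^Fin l]→ₗ[ℝ] ℝ :=
  (exteriorPower.alternatingMapLinearEquiv η ∘ₗ mulLeft h X).compAlternatingMap
    (exteriorPower.ιMulti ℝ l)

theorem contract_sub {k l m : ℕ} (h : k + l = m) (X Y : ⋀[ℝ]^k V) (η : V [⋀^Fin m]→ₗ[ℝ] ℝ) :
    contract h (X - Y) η = contract h X η - contract h Y η := by
  ext v
  change exteriorPower.alternatingMapLinearEquiv η (mulLeft h (X - Y) _) =
    exteriorPower.alternatingMapLinearEquiv η (mulLeft h X _) -
      exteriorPower.alternatingMapLinearEquiv η (mulLeft h Y _)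
  rw [← map_sub]
  congr 1
  ext
  simp [mulLeft, sub_mul]

theorem contract_ιMulti {k l m : ℕ} (h : k + l = m) (u : Fin k → V) (η : V [⋀^Fin m]→ₗ[ℝ] ℝ)
    (v : Fin l → V) :
    contract h (exteriorPower.ιMulti ℝ k u) η v = η (Fin.append u v ∘ Fin.cast h.symm) := by
  subst h
  have : mulLeft rfl (exteriorPower.ιMulti ℝ k u) (exteriorPower.ιMulti ℝ l v) =
      exteriorPower.ιMulti ℝ (k + l) (Fin.append u v) := by
    ext
    simp [mulLeft, ExteriorAlgebra.ιMulti_apply]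
    rw [← List.prod_append, ← List.ofFn_fin_append]
    congr
    ext i
    induction i using Fin.addCases <;> simp
  simp [contract, this]


/-- The power `Ω ^ n = Ω ∧ … ∧ Ω`, a form of degree `2 n`; `Ω ^ 0 = 1`. -/
def wedgePow (Ω : V [⋀^Fin 2]→L[ℝ] ℝ) : (n : ℕ) → V [⋀^Fin (2 * n)]→L[ℝ] ℝ
  | 0 => ContinuousAlternatingMap.constOfIsEmpty ℝ V (Fin 0) 1
  | n + 1 => wedge (show 2 * n + 2 = 2 * (n + 1) by ring) (wedgePow Ω n) Ω

theorem wedgePow_eq_zero_of_mem (Ω : V [⋀^Fin 2]→L[ℝ] ℝ) (t : V) (ht : ∀ w, Ω ![t, w] = 0)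
    (n : ℕ) (w : Fin (2 * n) → V) (i : Fin (2 * n)) (hi : w i = t) : wedgePow Ω n w = 0 := by
  induction n with
  | zero => exact i.elim0
  | succ n ih =>
    refine wedge_eq_zero_of_mem _ _ _ t ih (fun w i hi => ?_) w i hi
    have hw : w = ![w 0, w 1] := by ext i; fin_cases i <;> rfl
    fin_cases i
    · rw [hw]; exact hi ▸ ht _
    · have h1 := Ω.map_swap w (show (0 : Fin 2) ≠ 1 by decide)
      have h2 : (w ∘ Equiv.swap (0 : Fin 2) 1) = ![t, w 0] := by
        ext i; fin_cases i
        · exact hi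
        · rfl
      rw [h2] at h1
      change Ω _ = -Ω _ at h1
      rw [ht] at h1
      linarith

theorem pairingDual_injective [FiniteDimensional ℝ V] (k : ℕ) :
    Function.Injective (exteriorPower.pairingDual ℝ V k) := by
  rw [← LinearMap.ker_eq_bot, LinearMap.ker_eq_bot']
  intro x hx
  let b := finBasis ℝ V
  let B := b.dualBasis.exteriorPower k
  refine B.ext_elem fun s => ?_
  have h1 : B.coord s = (exteriorPower.pairingDual ℝ V k).flip
      (exteriorPower.ιMulti_family ℝ k b s) := by
    rw [exteriorPower.basis_coord]
    refine exteriorPower.linearMap_ext ?_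
    ext f
    simp only [LinearMap.compAlternatingMap_apply, exteriorPower.ιMultiDual_apply_ιMulti,
      LinearMap.flip_apply, exteriorPower.ιMulti_family, exteriorPower.pairingDual_ιMulti_ιMulti]
    rw [← Matrix.det_transpose]
    congr 1
    ext i j
    simp
  have h2 := LinearMap.congr_fun h1 x
  rw [LinearMap.flip_apply, hx] at h2
  simpa using h2

theorem exists_pseudoinverse {K V W : Type*} [Field K] [AddCommGroup V] [Module K V]
    [AddCommGroup W] [Module K W] (f : V →ₗ[K] W) : ∃ s : W →ₗ[K] V, ∀ u, f (s (f u)) = f u := by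
  obtain ⟨s, hs⟩ := f.rangeRestrict.exists_rightInverse_of_surjective
    (LinearMap.range_rangeRestrict _)
  obtain ⟨s', hs'⟩ := LinearMap.exists_extend s
  refine ⟨s', fun u => ?_⟩
  have h1 : s' (f u) = s (f.rangeRestrict u) := by
    rw [← hs']; rfl
  rw [h1]
  exact congrArg Subtype.val (LinearMap.congr_fun hs (f.rangeRestrict u))

/-- `ι_X (Ω ^ n)` depends on `X` only through the form `flatPow Ω k X`, also when `Ω` is degenerate. -/
theorem contract_wedgePow_eq_zero [FiniteDimensional ℝ V] (Ω : V [⋀^Fin 2]→L[ℝ] ℝ) {n k l : ℕ}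
    (h : k + l = 2 * n) (X : ⋀[ℝ]^k V) (hX : flatPow Ω k X = 0) :
    contract h X (wedgePow Ω n).toAlternatingMap = 0 := by
  have h0 : exteriorPower.map k (flat Ω) X = 0 := by
    apply pairingDual_injective
    simpa [flatPow] using hX
  obtain ⟨s, hs⟩ := exists_pseudoinverse (flat Ω)
  have hker : ∀ (w w' : Fin (2 * n) → V), (∀ i, flat Ω (w i) = flat Ω (w' i)) →
      wedgePow Ω n w = wedgePow Ω n w' := by
    intro w w' hw
    suffices H : ∀ S : Finset (Fin (2 * n)), wedgePow Ω n (S.piecewise w w') = wedgePow Ω n w' by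
      simpa using H Finset.univ
    intro S
    induction S using Finset.induction_on with
    | empty => simp
    | insert a S ha ih =>
      rw [Finset.piecewise_insert, ← ih]
      have h1 : w a = w' a + (w a - w' a) := by abel
      rw [h1, ContinuousAlternatingMap.map_update_add]
      have h2 : Function.update (S.piecewise w w') a (w' a) = S.piecewise w w' := by
        rw [Function.update_eq_self_iff]
        simp [ha]
      rw [h2, add_eq_left]
      refine wedgePow_eq_zero_of_mem Ω (w a - w' a) (fun z => ?_) n _ a (by simp)
      have := LinearMap.congr_fun (hw a) z
      have h3 := LinearMap.congr_fun ((flat Ω).map_sub (w a) (w' a)) z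
      change flat Ω (w a - w' a) z = 0
      rw [h3, hw a]
      simp
  ext v
  have key : (exteriorPower.alternatingMapLinearEquiv (wedgePow Ω n).toAlternatingMap) ∘ₗ
      (mulRight h (exteriorPower.ιMulti ℝ l v)) =
      ((exteriorPower.alternatingMapLinearEquiv (wedgePow Ω n).toAlternatingMap) ∘ₗ
      (mulRight h (exteriorPower.ιMulti ℝ l v))) ∘ₗ exteriorPower.map k s ∘ₗ
        exteriorPower.map k (flat Ω) := by
    refine exteriorPower.linearMap_ext ?_
    ext u
    have hc : ∀ u : Fin k → V, exteriorPower.alternatingMapLinearEquiv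
        (wedgePow Ω n).toAlternatingMap (mulRight h (exteriorPower.ιMulti ℝ l v)
          (exteriorPower.ιMulti ℝ k u)) =
        wedgePow Ω n (Fin.append u v ∘ Fin.cast h.symm) := fun u =>
      contract_ιMulti h u (wedgePow Ω n).toAlternatingMap v
    simp only [LinearMap.compAlternatingMap_apply, LinearMap.comp_apply,
      exteriorPower.map_apply_ιMulti, hc]
    refine hker _ _ fun i => ?_
    simp only [Function.comp_apply]
    generalize Fin.cast h.symm i = j
    induction j using Fin.addCases with
    | left j => simp [hs]
    | right j => simp
  have := LinearMap.congr_fun key X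
  simp only [LinearMap.comp_apply, h0, map_zero] at this
  exact this

end LinearAlgebra
section Normed
variable {E : Type*} [NormedAddCommGroup E] [NormedSpace ℝ E] 

open ContinuousAlternatingMap in
theorem alternatize_wedge_right {a b c : ℕ} (h : a + b = c) (h' : a + (b + 1) = c + 1)
    (α : E [⋀^Fin a]→L[ℝ] ℝ) (f : E →L[ℝ] E [⋀^Fin b]→L[ℝ] ℝ)
    (g : E →L[ℝ] E [⋀^Fin c]→L[ℝ] ℝ) (hg : ∀ v, g v = wedge h α (f v)) :
    alternatizeUncurryFin g = (-1 : ℝ) ^ a • wedge h' α (alternatizeUncurryFin f) := by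
  ext v
  subst h
  let H : Fin (a + b + 1) → (Fin (a + b) → Fin (a + b + 1)) → ℝ := fun q r =>
    α (fun i => v (r (Fin.castAdd b i))) * f (v q) (fun i => v (r (Fin.natAdd a i)))
  have hl : alternatizeUncurryFin g v = (a.factorial * b.factorial : ℝ)⁻¹ *
      ∑ σ : Equiv.Perm (Fin (a + b + 1)), ((Equiv.Perm.sign σ : ℤ) : ℝ) *
        H (σ 0) (fun j => σ j.succ) := by
    rw [← sum_perm_succ, alternatizeUncurryFin_apply, Finset.mul_sum]
    refine Finset.sum_congr rfl fun p _ => ?_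
    rw [hg, wedge_apply]
    simp [H, Fin.removeNth]
    ring
  have hr : wedge h' α (alternatizeUncurryFin f) v =
      (a.factorial * (b + 1).factorial : ℝ)⁻¹ * ∑ p : Fin (b + 1), (-1) ^ (p : ℕ) *
      ∑ σ : Equiv.Perm (Fin (a + b + 1)), ((Equiv.Perm.sign σ : ℤ) : ℝ) *
        H (σ (Fin.natAdd a p)) (fun j => σ ((Fin.natAdd a p : Fin (a + b + 1)).succAbove j)) := by
    rw [wedge_apply]
    simp only [alternatizeUncurryFin_apply, Finset.mul_sum]
    rw [Finset.sum_comm]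
    refine Finset.sum_congr rfl fun p _ => Finset.sum_congr rfl fun σ _ => ?_
    have h1 : ∀ i : Fin a, (Fin.natAdd a p : Fin (a + b + 1)).succAbove (Fin.castAdd b i) =
        Fin.castAdd (b + 1) i := fun i => by
      rw [Fin.succAbove_of_castSucc_lt]
      · rfl
      · simp [Fin.lt_def]; omega
    have h2 : ∀ i : Fin b, (Fin.natAdd a p : Fin (a + b + 1)).succAbove (Fin.natAdd a i) =
        Fin.natAdd a (p.succAbove i) := fun i => by
      ext
      simp only [Fin.succAbove, Fin.lt_def, Fin.val_castSucc, Fin.val_natAdd]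
      split_ifs <;> simp <;> omega
    have e (g : Fin (b + 1) → E) : p.removeNth g = fun i => g (p.succAbove i) := rfl
    simp only [H, h1, h2, e]
    simp
    left
    ring
  simp only [sum_perm_cycleRange] at hr
  rw [ContinuousAlternatingMap.smul_apply, hr, hl, smul_eq_mul]
  have : ∀ p : Fin (b + 1), ∀ S : ℝ, (-1 : ℝ) ^ (p : ℕ) * ((-1) ^ ((Fin.natAdd a p : Fin (a + (b + 1))) : ℕ) * S)
      = (-1) ^ a * S := fun p S => by
    rw [Fin.val_natAdd, pow_add, ← mul_assoc, mul_left_comm, ← mul_assoc, mul_assoc ((-1 : ℝ) ^ a), ← pow_add]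
    simp
  simp only [this]
  simp [Nat.factorial_succ]
  field_simp
  rw [← pow_mul, mul_comm a 2, pow_mul]
  simp

open ContinuousAlternatingMap in
theorem alternatize_wedge_left {a b c : ℕ} (h : a + b = c) (h' : a + 1 + b = c + 1)
    (β : E [⋀^Fin b]→L[ℝ] ℝ) (f : E →L[ℝ] E [⋀^Fin a]→L[ℝ] ℝ)
    (g : E →L[ℝ] E [⋀^Fin c]→L[ℝ] ℝ) (hg : ∀ v, g v = wedge h (f v) β) :
    alternatizeUncurryFin g = wedge h' (alternatizeUncurryFin f) β := by
  ext v
  subst h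
  let H : Fin (a + b + 1) → (Fin (a + b) → Fin (a + b + 1)) → ℝ := fun q r =>
    f (v q) (fun i => v (r (Fin.castAdd b i))) * β (fun i => v (r (Fin.natAdd a i)))
  have hl : alternatizeUncurryFin g v = (a.factorial * b.factorial : ℝ)⁻¹ *
      ∑ σ : Equiv.Perm (Fin (a + b + 1)), ((Equiv.Perm.sign σ : ℤ) : ℝ) *
        H (σ 0) (fun j => σ j.succ) := by
    rw [← sum_perm_succ, alternatizeUncurryFin_apply, Finset.mul_sum]
    refine Finset.sum_congr rfl fun p _ => ?_
    rw [hg, wedge_apply]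
    simp [H, Fin.removeNth]
    ring
  have hr : wedge h' (alternatizeUncurryFin f) β v =
      ((a + 1).factorial * b.factorial : ℝ)⁻¹ * ∑ p : Fin (a + 1), (-1) ^ (p : ℕ) *
      ∑ σ : Equiv.Perm (Fin (a + b + 1)), ((Equiv.Perm.sign σ : ℤ) : ℝ) *
        H (σ (Fin.cast h' (Fin.castAdd b p)))
          (fun j => σ ((Fin.cast h' (Fin.castAdd b p)).succAbove j)) := by
    rw [wedge_apply]
    simp only [alternatizeUncurryFin_apply, Finset.mul_sum, Finset.sum_mul]
    rw [Finset.sum_comm]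
    refine Finset.sum_congr rfl fun p _ => Finset.sum_congr rfl fun σ _ => ?_
    have h1 : ∀ i : Fin a, (Fin.cast h' (Fin.castAdd b p)).succAbove (Fin.castAdd b i) =
        Fin.cast h' (Fin.castAdd b (p.succAbove i)) := fun i => by
      ext
      simp only [Fin.succAbove, Fin.lt_def, Fin.val_castSucc, Fin.val_castAdd, Fin.val_cast]
      split_ifs <;> simp
    have h2 : ∀ i : Fin b, (Fin.cast h' (Fin.castAdd b p)).succAbove (Fin.natAdd a i) =
        Fin.cast h' (Fin.natAdd (a + 1) i) := fun i => by
      rw [Fin.succAbove_of_le_castSucc]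
      · ext; simp; omega
      · simp [Fin.le_def]; omega
    have e (g : Fin (a + 1) → E) : p.removeNth g = fun i => g (p.succAbove i) := rfl
    simp only [H, h1, h2, e]
    simp
    left
    ring
  simp only [sum_perm_cycleRange] at hr
  rw [hr, hl]
  have : ∀ p : Fin (a + 1), ∀ S : ℝ, (-1 : ℝ) ^ (p : ℕ) *
      ((-1) ^ ((Fin.cast h' (Fin.castAdd b p)) : ℕ) * S) = S := fun p S => by
    rw [Fin.val_cast, Fin.val_castAdd, ← mul_assoc, ← pow_add]
    simp
  simp only [this]
  simp [Nat.factorial_succ]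
  field_simp

/-- An alternating map on a finite-dimensional space is continuous. -/
def toCont [FiniteDimensional ℝ E] {k : ℕ} (f : E [⋀^Fin k]→ₗ[ℝ] ℝ) : E [⋀^Fin k]→L[ℝ] ℝ :=
  { f with
    cont := by
      let b := finBasis ℝ E
      have : ∀ v : Fin k → E, f v = ∑ r : Fin k → Fin (finrank ℝ E),
          (∏ i, b.coord (r i) (v i)) * f (fun i => b (r i)) := by
        intro v
        have h1 : v = fun i => ∑ j, b.coord j (v i) • b j := by
          ext i; simp [b.sum_repr]
        conv_lhs => rw [h1]
        change f.toMultilinearMap _ = _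
        rw [MultilinearMap.map_sum]
        refine Finset.sum_congr rfl fun r _ => ?_
        rw [MultilinearMap.map_smul_univ]
        rfl
      change Continuous fun v => f v
      rw [funext this]
      have hb : ∀ j, Continuous (b.coord j) := fun j => LinearMap.continuous_of_finiteDimensional _
      have hp : ∀ r : Fin k → Fin (finrank ℝ E), Continuous fun v : Fin k → E =>
          ∏ i, b.coord (r i) (v i) := fun r =>
        continuous_finsetProd _ fun i _ => (hb (r i)).comp (continuous_apply i)
      exact continuous_finsetSum _ fun r _ => (hp r).mul continuous_const }

end Normed



section Normed
variable {E : Type*} [NormedAddCommGroup E] [NormedSpace ℝ E] [FiniteDimensional ℝ E]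

instance finiteDimensional_alternating (k : ℕ) : FiniteDimensional ℝ (E [⋀^Fin k]→L[ℝ] ℝ) := by
  let f : (E [⋀^Fin k]→L[ℝ] ℝ) →ₗ[ℝ] MultilinearMap ℝ (fun _ : Fin k => E) ℝ :=
    { toFun := fun ξ => ξ.toMultilinearMap
      map_add' := fun _ _ => rfl
      map_smul' := fun _ _ => rfl }
  refine FiniteDimensional.of_injective f fun ξ η h => ?_
  ext v
  exact DFunLike.congr_fun h v

/-- The wedge product as a continuous bilinear map. -/
def wedgeL {a b c : ℕ} (h : a + b = c) :
    (E [⋀^Fin a]→L[ℝ] ℝ) →L[ℝ] (E [⋀^Fin b]→L[ℝ] ℝ) →L[ℝ] (E [⋀^Fin c]→L[ℝ] ℝ) :=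
  (LinearMap.mk₂ ℝ (wedge h) (wedge_add_left h) (wedge_smul_left h)
    (wedge_add_right h) (wedge_smul_right h)).toContinuousBilinearMap

theorem wedgeL_apply {a b c : ℕ} (h : a + b = c) (α : E [⋀^Fin a]→L[ℝ] ℝ)
    (β : E [⋀^Fin b]→L[ℝ] ℝ) : wedgeL h α β = wedge h α β := rfl

/-- The Leibniz rule. -/
theorem extDeriv_wedge {a b c : ℕ} (h : a + b = c) (A : E → E [⋀^Fin a]→L[ℝ] ℝ)
    (B : E → E [⋀^Fin b]→L[ℝ] ℝ) (u : E) (hA : DifferentiableAt ℝ A u)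
    (hB : DifferentiableAt ℝ B u) :
    extDeriv (fun y => wedge h (A y) (B y)) u =
      wedge (by omega) (extDeriv A u) (B u) +
        (-1 : ℝ) ^ a • wedge (show a + (b + 1) = c + 1 by omega) (A u) (extDeriv B u) := by
  have h1 := (wedgeL h).hasFDerivAt_of_bilinear hA.hasFDerivAt hB.hasFDerivAt
  simp only [wedgeL_apply] at h1
  rw [extDeriv, h1.fderiv, ContinuousAlternatingMap.alternatizeUncurryFin_add,
    alternatize_wedge_right h (show a + (b + 1) = c + 1 by omega) (A u) (fderiv ℝ B u) _
      (fun v => rfl),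
    alternatize_wedge_left h (show a + 1 + b = c + 1 by omega) (B u) (fderiv ℝ A u) _
      (fun v => rfl)]
  exact add_comm _ _

theorem extDeriv_wedge_pullback {a b c : ℕ} (h : a + b = c) (A : E → E [⋀^Fin a]→L[ℝ] ℝ)
    (B : E → E [⋀^Fin b]→L[ℝ] ℝ) (u : E) (hA : DifferentiableAt ℝ A u)
    (hB : DifferentiableAt ℝ B u) (L : E →L[ℝ] E) :
    (extDeriv (fun y => wedge h (A y) (B y)) u).compContinuousLinearMap L =
      wedge (show a + 1 + b = c + 1 by omega) ((extDeriv A u).compContinuousLinearMap L)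
          ((B u).compContinuousLinearMap L) +
        (-1 : ℝ) ^ a • wedge (show a + (b + 1) = c + 1 by omega)
          ((A u).compContinuousLinearMap L) ((extDeriv B u).compContinuousLinearMap L) := by
  rw [extDeriv_wedge h A B u hA hB, ← wedge_comp, ← wedge_comp]
  rfl

theorem contDiffOn_wedge {a b c : ℕ} (h : a + b = c) {A : E → E [⋀^Fin a]→L[ℝ] ℝ}
    {B : E → E [⋀^Fin b]→L[ℝ] ℝ} {s : Set E} (hA : ContDiffOn ℝ ∞ A s)
    (hB : ContDiffOn ℝ ∞ B s) : ContDiffOn ℝ ∞ (fun u => wedge h (A u) (B u)) s := by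
  have h1 : ContDiffOn ℝ ∞ (fun u => wedgeL h (A u)) s := by fun_prop
  have h2 := ContDiffOn.clm_apply h1 hB
  exact h2

open Classical in
/-- The symplectic star at a point: if `ξ` is the image of the `k`-vector `X` under the extension of
`v ↦ ι_v Ω`, then `⋆ ξ = ι_X (Ω ^ n)`. By `starAt_eq` this does not depend on the choice of `X`. In
particular `X` may be taken in the exterior power of any complement of the kernel of `Ω`. The value is
`0` if `k > 2 n` or if there is no such `X`. -/
def starAt (Ω : E [⋀^Fin 2]→L[ℝ] ℝ) (n : ℕ) {k : ℕ} (ξ : E [⋀^Fin k]→L[ℝ] ℝ) :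
    E [⋀^Fin (2 * n - k)]→L[ℝ] ℝ :=
  if h : k ≤ 2 * n ∧ ∃ X : ⋀[ℝ]^k E, flatPow Ω k X = ξ.toAlternatingMap then
    toCont (contract (Nat.add_sub_cancel' h.1) h.2.choose (wedgePow Ω n).toAlternatingMap)
  else 0

theorem starAt_eq (Ω : E [⋀^Fin 2]→L[ℝ] ℝ) (n : ℕ) {k : ℕ} (hk : k ≤ 2 * n)
    (ξ : E [⋀^Fin k]→L[ℝ] ℝ) (X : ⋀[ℝ]^k E) (hX : flatPow Ω k X = ξ.toAlternatingMap) :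
    starAt Ω n ξ =
      toCont (contract (Nat.add_sub_cancel' hk) X (wedgePow Ω n).toAlternatingMap) := by
  have h : k ≤ 2 * n ∧ ∃ X : ⋀[ℝ]^k E, flatPow Ω k X = ξ.toAlternatingMap := ⟨hk, X, hX⟩
  rw [starAt, dif_pos h]
  congr 1
  rw [← sub_eq_zero, ← contract_sub]
  apply contract_wedgePow_eq_zero
  rw [map_sub, h.2.choose_spec, hX, sub_self]

end Normed

section Manifold

variable (E : Type*) [NormedAddCommGroup E] [NormedSpace ℝ E]
  (M : Type*) [TopologicalSpace M] [ChartedSpace E M]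

/-- Fields of alternating `k`-forms on the manifold `M`. The tangent space `TangentSpace 𝓘(ℝ, E) x` of
a manifold modelled on `E` is by definition a copy of `E`. Smoothness is the predicate `IsSmooth`. -/
def DiffForm (k : ℕ) : Type _ := M → E [⋀^Fin k]→L[ℝ] ℝ

instance (k : ℕ) : AddCommGroup (DiffForm E M k) :=
  inferInstanceAs (AddCommGroup (M → E [⋀^Fin k]→L[ℝ] ℝ))

instance (k : ℕ) : Module ℝ (DiffForm E M k) :=
  inferInstanceAs (Module ℝ (M → E [⋀^Fin k]→L[ℝ] ℝ))

variable {E M}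

/-- The differential `T_x M → E` of a chart. -/
def derivAt (φ : OpenPartialHomeomorph M E) (x : M) : E →L[ℝ] E :=
  mfderiv 𝓘(ℝ, E) 𝓘(ℝ, E) φ x

/-- The differential at `u` of the inverse of a chart, from `E` to the tangent space of `M` at `φ⁻¹ u`. -/
def derivSymmAt (φ : OpenPartialHomeomorph M E) (u : E) : E →L[ℝ] E :=
  mfderiv 𝓘(ℝ, E) 𝓘(ℝ, E) φ.symm u

/-- The form `ξ` written in the preferred chart at `x₀`, that is, its pullback under the inverse of
the chart. Only the values on the target of the chart are meaningful. -/
def inChart {k : ℕ} (x₀ : M) (ξ : DiffForm E M k) : E → E [⋀^Fin k]→L[ℝ] ℝ := fun u =>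
  (ξ ((chartAt E x₀).symm u)).compContinuousLinearMap
    (derivSymmAt (chartAt E x₀) u)

/-- Smoothness of a form: its expression in every preferred chart is smooth. -/
def IsSmooth {k : ℕ} (ξ : DiffForm E M k) : Prop :=
  ∀ x₀ : M, ContDiffOn ℝ ∞ (inChart x₀ ξ) (chartAt E x₀).target

/-- The exterior derivative, computed at `x` in the preferred chart at `x`. -/
def extD {k : ℕ} (ξ : DiffForm E M k) : DiffForm E M (k + 1) := fun x =>
  (extDeriv (inChart x ξ) (chartAt E x x)).compContinuousLinearMap
    (derivAt (chartAt E x) x)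

/-- The wedge product of forms on `M`. -/
def wedgeForm {a b c : ℕ} (h : a + b = c) (α : DiffForm E M a) (β : DiffForm E M b) :
    DiffForm E M c := fun x => wedge h (α x) (β x)

/-- The power `Ω ^ k` of a `2`-form on `M`. -/
def powForm (Ω : DiffForm E M 2) (k : ℕ) : DiffForm E M (2 * k) := fun x => wedgePow (Ω x) k

variable (E M) in
/-- Vector fields on `M` (not necessarily smooth). -/
abbrev VField : Type _ := (x : M) → TangentSpace 𝓘(ℝ, E) x

/-- The interior product `ι_T ξ = ξ (T, ·, …, ·)` of a form of positive degree. -/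
def interiorSucc (T : VField E M) {k : ℕ} (ξ : DiffForm E M (k + 1)) : DiffForm E M k := fun x =>
  ContinuousAlternatingMap.curryLeft (E := E) (n := k) (ξ x) (T x)

/-- The interior product `ι_T ξ`, which is `0` on forms of degree `0`. -/
def interior (T : VField E M) : {k : ℕ} → DiffForm E M k → DiffForm E M (k - 1)
  | 0, _ => 0
  | _ + 1, ξ => interiorSucc T ξ

/-- The Lie derivative `L_T ξ = d (ι_T ξ) + ι_T (d ξ)` (Cartan's formula). -/
def lieDeriv (T : VField E M) : {k : ℕ} → DiffForm E M k → DiffForm E M k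
  | 0, ξ => interiorSucc T (extD ξ)
  | _ + 1, ξ => extD (interiorSucc T ξ) + interiorSucc T (extD ξ)

variable (E M) in
/-- A regular foliation of dimension `p` of `M`, given by its tangent distribution: around each point
there is a chart `φ` in the maximal smooth atlas of `M` and a `p`-dimensional subspace `K` of the model
space `E` such that the plaques, whose tangent spaces make up the distribution over the domain of `φ`,
are the slices of `φ` parallel to `K`, i.e. the fibres of the submersion `φ` followed by `E → E / K`.
The leaves are the maximal connected integral manifolds. -/
structure Foliation (p : ℕ) where
  tangent : (x : M) → Submodule ℝ (TangentSpace 𝓘(ℝ, E) x)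
  exists_flat_chart : ∀ x : M, ∃ φ ∈ IsManifold.maximalAtlas 𝓘(ℝ, E) ∞ M, x ∈ φ.source ∧
    ∃ K : Submodule ℝ E, finrank ℝ K = p ∧ ∀ y ∈ φ.source, ∀ v : TangentSpace 𝓘(ℝ, E) y,
      v ∈ tangent y ↔ derivAt φ y v ∈ K

/-- Smooth vector fields tangent to the foliation. -/
structure Foliation.IsTangent [IsManifold 𝓘(ℝ, E) ∞ M] {p : ℕ} (F : Foliation E M p)
    (T : VField E M) : Prop where
  smooth : ContMDiff 𝓘(ℝ, E) 𝓘(ℝ, E).tangent ∞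
    (fun x => (⟨x, T x⟩ : TangentBundle 𝓘(ℝ, E) M))
  mem : ∀ x, T x ∈ F.tangent x

/-- Basic forms: `ι_T ξ = L_T ξ = 0` for every vector field `T` tangent to the foliation. -/
structure IsBasic [IsManifold 𝓘(ℝ, E) ∞ M] {p : ℕ} (F : Foliation E M p) {k : ℕ}
    (ξ : DiffForm E M k) : Prop where
  smooth : IsSmooth ξ
  interior_eq_zero : ∀ T : VField E M, F.IsTangent T → interior T ξ = 0
  lieDeriv_eq_zero : ∀ T : VField E M, F.IsTangent T → lieDeriv T ξ = 0

theorem inChart_add {k : ℕ} (x₀ : M) (ξ η : DiffForm E M k) :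
    inChart x₀ (ξ + η) = inChart x₀ ξ + inChart x₀ η := rfl

theorem inChart_smul {k : ℕ} (x₀ : M) (r : ℝ) (ξ : DiffForm E M k) :
    inChart x₀ (r • ξ) = r • inChart x₀ ξ := rfl

theorem inChart_zero {k : ℕ} (x₀ : M) : inChart x₀ (0 : DiffForm E M k) = 0 := rfl

theorem inChart_wedgeForm {a b c : ℕ} (h : a + b = c) (α : DiffForm E M a) (β : DiffForm E M b)
    (x₀ : M) : inChart x₀ (wedgeForm h α β) =
      fun u => wedge h (inChart x₀ α u) (inChart x₀ β u) := by
  ext1 u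
  exact wedge_comp h _ _ _

theorem IsSmooth.differentiableAt {k : ℕ} {ξ : DiffForm E M k} (hξ : IsSmooth ξ) (x : M) :
    DifferentiableAt ℝ (inChart x ξ) (chartAt E x x) :=
  ((hξ x).contDiffAt ((chartAt E x).open_target.mem_nhds (mem_chart_target E x))).differentiableAt
    (by simp)

theorem IsSmooth.zero {k : ℕ} : IsSmooth (0 : DiffForm E M k) := fun x₀ => by
  rw [inChart_zero]; exact contDiffOn_const

theorem IsSmooth.add {k : ℕ} {ξ η : DiffForm E M k} (hξ : IsSmooth ξ) (hη : IsSmooth η) :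
    IsSmooth (ξ + η) := fun x₀ => (hξ x₀).add (hη x₀)

theorem IsSmooth.smul {k : ℕ} (r : ℝ) {ξ : DiffForm E M k} (hξ : IsSmooth ξ) :
    IsSmooth (r • ξ) := fun x₀ => by
  rw [inChart_smul]; exact (hξ x₀).const_smul r

theorem IsSmooth.wedgeForm [FiniteDimensional ℝ E] {a b c : ℕ} (h : a + b = c)
    {α : DiffForm E M a} {β : DiffForm E M b} (hα : IsSmooth α) (hβ : IsSmooth β) :
    IsSmooth (wedgeForm h α β) := fun x₀ => by
  rw [inChart_wedgeForm]
  exact contDiffOn_wedge h (hα x₀) (hβ x₀)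

theorem extD_add {k : ℕ} {ξ η : DiffForm E M k} (hξ : IsSmooth ξ) (hη : IsSmooth η) :
    extD (ξ + η) = extD ξ + extD η := by
  funext x
  change ContinuousAlternatingMap.compContinuousLinearMap _ _ = _
  rw [inChart_add, extDeriv_add (hξ.differentiableAt x) (hη.differentiableAt x)]
  rfl

theorem extD_smul {k : ℕ} (r : ℝ) (ξ : DiffForm E M k) : extD (r • ξ) = r • extD ξ := by
  funext x
  change ContinuousAlternatingMap.compContinuousLinearMap _ _ = _
  rw [inChart_smul, extDeriv_smul]
  rfl

theorem extD_zero {k : ℕ} : extD (0 : DiffForm E M k) = 0 := by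
  simpa using extD_smul (0 : ℝ) (0 : DiffForm E M k)

theorem comp_eq_of_eq_id {k : ℕ} (f : M → E [⋀^Fin k]→L[ℝ] ℝ) {y x : M} (h : y = x)
    {L : E →L[ℝ] E} (hL : L = ContinuousLinearMap.id ℝ E) :
    (f y).compContinuousLinearMap L = f x := by
  subst h hL
  rfl

theorem inChart_pullback [IsManifold 𝓘(ℝ, E) ∞ M] {k : ℕ} (ξ : DiffForm E M k) (x : M) :
    (inChart x ξ (chartAt E x x)).compContinuousLinearMap
      (derivAt (chartAt E x) x) = ξ x := by
  have : IsManifold 𝓘(ℝ, E) 1 M := IsManifold.of_le (n := ∞) (by simp)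
  exact comp_eq_of_eq_id ξ ((chartAt E x).left_inv (mem_chart_source E x))
    ((mdifferentiable_chart (I := 𝓘(ℝ, E)) x).symm_comp_deriv (mem_chart_source E x))

theorem extD_wedgeForm [FiniteDimensional ℝ E] [IsManifold 𝓘(ℝ, E) ∞ M] {a b c : ℕ}
    (h : a + b = c) {α : DiffForm E M a} {β : DiffForm E M b} (hα : IsSmooth α)
    (hβ : IsSmooth β) :
    extD (wedgeForm h α β) = wedgeForm (show a + 1 + b = c + 1 by omega) (extD α) β +
      (-1 : ℝ) ^ a • wedgeForm (show a + (b + 1) = c + 1 by omega) α (extD β) := by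
  funext x
  have key := extDeriv_wedge_pullback h _ _ _ (hα.differentiableAt x) (hβ.differentiableAt x)
    (derivAt (chartAt E x) x)
  rw [← inChart_wedgeForm, inChart_pullback α x, inChart_pullback β x] at key
  exact key

theorem interior_eq_zero_iff (T : VField E M) {k : ℕ} (ξ : DiffForm E M k) :
    interior T ξ = 0 ↔ ∀ (x : M) (w : Fin k → E) (i : Fin k), w i = T x → ξ x w = 0 := by
  cases k with
  | zero => exact ⟨fun _ _ _ i => i.elim0, fun _ => rfl⟩
  | succ k =>
    constructor
    · intro h x w i hi
      have h1 := ContinuousAlternatingMap.neg_one_pow_smul_map_insertNth (E := E) (ξ x) i (T x)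
        (i.removeNth w)
      rw [← hi, Fin.insertNth_self_removeNth] at h1
      have h2 : ξ x (Matrix.vecCons (T x) (i.removeNth w)) = 0 :=
        DFunLike.congr_fun (congrFun h x) (i.removeNth w)
      rw [hi, h2] at h1
      simpa using h1
    · intro h
      funext x
      ext w
      exact h x (Matrix.vecCons (T x) w) 0 rfl

theorem lieDeriv_eq_of_interior (T : VField E M) {k : ℕ} (ξ : DiffForm E M k)
    (h : interior T ξ = 0) : lieDeriv T ξ = interiorSucc T (extD ξ) := by
  cases k with
  | zero => rfl
  | succ k =>
    have h1 : interiorSucc T ξ = 0 := h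
    rw [lieDeriv, h1, extD_zero, zero_add]

section Basic

variable [IsManifold 𝓘(ℝ, E) ∞ M] {p : ℕ} {F : Foliation E M p}

theorem isBasic_iff {k : ℕ} (ξ : DiffForm E M k) : IsBasic F ξ ↔ IsSmooth ξ ∧
    ∀ T : VField E M, F.IsTangent T →
      (∀ (x : M) (w : Fin k → E) (i : Fin k), w i = T x → ξ x w = 0) ∧
        interiorSucc T (extD ξ) = 0 := by
  constructor
  · intro h
    refine ⟨h.smooth, fun T hT => ⟨(interior_eq_zero_iff T ξ).1 (h.interior_eq_zero T hT), ?_⟩⟩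
    rw [← lieDeriv_eq_of_interior T ξ (h.interior_eq_zero T hT)]
    exact h.lieDeriv_eq_zero T hT
  · rintro ⟨h1, h2⟩
    have h3 : ∀ T, F.IsTangent T → interior T ξ = 0 := fun T hT =>
      (interior_eq_zero_iff T ξ).2 (h2 T hT).1
    refine ⟨h1, h3, fun T hT => ?_⟩
    rw [lieDeriv_eq_of_interior T ξ (h3 T hT)]
    exact (h2 T hT).2

variable (F) in
/-- The space of basic `k`-forms. -/
def basicForms (k : ℕ) : Submodule ℝ (DiffForm E M k) where
  carrier := {ξ | IsBasic F ξ}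
  zero_mem' := by
    refine (isBasic_iff _).2 ⟨IsSmooth.zero, fun T _ => ⟨fun _ _ _ _ => rfl, ?_⟩⟩
    rw [extD_zero]
    rfl
  add_mem' := by
    intro ξ η hξ hη
    rw [Set.mem_ofPred_eq, isBasic_iff] at *
    refine ⟨hξ.1.add hη.1, fun T hT => ⟨fun x w i hi => ?_, ?_⟩⟩
    · change ξ x w + η x w = 0
      rw [(hξ.2 T hT).1 x w i hi, (hη.2 T hT).1 x w i hi, add_zero]
    · rw [extD_add hξ.1 hη.1]
      change interiorSucc T (extD ξ) + interiorSucc T (extD η) = 0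
      rw [(hξ.2 T hT).2, (hη.2 T hT).2, add_zero]
  smul_mem' := by
    intro r ξ hξ
    rw [Set.mem_ofPred_eq, isBasic_iff] at *
    refine ⟨hξ.1.smul r, fun T hT => ⟨fun x w i hi => ?_, ?_⟩⟩
    · change r * ξ x w = 0
      rw [(hξ.2 T hT).1 x w i hi, mul_zero]
    · rw [extD_smul]
      have h1 : interiorSucc T (r • extD ξ) = r • interiorSucc T (extD ξ) := by
        funext x
        ext w
        rfl
      rw [h1, (hξ.2 T hT).2, smul_zero]

variable (F) in
/-- The space of closed basic `k`-forms. -/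
def closedBasicForms (k : ℕ) : Submodule ℝ (DiffForm E M k) where
  carrier := {ξ | ξ ∈ basicForms F k ∧ extD ξ = 0}
  zero_mem' := ⟨Submodule.zero_mem _, extD_zero⟩
  add_mem' := by
    rintro ξ η ⟨hξ, hξ'⟩ ⟨hη, hη'⟩
    exact ⟨Submodule.add_mem _ hξ hη, by rw [extD_add hξ.smooth hη.smooth, hξ', hη', add_zero]⟩
  smul_mem' := by
    rintro r ξ ⟨hξ, hξ'⟩
    exact ⟨Submodule.smul_mem _ r hξ, by rw [extD_smul, hξ', smul_zero]⟩

variable (F) in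
/-- A form is exact in the basic complex if it is the differential of a basic form; in degree `0`
only the zero form is. -/
def IsBasicExact : {k : ℕ} → DiffForm E M k → Prop
  | 0, ξ => ξ = 0
  | k + 1, ξ => ∃ η ∈ basicForms F k, extD η = ξ

variable (F) in
/-- The coboundaries of the basic complex, inside the space of cocycles. -/
def exactBasicForms (k : ℕ) : Submodule ℝ (closedBasicForms F k) where
  carrier := {ξ | IsBasicExact F ξ.1}
  zero_mem' := by
    cases k with
    | zero => rfl
    | succ k => exact ⟨0, Submodule.zero_mem _, extD_zero⟩
  add_mem' := by
    rintro ⟨ξ, _⟩ ⟨η, _⟩ hξ hη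
    cases k with
    | zero =>
      change ξ = 0 at hξ
      change η = 0 at hη
      change ξ + η = 0
      rw [hξ, hη, add_zero]
    | succ k =>
      obtain ⟨α, hα, rfl⟩ := hξ
      obtain ⟨β, hβ, rfl⟩ := hη
      exact ⟨α + β, Submodule.add_mem _ hα hβ, extD_add hα.smooth hβ.smooth⟩
  smul_mem' := by
    rintro r ⟨ξ, _⟩ hξ
    cases k with
    | zero =>
      change ξ = 0 at hξ
      change r • ξ = 0
      rw [hξ, smul_zero]
    | succ k =>
      obtain ⟨α, hα, rfl⟩ := hξ
      exact ⟨r • α, Submodule.smul_mem _ r hα, extD_smul r α⟩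

variable (F) in
/-- The basic cohomology `H^k_B(M, F)`: closed basic `k`-forms modulo differentials of basic forms. -/
abbrev BasicCohomology (k : ℕ) : Type _ := closedBasicForms F k ⧸ exactBasicForms F k

/-- The cohomology class of a closed basic form. -/
abbrev basicClass {k : ℕ} (ξ : closedBasicForms F k) : BasicCohomology F k :=
  (exactBasicForms F k).mkQ ξ

section Lefschetz

variable [FiniteDimensional ℝ E]

theorem wedgeForm_mem_basicForms {a b c : ℕ} (h : a + b = c) {α : DiffForm E M a}
    {β : DiffForm E M b} (hα : α ∈ closedBasicForms F a) (hβ : β ∈ basicForms F b) :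
    wedgeForm h α β ∈ basicForms F c := by
  have hα1 := (isBasic_iff α).1 hα.1
  have hβ1 := (isBasic_iff β).1 hβ
  refine (isBasic_iff _).2 ⟨hα1.1.wedgeForm h hβ1.1, fun T hT => ⟨fun x w i hi => ?_, ?_⟩⟩
  · exact wedge_eq_zero_of_mem h (α x) (β x) (T x) ((hα1.2 T hT).1 x) ((hβ1.2 T hT).1 x) w i hi
  · rw [extD_wedgeForm h hα1.1 hβ1.1, hα.2]
    funext x
    ext w
    have hd : ∀ (w : Fin (b + 1) → E) (i : Fin (b + 1)), w i = T x → extD β x w = 0 :=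
      (interior_eq_zero_iff T (extD β)).1 (hβ1.2 T hT).2 x
    have h1 := wedge_eq_zero_of_mem (show a + (b + 1) = c + 1 by omega) (α x) (extD β x) (T x)
      ((hα1.2 T hT).1 x) hd (Matrix.vecCons (T x) w) 0 rfl
    have h2 := wedge_eq_zero_of_mem (show a + 1 + b = c + 1 by omega) 0 (β x) (T x)
      (fun _ _ _ => rfl) ((hβ1.2 T hT).1 x) (Matrix.vecCons (T x) w) 0 rfl
    change wedge _ 0 (β x) (Matrix.vecCons (T x) w) +
      (-1 : ℝ) ^ a * wedge _ (α x) (extD β x) (Matrix.vecCons (T x) w) = 0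
    rw [h1, h2, mul_zero, add_zero]

theorem wedgeForm_zero_left {a b c : ℕ} (h : a + b = c) (β : DiffForm E M b) :
    wedgeForm h (0 : DiffForm E M a) β = 0 := by
  funext x
  have h1 := wedge_smul_left h (0 : ℝ) (0 : E [⋀^Fin a]→L[ℝ] ℝ) (β x)
  rw [zero_smul, zero_smul] at h1
  exact h1

theorem wedgeForm_zero_right {a b c : ℕ} (h : a + b = c) (α : DiffForm E M a) :
    wedgeForm h α (0 : DiffForm E M b) = 0 := by
  funext x
  have h1 := wedge_smul_right h (0 : ℝ) (α x) (0 : E [⋀^Fin b]→L[ℝ] ℝ)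
  rw [zero_smul, zero_smul] at h1
  exact h1

theorem wedgeForm_mem_closedBasicForms {a b c : ℕ} (h : a + b = c) {α : DiffForm E M a}
    {β : DiffForm E M b} (hα : α ∈ closedBasicForms F a) (hβ : β ∈ closedBasicForms F b) :
    wedgeForm h α β ∈ closedBasicForms F c := by
  refine ⟨wedgeForm_mem_basicForms h hα hβ.1, ?_⟩
  rw [extD_wedgeForm h hα.1.smooth hβ.1.smooth, hα.2, hβ.2, wedgeForm_zero_left,
    wedgeForm_zero_right, smul_zero, add_zero]

theorem powForm_mem_closedBasicForms {Ω : DiffForm E M 2} (hΩ : Ω ∈ closedBasicForms F 2)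
    (k : ℕ) : powForm Ω k ∈ closedBasicForms F (2 * k) := by
  induction k with
  | zero =>
    have h1 : extD (powForm Ω 0) = 0 := by
      funext x
      have h2 : inChart x (powForm Ω 0) = fun _ =>
          ContinuousAlternatingMap.constOfIsEmpty ℝ E (Fin 0) (1 : ℝ) := rfl
      change ContinuousAlternatingMap.compContinuousLinearMap
        (extDeriv (inChart x (powForm Ω 0)) (chartAt E x x)) _ = 0
      rw [h2, extDeriv_constOfIsEmpty]
      ext v
      simp
    have h3 : IsSmooth (powForm Ω 0) := fun x₀ => by
      have h2 : inChart x₀ (powForm Ω 0) = fun _ =>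
          ContinuousAlternatingMap.constOfIsEmpty ℝ E (Fin 0) (1 : ℝ) := rfl
      rw [h2]
      exact contDiffOn_const
    refine ⟨(isBasic_iff _).2 ⟨h3, fun T _ => ⟨fun _ _ i => i.elim0, ?_⟩⟩,
      h1⟩
    rw [h1]
    rfl
  | succ k ih => exact wedgeForm_mem_closedBasicForms (show 2 * k + 2 = 2 * (k + 1) by ring) ih hΩ

/-- The wedge product with a fixed closed basic form, on closed basic forms. -/
def wedgeClosed {a b c : ℕ} (h : a + b = c) (α : closedBasicForms F a) :
    closedBasicForms F b →ₗ[ℝ] closedBasicForms F c where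
  toFun β := ⟨wedgeForm h α.1 β.1, wedgeForm_mem_closedBasicForms h α.2 β.2⟩
  map_add' β β' := Subtype.ext (funext fun x => wedge_add_right h (α.1 x) (β.1 x) (β'.1 x))
  map_smul' r β := Subtype.ext (funext fun x => wedge_smul_right h r (α.1 x) (β.1 x))

theorem exactBasicForms_le_comap {a b c : ℕ} (h : a + b = c) (α : closedBasicForms F a) :
    exactBasicForms F b ≤ (exactBasicForms F c).comap (wedgeClosed h α) := by
  subst h
  rintro ⟨β, hβ⟩ hex
  cases b with
  | zero =>
    have h1 : (⟨β, hβ⟩ : closedBasicForms F 0) = 0 := Subtype.ext hex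
    rw [h1]
    exact Submodule.zero_mem _
  | succ b =>
    obtain ⟨η, hη, rfl⟩ := hex
    refine ⟨(-1 : ℝ) ^ a • wedgeForm rfl α.1 η,
      Submodule.smul_mem _ _ (wedgeForm_mem_basicForms rfl α.2 hη), ?_⟩
    rw [extD_smul, extD_wedgeForm rfl α.2.1.smooth hη.smooth, α.2.2, wedgeForm_zero_left, zero_add,
      smul_smul, ← mul_pow]
    simp
    rfl

/-- The map `[ξ] ↦ [α ∧ ξ]` on basic cohomology, for a closed basic form `α`. -/
def wedgeCohomology {a b c : ℕ} (h : a + b = c) (α : closedBasicForms F a) :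
    BasicCohomology F b →ₗ[ℝ] BasicCohomology F c :=
  (exactBasicForms F b).mapQ (exactBasicForms F c) (wedgeClosed h α)
    (exactBasicForms_le_comap h α)

variable (F) in
/-- A transversely symplectic structure: a closed basic `2`-form `Ω` that is nondegenerate in the
transverse directions, i.e. whose kernel at each point is contained in (hence equal to) the tangent
space of the leaf. -/
structure IsTransverselySymplectic (Ω : DiffForm E M 2) : Prop where
  basic : IsBasic F Ω
  closed : extD Ω = 0
  nondegenerate : ∀ (x : M) (v : TangentSpace 𝓘(ℝ, E) x),
    (∀ w : TangentSpace 𝓘(ℝ, E) x, Ω x ![v, w] = 0) → v ∈ F.tangent x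

/-- The map `L^k : [ξ] ↦ [Ω ^ k ∧ ξ]` from `H^i_B` to `H^j_B`, where `j = 2 k + i`. -/
def lefschetz {Ω : DiffForm E M 2} (hΩ : IsTransverselySymplectic F Ω) (k : ℕ) {i j : ℕ}
    (h : 2 * k + i = j) : BasicCohomology F i →ₗ[ℝ] BasicCohomology F j :=
  wedgeCohomology h
    ⟨powForm Ω k, powForm_mem_closedBasicForms (F := F) ⟨hΩ.basic, hΩ.closed⟩ k⟩

end Lefschetz

end Basic

section Star

variable [FiniteDimensional ℝ E]

/-- The transversal symplectic star operator from `k`-forms to `(2 n - k)`-forms. -/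
def star (n : ℕ) (Ω : DiffForm E M 2) {k : ℕ} (ξ : DiffForm E M k) : DiffForm E M (2 * n - k) :=
  fun x => starAt (Ω x) n (ξ x)

/-- The codifferential `δ ξ = (-1) ^ k ⋆ d ⋆ ξ` of a `k`-form. For `1 ≤ k ≤ 2 n` its degree
`2 n - ((2 n - k) + 1)` is `k - 1`; for `k = 0` and for `k > 2 n` it is zero. -/
def codiff (n : ℕ) (Ω : DiffForm E M 2) {k : ℕ} (ξ : DiffForm E M k) :
    DiffForm E M (2 * n - (2 * n - k + 1)) :=
  (-1 : ℝ) ^ k • star n Ω (extD (star n Ω ξ))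

/-- Harmonic forms: `d ξ = 0` and `δ ξ = 0`. -/
structure IsHarmonic (n : ℕ) (Ω : DiffForm E M 2) {k : ℕ} (ξ : DiffForm E M k) : Prop where
  closed : extD ξ = 0
  coclosed : codiff n Ω ξ = 0

end Star

end Manifold

end BasicHodge

end

open scoped Manifold ContDiff
open Module

set_option linter.unusedSectionVars false

/-! At each point `Ω` is a symplectic form on the normal space of the leaf, so basic forms carry the
`sl₂` calculus of symplectic geometry, with `L = Ω ∧ ·` and a contraction operator `Λ` (`lam`). The
crux is a hard Lefschetz property of the basic forms themselves, before passing to cohomology: for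
`k ≤ n`, `L^k` maps basic forms of degree `n - k` bijectively onto those of degree `n + k`, and it
commutes with `d`. Injectivity is pointwise (`lef_pow_injective`). For surjectivity there is an
explicit pointwise inverse (`lefInv_spec`), hence a smooth one, and the preimage of a basic form is
basic because `L^k` is injective even on forms not known to be horizontal
(`exists_wedgeForm_powForm_eq`). So every basic form is a sum of terms `L^r p` with `p` basic and
primitive. If `p` has degree `n - s`, then `⋆ L^r p` is a nonzero multiple of `L^(s-r) p`
(`starF_lef_pow`). As `⋆` is injective on horizontal forms, harmonic means that `ξ` and `⋆ ξ` are
both closed.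

The rest is algebra in a graded module with operators `L`, `D` and a star with these properties
(`IsLefschetzModule`, `IsLefschetzStar`).

Let `x = L^s x'` be harmonic of degree `n + s`, and `x' = x₀ + L x₁` with `x₀` primitive. Then `⋆ x
= c x₀ + L y`, and its closedness gives `c D x' = L ζ` with `ζ = c D x₁ - D y` of degree `n - s -
1`. Since `L^s D x' = D x = 0`, injectivity of `L^(s+1)` gives `ζ = 0`. Thus `x'` is closed and the
class of `x` is in the image of `L^s` (`exists_closed_of_harmonic`).

Conversely, let `x` be closed of degree `n - s`. Surjectivity of `L^(s+2)` on cohomology gives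
`L^(s+1) x = L^(s+2) y + D η` with `y` closed, and `η = L^(s+1) θ` by hard Lefschetz on forms. Then
`p = x - L y - D θ` is closed and primitive. By induction `y` is cohomologous to some `z` with every
`⋆ L^j z` closed, and `p + L z` is a harmonic representative of `x` (`exists_harmonic_L_pow`).
Degrees above `n` are reached by applying `L^s`. -/

noncomputable section
namespace BasicHodge

/-! ### Interior and exterior products on forms of all degrees -/

section Operators

open ContinuousAlternatingMap

variable {E : Type*} [NormedAddCommGroup E] [NormedSpace ℝ E]

/-- The product over all degrees of the spaces of alternating forms on `E`. -/
def Forms (E : Type*) [NormedAddCommGroup E] [NormedSpace ℝ E] : Type _ :=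
  ∀ k : ℕ, E [⋀^Fin k]→L[ℝ] ℝ

instance : AddCommGroup (Forms E) := inferInstanceAs (AddCommGroup (∀ k : ℕ, E [⋀^Fin k]→L[ℝ] ℝ))

instance : Module ℝ (Forms E) := inferInstanceAs (Module ℝ (∀ k : ℕ, E [⋀^Fin k]→L[ℝ] ℝ))

namespace Forms

theorem add_apply (f g : Forms E) (k : ℕ) : (f + g) k = f k + g k := rfl

theorem neg_apply (f : Forms E) (k : ℕ) : (-f) k = -f k := rfl

theorem sub_apply (f g : Forms E) (k : ℕ) : (f - g) k = f k - g k := rfl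

theorem smul_apply (r : ℝ) (f : Forms E) (k : ℕ) : (r • f) k = r • f k := rfl

theorem zero_apply (k : ℕ) : (0 : Forms E) k = 0 := rfl

/-- The projection to degree `k`. -/
def proj (k : ℕ) : Forms E →ₗ[ℝ] E [⋀^Fin k]→L[ℝ] ℝ where
  toFun f := f k
  map_add' _ _ := rfl
  map_smul' _ _ := rfl

theorem sum_apply {ι : Type*} (s : Finset ι) (f : ι → Forms E) (k : ℕ) :
    (∑ i ∈ s, f i) k = ∑ i ∈ s, f i k :=
  _root_.map_sum (proj k) f s

@[ext] theorem ext {f g : Forms E} (h : ∀ k, f k = g k) : f = g := funext h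

/-- The inclusion of the forms of degree `k`. -/
def single (k : ℕ) : (E [⋀^Fin k]→L[ℝ] ℝ) →ₗ[ℝ] Forms E :=
  LinearMap.single ℝ (fun k => E [⋀^Fin k]→L[ℝ] ℝ) k

theorem single_same (k : ℕ) (ξ : E [⋀^Fin k]→L[ℝ] ℝ) : single k ξ k = ξ := Pi.single_eq_same _ _

theorem single_of_ne {k l : ℕ} (h : l ≠ k) (ξ : E [⋀^Fin k]→L[ℝ] ℝ) : single k ξ l = 0 :=
  Pi.single_eq_of_ne h _

end Forms

/-- The interior product with `v` on forms of all degrees. -/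
def ins (v : E) : Forms E →ₗ[ℝ] Forms E where
  toFun f k := curryLeft (f (k + 1)) v
  map_add' _ _ := rfl
  map_smul' _ _ := rfl

theorem ins_apply (v : E) (f : Forms E) (k : ℕ) : ins v f k = curryLeft (f (k + 1)) v := rfl

theorem ins_add_left (v w : E) (f : Forms E) : ins (v + w) f = ins v f + ins w f := by
  ext1 k
  exact _root_.map_add (curryLeft (f (k + 1))) v w

theorem ins_smul_left (r : ℝ) (v : E) (f : Forms E) : ins (r • v) f = r • ins v f := by
  ext1 k
  exact _root_.map_smul (curryLeft (f (k + 1))) r v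

theorem ins_neg_left (v : E) (f : Forms E) : ins (-v) f = - ins v f := by
  simpa using ins_smul_left (-1 : ℝ) v f

theorem ins_sub_left (v w : E) (f : Forms E) : ins (v - w) f = ins v f - ins w f := by
  rw [sub_eq_add_neg, ins_add_left, ins_neg_left, sub_eq_add_neg]

theorem ins_self (v : E) (f : Forms E) : ins v (ins v f) = 0 :=
  Forms.ext fun k => curryLeft_same (f (k + 1 + 1)) v

theorem ins_ins (v w : E) (f : Forms E) : ins v (ins w f) = - ins w (ins v f) := by
  have h := ins_self (v + w) f
  rw [ins_add_left, ins_add_left v w, map_add, map_add, ins_self, ins_self, zero_add, add_zero] at h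
  exact eq_neg_of_add_eq_zero_left h

/-- A form of positive degree is determined by its interior products. -/
theorem eq_of_curryLeft {k : ℕ} {α β : E [⋀^Fin (k + 1)]→L[ℝ] ℝ}
    (h : ∀ v, curryLeft α v = curryLeft β v) : α = β := by
  ext w
  have h1 := DFunLike.congr_fun (h (w 0)) (Fin.tail w)
  have h2 : Matrix.vecCons (w 0) (Fin.tail w) = w := Fin.cons_self_tail w
  simpa [h2] using h1

/-- The exterior product `θ ∧ ξ` of a `1`-form with a form. -/
def oneWedge {k : ℕ} : (E →L[ℝ] ℝ) →ₗ[ℝ] (E [⋀^Fin k]→L[ℝ] ℝ) →ₗ[ℝ] (E [⋀^Fin (k + 1)]→L[ℝ] ℝ) :=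
  LinearMap.mk₂ ℝ (fun θ ξ => alternatizeUncurryFin (θ.smulRight ξ))
    (fun θ θ' ξ => by
      rw [← alternatizeUncurryFin_add]
      congr 1
      ext
      simp
      ring)
    (fun r θ ξ => by
      rw [← alternatizeUncurryFin_smul]
      congr 1
      ext
      simp
      ring)
    (fun θ ξ ξ' => by
      rw [← alternatizeUncurryFin_add]
      congr 1
      ext
      simp)
    (fun r θ ξ => by
      rw [← alternatizeUncurryFin_smul]
      congr 1
      ext
      simp
      ring)

theorem oneWedge_eq {k : ℕ} (θ : E →L[ℝ] ℝ) (ξ : E [⋀^Fin k]→L[ℝ] ℝ) :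
    oneWedge θ ξ = alternatizeUncurryFin (θ.smulRight ξ) := rfl

theorem oneWedge_apply {k : ℕ} (θ : E →L[ℝ] ℝ) (ξ : E [⋀^Fin k]→L[ℝ] ℝ) (w : Fin (k + 1) → E) :
    oneWedge θ ξ w = ∑ i : Fin (k + 1), (-1 : ℝ) ^ (i : ℕ) * (θ (w i) * ξ (i.removeNth w)) := by
  simp [oneWedge_eq, alternatizeUncurryFin_apply]

/-- The exterior product `θ ∧ ·` with a `1`-form on forms of all degrees. -/
def ext1 (θ : E →L[ℝ] ℝ) : Forms E →ₗ[ℝ] Forms E where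
  toFun f k := Nat.casesOn k 0 fun k => oneWedge θ (f k)
  map_add' f g := by
    ext1 k
    cases k with
    | zero => exact (add_zero _).symm
    | succ k => exact _root_.map_add (oneWedge θ) (f k) (g k)
  map_smul' r f := by
    ext1 k
    cases k with
    | zero => exact (smul_zero r).symm
    | succ k => exact _root_.map_smul (oneWedge θ) r (f k)

theorem ext1_zero (θ : E →L[ℝ] ℝ) (f : Forms E) : ext1 θ f 0 = 0 := rfl

theorem ext1_succ (θ : E →L[ℝ] ℝ) (f : Forms E) (k : ℕ) :
    ext1 θ f (k + 1) = oneWedge θ (f k) := rfl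

theorem ext1_add_left (θ θ' : E →L[ℝ] ℝ) (f : Forms E) :
    ext1 (θ + θ') f = ext1 θ f + ext1 θ' f := by
  ext1 k
  cases k with
  | zero => simp [ext1_zero, Forms.add_apply]
  | succ k => simp [ext1_succ, Forms.add_apply]

theorem ext1_smul_left (r : ℝ) (θ : E →L[ℝ] ℝ) (f : Forms E) :
    ext1 (r • θ) f = r • ext1 θ f := by
  ext1 k
  cases k with
  | zero => simp [ext1_zero, Forms.smul_apply]
  | succ k => simp [ext1_succ, Forms.smul_apply]

theorem ext1_zero_left (f : Forms E) : ext1 (0 : E →L[ℝ] ℝ) f = 0 := by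
  simpa using ext1_smul_left (0 : ℝ) (0 : E →L[ℝ] ℝ) f

theorem ext1_neg_left (θ : E →L[ℝ] ℝ) (f : Forms E) : ext1 (-θ) f = - ext1 θ f := by
  rw [eq_neg_iff_add_eq_zero, ← ext1_add_left, neg_add_cancel, ext1_zero_left]

theorem ext1_sum_left {ι : Type*} (s : Finset ι) (θ : ι → E →L[ℝ] ℝ) (f : Forms E) :
    ext1 (∑ i ∈ s, θ i) f = ∑ i ∈ s, ext1 (θ i) f := by
  classical
  induction s using Finset.induction_on with
  | empty => simp [ext1_zero_left]
  | insert a s ha ih => rw [Finset.sum_insert ha, Finset.sum_insert ha, ext1_add_left, ih]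

theorem curryLeft_oneWedge (v : E) (θ : E →L[ℝ] ℝ) {k : ℕ} (ξ : E [⋀^Fin (k + 1)]→L[ℝ] ℝ) :
    curryLeft (oneWedge θ ξ) v = θ v • ξ - oneWedge θ (curryLeft ξ v) := by
  ext w
  rw [curryLeft_apply_apply, oneWedge_apply, Fin.sum_univ_succ,
    ContinuousAlternatingMap.sub_apply, oneWedge_apply]
  have h1 : ∀ i : Fin (k + 1), (i.succ.removeNth (Matrix.vecCons v w) : Fin (k + 1) → E) =
      Matrix.vecCons v (i.removeNth w) := fun i => by
    funext j
    cases j using Fin.cases <;> simp [Fin.removeNth]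
  have h2 : ((0 : Fin (k + 2)).removeNth (Matrix.vecCons v w) : Fin (k + 1) → E) = w := by
    funext j
    simp [Fin.removeNth]
  simp [h1, h2, pow_succ, sub_eq_add_neg]

/-- The antiderivation rule from which the commutators of `lef` and `lam` are derived. -/
theorem ins_ext1 (v : E) (θ : E →L[ℝ] ℝ) (f : Forms E) :
    ins v (ext1 θ f) = θ v • f - ext1 θ (ins v f) := by
  ext1 k
  cases k with
  | zero =>
    ext w
    simp [ins_apply, ext1_succ, oneWedge_apply, Forms.sub_apply, Forms.smul_apply, ext1_zero]
  | succ k => exact curryLeft_oneWedge v θ (f (k + 1))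

/-- Induction on the degree: a form of positive degree is determined by its interior products, and
`ins_ext1` reduces those of both sides to one degree lower. -/
theorem ext1_ext1 (θ θ' : E →L[ℝ] ℝ) (f : Forms E) :
    ext1 θ (ext1 θ' f) = - ext1 θ' (ext1 θ f) := by
  ext1 k
  induction k generalizing f with
  | zero => exact neg_zero.symm
  | succ k ih =>
    refine eq_of_curryLeft fun v => ?_
    change ins v _ k = ins v _ k
    rw [map_neg]
    simp only [ins_ext1, map_sub, map_smul, Forms.sub_apply, Forms.smul_apply,
      Forms.neg_apply] at ih ⊢
    rw [ih (ins v f)]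
    module

/-- Euler's identity in a single degree. -/
theorem sum_oneWedge_curryLeft {ι : Type*} [Fintype ι] (θ : ι → E →L[ℝ] ℝ) (b : ι → E) {k : ℕ}
    (ξ : E [⋀^Fin (k + 1)]→L[ℝ] ℝ)
    (h : ∀ w, curryLeft ξ (w - ∑ i, θ i w • b i) = 0) :
    ∑ i, oneWedge (θ i) (curryLeft ξ (b i)) = ((k + 1 : ℕ) : ℝ) • ξ := by
  have h2 : curryLeft ξ = ∑ i, (θ i).smulRight (curryLeft ξ (b i)) := by
    ext1 w
    have := h w
    rw [map_sub, sub_eq_zero] at this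
    rw [this, _root_.map_sum]
    simp
  -- Alternatizing a curried form multiplies it by its degree; by `h2` the curried form is a sum of
  -- terms `θ i ⊗ ι_{b i} ξ`.
  have h1 := alternatizeUncurryFin_curryLeft ξ
  rw [Nat.cast_smul_eq_nsmul, ← h1]
  conv_rhs => rw [h2]
  exact (_root_.map_sum (alternatizeUncurryFinCLM ℝ E ℝ) _ _).symm

theorem wedge_const_left {b : ℕ} (h : 0 + b = b) (α : E [⋀^Fin 0]→L[ℝ] ℝ)
    (β : E [⋀^Fin b]→L[ℝ] ℝ) : wedge h α β = α ![] • β := by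
  ext v
  have hs : ∀ σ : Equiv.Perm (Fin b), ((Equiv.Perm.sign σ : ℤ) : ℝ) *
      (α (fun i => v (σ (Fin.cast h (Fin.castAdd b i)))) *
        β (fun i => v (σ (Fin.cast h (Fin.natAdd 0 i))))) = α ![] * β v := by
    intro σ
    have h1 : (fun i => v (σ (Fin.cast h (Fin.natAdd 0 i)))) = v ∘ σ := by
      funext i
      simp
    rw [h1, show β (v ∘ σ) = _ from β.toAlternatingMap.map_perm v σ,
      Subsingleton.elim (fun i => v (σ (Fin.cast h (Fin.castAdd b i)))) ![]]
    have h2 : ((Equiv.Perm.sign σ : ℤ) : ℝ) * ((Equiv.Perm.sign σ : ℤ) : ℝ) = 1 := by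
      rw [← Int.cast_mul, ← Units.val_mul, Int.units_mul_self]
      simp
    rw [Units.smul_def, zsmul_eq_mul]
    change _ * (_ * (_ * β v)) = _
    linear_combination (α ![] * β v) * h2
  rw [wedge_apply, Finset.sum_congr rfl fun σ _ => hs σ]
  simp [Fintype.card_perm]
  field_simp

end Operators

/-! ### Associativity of the wedge product and the Lefschetz operator -/

section WedgeOperators

open ContinuousAlternatingMap

variable {E : Type*} [NormedAddCommGroup E] [NormedSpace ℝ E]

theorem oneWedge_eq_wedge {k : ℕ} (h : 1 + k = k + 1) (θ : E →L[ℝ] ℝ) (ξ : E [⋀^Fin k]→L[ℝ] ℝ) :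
    oneWedge θ ξ = wedge h (ofSubsingleton ℝ E ℝ (0 : Fin 1) θ) ξ := by
  have h1 := alternatize_wedge_left (zero_add k) (by omega : 0 + 1 + k = k + 1) ξ
    ((constOfIsEmptyLIE ℝ E ℝ (Fin 0) : ℝ →L[ℝ] E [⋀^Fin 0]→L[ℝ] ℝ) ∘L θ) (θ.smulRight ξ)
    (fun v => by rw [wedge_const_left]; rfl)
  rw [alternatizeUncurryFin_constOfIsEmptyLIE_comp] at h1
  exact h1

/-- Both sides alternatize `v ↦ θ v • (α ∧ β)`, and the constant factor `β` can be pulled out on the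
right. This is the induction step of associativity in `wedgeOp_wedge`. -/
theorem oneWedge_wedge {a b c : ℕ} (h : a + b = c) (h' : a + 1 + b = c + 1) (θ : E →L[ℝ] ℝ)
    (α : E [⋀^Fin a]→L[ℝ] ℝ) (β : E [⋀^Fin b]→L[ℝ] ℝ) :
    wedge h' (oneWedge θ α) β = oneWedge θ (wedge h α β) :=
  (alternatize_wedge_left h h' β (θ.smulRight α) (θ.smulRight (wedge h α β))
    (fun v => (wedge_smul_left h (θ v) α β).symm)).symm

/-- The wedge product with a form of degree `a` on forms of all degrees. -/
def wedgeOp {a : ℕ} (α : E [⋀^Fin a]→L[ℝ] ℝ) : Forms E →ₗ[ℝ] Forms E where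
  toFun f c := if h : a ≤ c then wedge (Nat.add_sub_of_le h) α (f (c - a)) else 0
  map_add' f g := by
    ext1 c
    change (if h : a ≤ c then wedge (Nat.add_sub_of_le h) α (f (c - a) + g (c - a)) else 0) =
      (if h : a ≤ c then wedge (Nat.add_sub_of_le h) α (f (c - a)) else 0) +
      (if h : a ≤ c then wedge (Nat.add_sub_of_le h) α (g (c - a)) else 0)
    split_ifs with h
    · exact wedge_add_right _ _ _ _
    · exact (add_zero 0).symm
  map_smul' r f := by
    ext1 c
    change (if h : a ≤ c then wedge (Nat.add_sub_of_le h) α (r • f (c - a)) else 0) =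
      r • (if h : a ≤ c then wedge (Nat.add_sub_of_le h) α (f (c - a)) else 0)
    split_ifs with h
    · exact wedge_smul_right _ _ _ _
    · exact (smul_zero r).symm

theorem wedgeOp_apply {a b c : ℕ} (h : a + b = c) (α : E [⋀^Fin a]→L[ℝ] ℝ) (f : Forms E) :
    wedgeOp α f c = wedge h α (f b) := by
  obtain rfl : b = c - a := by omega
  exact dif_pos (by omega)

theorem wedgeOp_of_lt {a c : ℕ} (h : c < a) (α : E [⋀^Fin a]→L[ℝ] ℝ) (f : Forms E) :
    wedgeOp α f c = 0 := dif_neg (by omega)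

theorem wedgeOp_single {a b c : ℕ} (h : a + b = c) (α : E [⋀^Fin a]→L[ℝ] ℝ)
    (β : E [⋀^Fin b]→L[ℝ] ℝ) : wedgeOp α (Forms.single b β) = Forms.single c (wedge h α β) := by
  ext1 d
  by_cases hd : a ≤ d
  · obtain ⟨e, rfl⟩ := Nat.exists_eq_add_of_le hd
    rw [wedgeOp_apply rfl]
    by_cases he : e = b
    · subst he
      subst h
      rw [Forms.single_same, Forms.single_same]
    · rw [Forms.single_of_ne he, Forms.single_of_ne (by omega)]
      simpa using wedge_smul_right rfl (0 : ℝ) α (0 : E [⋀^Fin e]→L[ℝ] ℝ)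
  · rw [wedgeOp_of_lt (by omega), Forms.single_of_ne (by omega)]

theorem wedgeOp_oneWedge {a : ℕ} (θ : E →L[ℝ] ℝ) (α : E [⋀^Fin a]→L[ℝ] ℝ) (f : Forms E) :
    wedgeOp (oneWedge θ α) f = ext1 θ (wedgeOp α f) := by
  ext1 c
  by_cases hc : a + 1 ≤ c
  · obtain ⟨d, rfl⟩ : ∃ d, c = d + 1 := ⟨c - 1, by omega⟩
    obtain ⟨e, rfl⟩ : ∃ e, d = a + e := ⟨d - a, by omega⟩
    rw [wedgeOp_apply (b := e) (by omega), oneWedge_wedge (c := a + e) rfl, ext1_succ,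
      wedgeOp_apply rfl]
  · rw [wedgeOp_of_lt (by omega)]
    cases c with
    | zero => rfl
    | succ c => rw [ext1_succ, wedgeOp_of_lt (by omega), _root_.map_zero]

theorem wedgeOp_add_left {a : ℕ} (α β : E [⋀^Fin a]→L[ℝ] ℝ) (f : Forms E) :
    wedgeOp (α + β) f = wedgeOp α f + wedgeOp β f := by
  ext1 c
  rw [Forms.add_apply]
  by_cases hc : a ≤ c
  · obtain ⟨e, rfl⟩ := Nat.exists_eq_add_of_le hc
    simp only [wedgeOp_apply rfl, wedge_add_left]
  · simp only [wedgeOp_of_lt (not_le.1 hc), add_zero]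

theorem wedgeOp_smul_left {a : ℕ} (r : ℝ) (α : E [⋀^Fin a]→L[ℝ] ℝ) (f : Forms E) :
    wedgeOp (r • α) f = r • wedgeOp α f := by
  ext1 c
  rw [Forms.smul_apply]
  by_cases hc : a ≤ c
  · obtain ⟨e, rfl⟩ := Nat.exists_eq_add_of_le hc
    simp only [wedgeOp_apply rfl, wedge_smul_left]
  · simp only [wedgeOp_of_lt (not_le.1 hc), smul_zero]

theorem wedgeOp_zero_left {a : ℕ} (f : Forms E) :
    wedgeOp (0 : E [⋀^Fin a]→L[ℝ] ℝ) f = 0 := by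
  have h := wedgeOp_smul_left (0 : ℝ) (0 : E [⋀^Fin a]→L[ℝ] ℝ) f
  rwa [zero_smul, zero_smul] at h

theorem wedgeOp_sum_left {a : ℕ} {ι : Type*} (s : Finset ι) (α : ι → E [⋀^Fin a]→L[ℝ] ℝ)
    (f : Forms E) : wedgeOp (∑ i ∈ s, α i) f = ∑ i ∈ s, wedgeOp (α i) f := by
  classical
  induction s using Finset.induction_on with
  | empty => simp [wedgeOp_zero_left]
  | insert a s ha ih => rw [Finset.sum_insert ha, Finset.sum_insert ha, wedgeOp_add_left, ih]

theorem wedgeOp_const (α : E [⋀^Fin 0]→L[ℝ] ℝ) (f : Forms E) : wedgeOp α f = α ![] • f := by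
  ext1 c
  rw [wedgeOp_apply (zero_add c), wedge_const_left, Forms.smul_apply]

theorem wedgeOp_ofSubsingleton (θ : E →L[ℝ] ℝ) (f : Forms E) :
    wedgeOp (ofSubsingleton ℝ E ℝ (0 : Fin 1) θ) f = ext1 θ f := by
  ext1 c
  cases c with
  | zero => rw [wedgeOp_of_lt zero_lt_one, ext1_zero]
  | succ c => rw [wedgeOp_apply (add_comm 1 c), ext1_succ, oneWedge_eq_wedge (add_comm 1 c)]

variable [FiniteDimensional ℝ E]

theorem sum_oneWedge_basis {ι : Type*} [Fintype ι] (b : Basis ι ℝ E) {k : ℕ}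
    (ξ : E [⋀^Fin (k + 1)]→L[ℝ] ℝ) :
    ∑ i, oneWedge (LinearMap.toContinuousLinearMap (b.coord i)) (curryLeft ξ (b i)) =
      ((k + 1 : ℕ) : ℝ) • ξ := by
  refine sum_oneWedge_curryLeft _ _ ξ fun w => ?_
  have : w - ∑ i, LinearMap.toContinuousLinearMap (b.coord i) w • b i = 0 := by
    simp [b.sum_repr]
  rw [this, _root_.map_zero]

/-- Forms of positive degree are sums of products `θ ∧ α` with `1`-forms `θ`. -/
theorem form_induction {k : ℕ} {P : E [⋀^Fin (k + 1)]→L[ℝ] ℝ → Prop} (h0 : P 0)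
    (hadd : ∀ α β, P α → P β → P (α + β)) (h : ∀ θ α, P (oneWedge θ α))
    (ξ : E [⋀^Fin (k + 1)]→L[ℝ] ℝ) : P ξ := by
  have h1 : ξ = ((k + 1 : ℕ) : ℝ)⁻¹ • ((k + 1 : ℕ) : ℝ) • ξ := by
    rw [smul_smul, inv_mul_cancel₀ (by positivity), one_smul]
  rw [h1, ← sum_oneWedge_basis (finBasis ℝ E), Finset.smul_sum]
  refine Finset.sum_induction _ P (fun α β => hadd α β) h0 fun i _ => ?_
  rw [← _root_.map_smul]
  exact h _ _

/-- Associativity of the wedge product. -/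
theorem wedgeOp_wedge {a b c : ℕ} (h : a + b = c) (α : E [⋀^Fin a]→L[ℝ] ℝ)
    (β : E [⋀^Fin b]→L[ℝ] ℝ) (f : Forms E) :
    wedgeOp (wedge h α β) f = wedgeOp α (wedgeOp β f) := by
  induction a generalizing c with
  | zero =>
    obtain rfl : b = c := by omega
    rw [wedge_const_left, wedgeOp_smul_left, wedgeOp_const]
  | succ a ih =>
    obtain ⟨d, rfl⟩ : ∃ d, c = d + 1 := ⟨c - 1, by omega⟩
    induction α using form_induction with
    | h0 =>
      have h1 := wedge_smul_left h (0 : ℝ) (0 : E [⋀^Fin (a + 1)]→L[ℝ] ℝ) β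
      rw [zero_smul, zero_smul] at h1
      rw [h1, wedgeOp_zero_left, wedgeOp_zero_left]
    | hadd α α' h1 h2 => rw [wedge_add_left, wedgeOp_add_left, wedgeOp_add_left, h1, h2]
    | h θ α =>
      rw [oneWedge_wedge (c := d) (by omega), wedgeOp_oneWedge, wedgeOp_oneWedge,
        ih (by omega)]

/-- The Lefschetz operator `f ↦ Ω ∧ f`. -/
def lef (Ω : E [⋀^Fin 2]→L[ℝ] ℝ) : Forms E →ₗ[ℝ] Forms E := wedgeOp Ω

theorem wedgeOp_wedgePow (Ω : E [⋀^Fin 2]→L[ℝ] ℝ) (k : ℕ) :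
    wedgeOp (wedgePow Ω k) = lef Ω ^ k := by
  induction k with
  | zero =>
    ext1 f
    rw [wedgeOp_const]
    exact one_smul ℝ f
  | succ k ih =>
    ext1 f
    rw [pow_succ, Module.End.mul_apply, ← ih]
    exact wedgeOp_wedge _ _ _ _

/-- The continuous `1`-form `ι_v Ω`. -/
def flatC (Ω : E [⋀^Fin 2]→L[ℝ] ℝ) (v : E) : E →L[ℝ] ℝ :=
  LinearMap.toContinuousLinearMap (flat Ω v)

theorem flatC_apply (Ω : E [⋀^Fin 2]→L[ℝ] ℝ) (v w : E) : flatC Ω v w = Ω ![v, w] := rfl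

theorem flatC_swap (Ω : E [⋀^Fin 2]→L[ℝ] ℝ) (v w : E) : flatC Ω v w = - flatC Ω w v := by
  have h := Ω.toAlternatingMap.map_swap ![v, w] (show (0 : Fin 2) ≠ 1 by decide)
  have h2 : (![v, w] ∘ Equiv.swap (0 : Fin 2) 1) = ![w, v] := by
    ext i
    fin_cases i <;> rfl
  rw [h2] at h
  rw [flatC_apply, flatC_apply]
  change Ω _ = - Ω _ at h
  rw [h, neg_neg]

theorem flatC_add (Ω : E [⋀^Fin 2]→L[ℝ] ℝ) (v w : E) :
    flatC Ω (v + w) = flatC Ω v + flatC Ω w := by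
  simp [flatC]

theorem flatC_smul (Ω : E [⋀^Fin 2]→L[ℝ] ℝ) (r : ℝ) (v : E) :
    flatC Ω (r • v) = r • flatC Ω v := by
  simp [flatC]

theorem flatC_neg (Ω : E [⋀^Fin 2]→L[ℝ] ℝ) (v : E) : flatC Ω (-v) = - flatC Ω v := by
  simp [flatC]

theorem flatC_sum (Ω : E [⋀^Fin 2]→L[ℝ] ℝ) {ι : Type*} (s : Finset ι) (v : ι → E) :
    flatC Ω (∑ i ∈ s, v i) = ∑ i ∈ s, flatC Ω (v i) := by
  simp [flatC]

theorem curryLeft_two (Ω : E [⋀^Fin 2]→L[ℝ] ℝ) (v : E) :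
    curryLeft (n := 1) Ω v = ofSubsingleton ℝ E ℝ (0 : Fin 1) (flatC Ω v) := by
  ext w
  rw [curryLeft_apply_apply]
  change _ = Ω ![v, w 0]
  congr 1
  ext i
  fin_cases i <;> rfl

/-- Euler's identity in degree `2`. It expresses `Ω` through products of `1`-forms, so that
commutators with `lef` reduce to those with `ext1`. -/
theorem two_smul_lef {ι : Type*} [Fintype ι] (b : Basis ι ℝ E) (Ω : E [⋀^Fin 2]→L[ℝ] ℝ)
    (f : Forms E) :
    (2 : ℝ) • lef Ω f = ∑ i, ext1 (LinearMap.toContinuousLinearMap (b.coord i))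
      (ext1 (flatC Ω (b i)) f) := by
  have h := sum_oneWedge_basis b (k := 1) Ω
  rw [lef, ← wedgeOp_smul_left, show (2 : ℝ) = ((1 + 1 : ℕ) : ℝ) by norm_num, ← h,
    wedgeOp_sum_left]
  refine Finset.sum_congr rfl fun i _ => ?_
  rw [wedgeOp_oneWedge, curryLeft_two, wedgeOp_ofSubsingleton]

theorem two_smul_cancel {f g : Forms E} (h : (2 : ℝ) • f = (2 : ℝ) • g) : f = g := by
  have h1 := congrArg (fun x => (2⁻¹ : ℝ) • x) h
  simpa [smul_smul] using h1

theorem lef_ext1 (Ω : E [⋀^Fin 2]→L[ℝ] ℝ) (θ : E →L[ℝ] ℝ) (f : Forms E) :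
    lef Ω (ext1 θ f) = ext1 θ (lef Ω f) := by
  apply two_smul_cancel
  rw [← _root_.map_smul (ext1 θ), two_smul_lef (finBasis ℝ E), two_smul_lef (finBasis ℝ E),
    _root_.map_sum]
  refine Finset.sum_congr rfl fun i _ => ?_
  rw [ext1_ext1 _ θ, map_neg, ext1_ext1 _ θ, neg_neg]

theorem ins_lef (Ω : E [⋀^Fin 2]→L[ℝ] ℝ) (v : E) (f : Forms E) :
    ins v (lef Ω f) = lef Ω (ins v f) + ext1 (flatC Ω v) f := by
  apply two_smul_cancel
  -- Contracting the sum for `2 Ω ∧ f` leaves two extra sums, one from each `1`-form factor. The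
  -- expansions `h1`, in the dual basis, and `h2`, in the forms `ι_{b i} Ω`, identify each of them
  -- with `ι_v Ω ∧ f`.
  have h1 : flatC Ω v = ∑ i, flatC Ω v (finBasis ℝ E i) •
      LinearMap.toContinuousLinearMap ((finBasis ℝ E).coord i) := by
    ext w
    conv_lhs => rw [← (finBasis ℝ E).sum_repr w, _root_.map_sum]
    simp [mul_comm]
  have h2 : flatC Ω v = ∑ i, (finBasis ℝ E).coord i v • flatC Ω (finBasis ℝ E i) := by
    conv_lhs => rw [← (finBasis ℝ E).sum_repr v]
    rw [flatC_sum]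
    simp [flatC_smul]
  rw [smul_add, ← _root_.map_smul (ins v), two_smul_lef (finBasis ℝ E),
    two_smul_lef (finBasis ℝ E), _root_.map_sum, two_smul]
  conv_rhs =>
    congr
    · skip
    · congr
      · rw [h1]
      · rw [h2]
  rw [ext1_sum_left, ext1_sum_left, ← Finset.sum_add_distrib, ← Finset.sum_add_distrib]
  refine Finset.sum_congr rfl fun i _ => ?_
  rw [ins_ext1, ins_ext1, ext1_smul_left, ext1_smul_left, flatC_swap Ω v, map_sub, _root_.map_smul]
  simp only [LinearMap.coe_toContinuousLinearMap']
  module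

theorem lef_pow_succ (Ω : E [⋀^Fin 2]→L[ℝ] ℝ) (m : ℕ) (f : Forms E) :
    (lef Ω ^ (m + 1)) f = lef Ω ((lef Ω ^ m) f) := by
  rw [pow_succ', Module.End.mul_apply]

theorem lef_pow_ext1 (Ω : E [⋀^Fin 2]→L[ℝ] ℝ) (θ : E →L[ℝ] ℝ) (m : ℕ) (f : Forms E) :
    (lef Ω ^ m) (ext1 θ f) = ext1 θ ((lef Ω ^ m) f) := by
  induction m with
  | zero => rfl
  | succ m ih => rw [lef_pow_succ, ih, lef_ext1, lef_pow_succ]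

theorem ins_lef_pow (Ω : E [⋀^Fin 2]→L[ℝ] ℝ) (v : E) (m : ℕ) (f : Forms E) :
    ins v ((lef Ω ^ (m + 1)) f) = (lef Ω ^ (m + 1)) (ins v f) +
      ((m + 1 : ℕ) : ℝ) • (lef Ω ^ m) (ext1 (flatC Ω v) f) := by
  induction m with
  | zero => simpa using ins_lef Ω v f
  | succ m ih =>
    rw [lef_pow_succ, ins_lef, ih, map_add, _root_.map_smul, ← lef_pow_ext1, ← lef_pow_succ,
      ← lef_pow_succ]
    push_cast
    module

end WedgeOperators

/-! ### Horizontal forms, transverse frames and the `sl₂` relation -/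

section Frames

open ContinuousAlternatingMap (curryLeft curryLeft_zero constOfIsEmpty)

variable {E : Type*} [NormedAddCommGroup E] [NormedSpace ℝ E]

variable (E) in
/-- The forms of degree `m`, inside the product over all degrees; zero if `m < 0`. -/
def degForms (m : ℤ) : Submodule ℝ (Forms E) where
  carrier := {f | ∀ k : ℕ, (k : ℤ) ≠ m → f k = 0}
  zero_mem' _ _ := rfl
  add_mem' hf hg k hk := by rw [Forms.add_apply, hf k hk, hg k hk, add_zero]
  smul_mem' r f hf k hk := by rw [Forms.smul_apply, hf k hk, smul_zero]

theorem eq_zero_of_neg {m : ℤ} (hm : m < 0) {f : Forms E} (hf : f ∈ degForms E m) : f = 0 :=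
  Forms.ext fun k => hf k (by omega)

theorem single_mem_degForms (k : ℕ) (ξ : E [⋀^Fin k]→L[ℝ] ℝ) :
    Forms.single k ξ ∈ degForms E k := fun l hl =>
  Forms.single_of_ne (by exact_mod_cast hl) ξ

theorem eq_single {k : ℕ} {f : Forms E} (hf : f ∈ degForms E k) : f = Forms.single k (f k) := by
  ext1 l
  by_cases hl : l = k
  · subst hl
    rw [Forms.single_same]
  · rw [Forms.single_of_ne hl, hf l (by exact_mod_cast hl)]

theorem ins_mem_degForms {m l : ℤ} (h : m = l + 1) (v : E) {f : Forms E} (hf : f ∈ degForms E m) :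
    ins v f ∈ degForms E l := fun k hk => by
  rw [ins_apply, hf (k + 1) (by push_cast; omega), curryLeft_zero]
  rfl

theorem ext1_mem_degForms {m l : ℤ} (h : l = m + 1) (θ : E →L[ℝ] ℝ) {f : Forms E}
    (hf : f ∈ degForms E m) : ext1 θ f ∈ degForms E l := fun k hk => by
  cases k with
  | zero => rfl
  | succ k =>
    rw [ext1_succ, hf k (by push_cast at hk; omega), map_zero]

theorem lef_mem_degForms {m l : ℤ} (h : l = m + 2) (Ω : E [⋀^Fin 2]→L[ℝ] ℝ) {f : Forms E}
    (hf : f ∈ degForms E m) : lef Ω f ∈ degForms E l := fun k hk => by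
  by_cases hk2 : 2 ≤ k
  · obtain ⟨j, rfl⟩ := Nat.exists_eq_add_of_le hk2
    rw [lef, wedgeOp_apply rfl, hf j (by push_cast at hk; omega)]
    simpa using wedge_smul_right rfl (0 : ℝ) Ω (0 : E [⋀^Fin j]→L[ℝ] ℝ)
  · exact wedgeOp_of_lt (by omega) Ω f

/-- A form of positive degree all of whose interior products vanish is zero. -/
theorem eq_zero_of_ins {m : ℤ} (hm : m ≠ 0) {f : Forms E} (hf : f ∈ degForms E m)
    (h : ∀ v, ins v f = 0) : f = 0 := by
  ext1 k
  cases k with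
  | zero => exact hf 0 (by exact_mod_cast hm.symm)
  | succ k =>
    refine eq_of_curryLeft fun v => ?_
    rw [Forms.zero_apply, curryLeft_zero]
    exact congrFun (h v) k

variable (E) in
/-- The constant `1`, as a form of degree `0`. -/
def oneForm : Forms E := Forms.single 0 (constOfIsEmpty ℝ E (Fin 0) 1)

theorem oneForm_mem : oneForm E ∈ degForms E 0 := single_mem_degForms 0 _

theorem ins_oneForm (v : E) : ins v (oneForm E) = 0 := by
  ext1 k
  rw [ins_apply, oneForm, Forms.single_of_ne (by omega), curryLeft_zero]
  rfl

theorem oneForm_ne_zero : oneForm E ≠ 0 := fun h => by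
  have h1 := congrFun h 0
  rw [oneForm, Forms.single_same] at h1
  have h2 := DFunLike.congr_fun h1 ![]
  change (1 : ℝ) = 0 at h2
  exact one_ne_zero h2

theorem eq_smul_oneForm {f : Forms E} (hf : f ∈ degForms E 0) : f = f 0 ![] • oneForm E := by
  rw [oneForm, ← map_smul]
  conv_lhs => rw [eq_single (k := 0) hf]
  congr 1
  ext w
  rw [Subsingleton.elim w ![]]
  simp

variable [FiniteDimensional ℝ E]

/-- The horizontal forms of degree `m`: those annihilated by the kernel of `Ω`. -/
def horForms (Ω : E [⋀^Fin 2]→L[ℝ] ℝ) (m : ℤ) : Submodule ℝ (Forms E) where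
  carrier := {f | f ∈ degForms E m ∧ ∀ t, flatC Ω t = 0 → ins t f = 0}
  zero_mem' := ⟨Submodule.zero_mem _, fun _ _ => map_zero _⟩
  add_mem' hf hg := ⟨Submodule.add_mem _ hf.1 hg.1, fun t ht => by
    rw [map_add, hf.2 t ht, hg.2 t ht, add_zero]⟩
  smul_mem' r f hf := ⟨Submodule.smul_mem _ r hf.1, fun t ht => by
    rw [map_smul, hf.2 t ht, smul_zero]⟩

variable {Ω : E [⋀^Fin 2]→L[ℝ] ℝ}

theorem flatC_of_ker {t : E} (ht : flatC Ω t = 0) (v : E) : flatC Ω v t = 0 := by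
  rw [flatC_swap, ht]
  simp

theorem oneForm_mem_horForms : oneForm E ∈ horForms Ω 0 := ⟨oneForm_mem, fun t _ => ins_oneForm t⟩

theorem ins_mem_horForms {m l : ℤ} (h : m = l + 1) (v : E) {f : Forms E} (hf : f ∈ horForms Ω m) :
    ins v f ∈ horForms Ω l :=
  ⟨ins_mem_degForms h v hf.1, fun t ht => by rw [ins_ins, hf.2 t ht, map_zero, neg_zero]⟩

theorem ext1_mem_horForms {m l : ℤ} (h : l = m + 1) (v : E) {f : Forms E}
    (hf : f ∈ horForms Ω m) : ext1 (flatC Ω v) f ∈ horForms Ω l :=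
  ⟨ext1_mem_degForms h _ hf.1, fun t ht => by
    rw [ins_ext1, hf.2 t ht, flatC_of_ker ht, zero_smul, map_zero, sub_zero]⟩

theorem lef_mem_horForms {m l : ℤ} (h : l = m + 2) {f : Forms E}
    (hf : f ∈ horForms Ω m) : lef Ω f ∈ horForms Ω l :=
  ⟨lef_mem_degForms h Ω hf.1, fun t ht => by
    rw [ins_lef, hf.2 t ht, ht, ext1_zero_left, map_zero, zero_add]⟩

theorem lef_pow_mem_degForms {m l : ℤ} (k : ℕ) (h : l = m + 2 * k) {f : Forms E}
    (hf : f ∈ degForms E m) : (lef Ω ^ k) f ∈ degForms E l := by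
  induction k generalizing l with
  | zero =>
    obtain rfl : l = m := by simpa using h
    exact hf
  | succ k ih =>
    rw [lef_pow_succ]
    exact lef_mem_degForms (by push_cast at h; omega) Ω (ih rfl)

theorem lef_pow_mem_horForms {m l : ℤ} (k : ℕ) (h : l = m + 2 * k) {f : Forms E}
    (hf : f ∈ horForms Ω m) : (lef Ω ^ k) f ∈ horForms Ω l := by
  induction k generalizing l with
  | zero =>
    obtain rfl : l = m := by simpa using h
    exact hf
  | succ k ih =>
    rw [lef_pow_succ]
    exact lef_mem_horForms (by push_cast at h; omega) (ih rfl)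

/-- Vectors `b i` and `v i` such that the `1`-forms `ι_{v i} Ω` are dual to the `b i`, and the `b i`
span a complement of the kernel of `Ω`. -/
structure IsFrame (Ω : E [⋀^Fin 2]→L[ℝ] ℝ) {N : ℕ} (b v : Fin N → E) : Prop where
  dual : ∀ i j, flatC Ω (v i) (b j) = if i = j then 1 else 0
  residue : ∀ w, flatC Ω (w - ∑ i, flatC Ω (v i) w • b i) = 0

namespace IsFrame

variable {N : ℕ} {b v : Fin N → E} (hF : IsFrame Ω b v)

include hF

/-- The `b i` need not span `E`: by `residue`, what is missing from a vector lies in the kernel of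
`Ω`, and horizontal forms do not see it. -/
theorem euler {m : ℤ} {f : Forms E} (hf : f ∈ horForms Ω m) :
    ∑ i, ext1 (flatC Ω (v i)) (ins (b i) f) = (m : ℝ) • f := by
  ext1 k
  rw [Forms.sum_apply, Forms.smul_apply]
  cases k with
  | zero =>
    rw [Finset.sum_eq_zero fun i _ => ext1_zero _ _]
    by_cases hm : m = 0
    · rw [hm, Int.cast_zero, zero_smul]
    · rw [hf.1 0 (by exact_mod_cast Ne.symm hm), smul_zero]
  | succ k =>
    have h : ∀ w, curryLeft (f (k + 1)) (w - ∑ i, flatC Ω (v i) w • b i) = 0 := fun w =>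
      congrFun (hf.2 _ (hF.residue w)) k
    refine (sum_oneWedge_curryLeft _ b (f (k + 1)) h).trans ?_
    by_cases hm : m = (k + 1 : ℕ)
    · rw [hm, Int.cast_natCast]
    · rw [hf.1 (k + 1) (Ne.symm hm), smul_zero, smul_zero]

/-- The counterpart of Euler's identity. It recovers `f` from its products with the frame `1`-forms
as long as `m ≠ N`, which drives the inductions that descend from the top degree. -/
theorem sum_ins_ext1 {m : ℤ} {f : Forms E} (hf : f ∈ horForms Ω m) :
    ∑ i, ins (b i) (ext1 (flatC Ω (v i)) f) = ((N : ℝ) - m) • f := by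
  simp only [ins_ext1, Finset.sum_sub_distrib, hF.euler hf, hF.dual]
  simp
  module

/-- The antisymmetry of `Ω` lets the two halves of a frame trade places; this supplies the second
Euler sum in `lam_lef`. -/
theorem swap : IsFrame Ω v (fun i => - b i) where
  dual i j := by
    rw [flatC_neg, _root_.neg_apply, flatC_swap, neg_neg, hF.dual]
    simp [eq_comm]
  residue w := by
    set u := w - ∑ i, flatC Ω (-b i) w • v i with hu
    have h1 : ∀ j, flatC Ω u (b j) = 0 := fun j => by
      rw [hu, sub_eq_add_neg, flatC_add, flatC_neg, flatC_sum]
      simp only [flatC_smul, flatC_neg, _root_.add_apply,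
        _root_.neg_apply, _root_.sum_apply,
        _root_.smul_apply, hF.dual]
      rw [flatC_swap]
      simp
    ext z
    have h2 : z = (z - ∑ i, flatC Ω (v i) z • b i) + ∑ i, flatC Ω (v i) z • b i := by abel
    rw [h2, map_add, flatC_of_ker (hF.residue z), map_sum]
    simp [h1]

end IsFrame

/-- The operator `∑ i, ι_{v i} ι_{b i}`. -/
def lam {N : ℕ} (b v : Fin N → E) : Forms E →ₗ[ℝ] Forms E :=
  ∑ i, ins (v i) ∘ₗ ins (b i)

theorem lam_apply {N : ℕ} (b v : Fin N → E) (f : Forms E) :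
    lam b v f = ∑ i, ins (v i) (ins (b i) f) := by
  simp [lam]

theorem lam_mem_horForms {N : ℕ} (b v : Fin N → E) {m l : ℤ} (h : m = l + 2) {f : Forms E}
    (hf : f ∈ horForms Ω m) : lam b v f ∈ horForms Ω l := by
  rw [lam_apply]
  exact Submodule.sum_mem _ fun i _ =>
    ins_mem_horForms rfl _ (ins_mem_horForms (by omega) _ hf)

namespace IsFrame

variable {N : ℕ} {b v : Fin N → E} (hF : IsFrame Ω b v)

include hF

/-- The `sl₂` relation. Moving `ι_{v i} ι_{b i}` past `L` produces the Euler sums of the frame and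
of the swapped frame, each contributing `m`, and the constants `Ω (b i, v i) = -1`, contributing
`-N`. -/
theorem lam_lef {m : ℤ} {f : Forms E} (hf : f ∈ horForms Ω m) :
    lam b v (lef Ω f) = lef Ω (lam b v f) + (2 * (m : ℝ) - N) • f := by
  have h1 := hF.euler hf
  have h2 := hF.swap.euler hf
  have h3 : ∑ i, flatC Ω (b i) (v i) = - (N : ℝ) := by
    simp [flatC_swap Ω (b _) (v _), hF.dual]
  have h4 : ∀ i, ins (v i) (ins (b i) (lef Ω f)) = lef Ω (ins (v i) (ins (b i) f)) +
      ext1 (flatC Ω (v i)) (ins (b i) f) + flatC Ω (b i) (v i) • f +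
      ext1 (flatC Ω (- b i)) (ins (v i) f) := fun i => by
    rw [ins_lef, map_add, ins_lef, ins_ext1, flatC_neg, ext1_neg_left]
    abel
  rw [lam_apply, lam_apply, map_sum, Finset.sum_congr rfl fun i _ => h4 i,
    Finset.sum_add_distrib, Finset.sum_add_distrib, Finset.sum_add_distrib, h1, h2,
    ← Finset.sum_smul, h3]
  module

theorem lam_lef_pow {m : ℤ} {f : Forms E} (hf : f ∈ horForms Ω m) (r : ℕ) :
    lam b v ((lef Ω ^ (r + 1)) f) = (lef Ω ^ (r + 1)) (lam b v f) +
      ((r + 1 : ℝ) * (2 * m + 2 * r - N)) • (lef Ω ^ r) f := by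
  induction r with
  | zero => simpa using hF.lam_lef hf
  | succ r ih =>
    rw [lef_pow_succ, hF.lam_lef (lef_pow_mem_horForms (r + 1) rfl hf), ih, map_add, map_smul,
      ← lef_pow_succ, ← lef_pow_succ]
    push_cast
    module

end IsFrame

section Symplectic

variable {n : ℕ} {b v : Fin (2 * n) → E} (hF : IsFrame Ω b v)

include hF

/-- As `Λ 1 = 0`, the `sl₂` relation gives `Λ L^(m+1) 1 = (m + 1) (2 m - 2 n) L^m 1`, with a nonzero
coefficient for `m < n`. -/
theorem lef_pow_oneForm_ne_zero {m : ℕ} (hm : m ≤ n) : (lef Ω ^ m) (oneForm E) ≠ 0 := by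
  induction m with
  | zero => exact oneForm_ne_zero
  | succ m ih =>
    intro h
    have h1 := hF.lam_lef_pow (oneForm_mem_horForms (Ω := Ω)) m
    have h2 : lam b v (oneForm E) = 0 := by simp [lam_apply, ins_oneForm]
    rw [h, h2, map_zero, map_zero, zero_add, eq_comm, smul_eq_zero] at h1
    refine h1.elim (fun h3 => ?_) (ih (by omega))
    have h4 : ((m : ℝ) + 1) ≤ n := by exact_mod_cast hm
    push_cast at h3
    rcases mul_eq_zero.1 h3 with h5 | h5
    · linarith [Nat.cast_nonneg (α := ℝ) m]
    · linarith

/-- `L ^ k` is injective on all forms of degree `n - k`, horizontal or not. -/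
theorem lef_pow_injective (k : ℕ) {m : ℤ} (hm : m + k = n) {f : Forms E} (hf : f ∈ degForms E m)
    (h : (lef Ω ^ k) f = 0) : f = 0 := by
  rcases lt_or_ge m 0 with hneg | hpos
  · exact eq_zero_of_neg hneg hf
  obtain ⟨j, rfl⟩ := Int.eq_ofNat_of_zero_le hpos
  clear hpos
  induction j generalizing k f with
  | zero =>
    have h1 := eq_smul_oneForm hf
    rw [h1, map_smul, smul_eq_zero] at h
    rw [h1, h.resolve_right (lef_pow_oneForm_ne_zero hF (by push_cast at hm; omega)), zero_smul]
  | succ j ih =>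
    refine eq_zero_of_ins (by omega) hf fun v => ?_
    -- Contract `L^(k+1) f = 0` with `v`. The term containing `L^k f` drops out and `L^(k+1) (ι_v f)
    -- = 0` remains, one degree lower and one power higher.
    have h1 := ins_lef_pow Ω v k f
    rw [lef_pow_succ, h, map_zero, map_zero, lef_pow_ext1, h, map_zero, smul_zero, add_zero] at h1
    exact ih (k + 1) h1.symm (by push_cast at hm ⊢; omega)
      (ins_mem_degForms (by push_cast; rfl) v hf)

end Symplectic

end Frames

/-! ### Explicit pointwise inverse of the powers of `L` -/

section Inverse

open ContinuousAlternatingMap (curryLeft curryLeft_zero constOfIsEmpty)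

variable {E : Type*} [NormedAddCommGroup E] [NormedSpace ℝ E] [FiniteDimensional ℝ E]
  {Ω : E [⋀^Fin 2]→L[ℝ] ℝ}

section

variable {N : ℕ} {b v : Fin N → E} (hF : IsFrame Ω b v)

include hF

/-- A vector and its projection to the span of the `b i` differ by an element of the kernel of `Ω`.
Hence a horizontal form is pulled back from `ℝ^N`: it vanishes above degree `N`, and in degree `N`
its value on `b` determines it. -/
theorem IsFrame.apply_eq {m : ℤ} {f : Forms E} (hf : f ∈ horForms Ω m) {k : ℕ} (w : Fin k → E) :
    f k w = f k (fun j => ∑ i, flatC Ω (v i) (w j) • b i) := by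
  induction k generalizing f m with
  | zero =>
    congr 1
    exact Subsingleton.elim _ _
  | succ k ih =>
    have h : ∀ (x : E) (y : Fin k → E), f (k + 1) (Fin.cons x y) = ins x f k y := fun x y => rfl
    have h1 : ins (w 0) f = ins (∑ i, flatC Ω (v i) (w 0) • b i) f := by
      rw [← sub_eq_zero, ← ins_sub_left]
      exact hf.2 _ (hF.residue _)
    have h2 : (fun j => ∑ i, flatC Ω (v i) (w j) • b i) = Fin.cons (∑ i, flatC Ω (v i) (w 0) • b i)
        (fun j => ∑ i, flatC Ω (v i) (Fin.tail w j) • b i) := by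
      funext j
      cases j using Fin.cases <;> rfl
    rw [h2, ← Fin.cons_self_tail w, h, h, Fin.cons_zero, Fin.tail_cons, h1]
    exact ih (ins_mem_horForms (l := m - 1) (by omega) _ hf) _

theorem IsFrame.eq_zero_of_lt {m : ℤ} (hm : (N : ℤ) < m) {f : Forms E} (hf : f ∈ horForms Ω m) :
    f = 0 := by
  ext k w
  by_cases hk : (k : ℤ) = m
  · rw [hF.apply_eq hf]
    have h := ((f k).toAlternatingMap.compLinearMap
      (Fintype.linearCombination ℝ b)).map_linearDependent
        (fun j i => flatC Ω (v i) (w j)) (fun hli => by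
          have := hli.fintype_card_le_finrank
          simp at this
          omega)
    exact h
  · rw [hf.1 k hk]
    rfl

theorem IsFrame.eq_zero_of_apply_eq_zero {f : Forms E} (hf : f ∈ horForms Ω N) (h : f N b = 0) :
    f = 0 := by
  ext k w
  by_cases hk : k = N
  · subst hk
    rw [hF.apply_eq hf]
    have h1 := AlternatingMap.eq_smul_basis_det (Pi.basisFun ℝ (Fin k))
      ((f k).toAlternatingMap.compLinearMap (Fintype.linearCombination ℝ b))
    have h2 : ((f k).toAlternatingMap.compLinearMap (Fintype.linearCombination ℝ b))
        (Pi.basisFun ℝ (Fin k)) = 0 := by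
      rw [← h]
      change f k _ = f k b
      congr 1
      funext i
      simp [Fintype.linearCombination_apply, Pi.single_apply]
    rw [h2, zero_smul] at h1
    exact DFunLike.congr_fun h1 (fun j i => flatC Ω (v i) (w j))
  · rw [hf.1 k (by exact_mod_cast hk)]
    rfl

end

theorem lef_pow_succ' (Ω : E [⋀^Fin 2]→L[ℝ] ℝ) (m : ℕ) (f : Forms E) :
    (lef Ω ^ (m + 1)) f = (lef Ω ^ m) (lef Ω f) := by
  rw [pow_succ, Module.End.mul_apply]

/-- An explicit inverse of `L ^ (n - t)`, from horizontal forms of degree `2 n - t` to horizontal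
forms of degree `t`. -/
def lefInv (Ω : E [⋀^Fin 2]→L[ℝ] ℝ) (n : ℕ) (b v : Fin (2 * n) → E) : ℕ → Forms E → Forms E
  | 0, f => (f (2 * n) b / (lef Ω ^ n) (oneForm E) (2 * n) b) • oneForm E
  | t + 1, f => (t + 1 : ℝ)⁻¹ • ∑ i,
      (lef Ω (ins (b i) (lefInv Ω n b v t (ext1 (flatC Ω (v i)) f))) +
        ((n : ℝ) - t) • ext1 (flatC Ω (b i)) (lefInv Ω n b v t (ext1 (flatC Ω (v i)) f)))

theorem top_form_apply_ne_zero {n : ℕ} {b v : Fin (2 * n) → E} (hF : IsFrame Ω b v) :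
    (lef Ω ^ n) (oneForm E) (2 * n) b ≠ 0 := fun h =>
  lef_pow_oneForm_ne_zero hF le_rfl (hF.eq_zero_of_apply_eq_zero
    (lef_pow_mem_horForms n (by push_cast; ring) oneForm_mem_horForms) h)

/-- In the top degree every horizontal form is a multiple of `L^n 1`, and the factor is read off on
`b`. Below it, let `g i` solve `L^(n-t) (g i) = ι_{v i} Ω ∧ f`. Contract with `b i` and sum:
`sum_ins_ext1` turns the right side into `(t + 1) f`, while `ins_lef_pow` lets `L^(n-t-1)` be
factored out on the left. What remains there, divided by `t + 1`, is the recursion of `lefInv`. -/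
theorem lefInv_spec {n : ℕ} {b v : Fin (2 * n) → E} (hF : IsFrame Ω b v) {t : ℕ} (ht : t ≤ n)
    {f : Forms E} (hf : f ∈ horForms Ω (2 * n - t : ℤ)) :
    lefInv Ω n b v t f ∈ horForms Ω t ∧ (lef Ω ^ (n - t)) (lefInv Ω n b v t f) = f := by
  induction t generalizing f with
  | zero =>
    have hne := top_form_apply_ne_zero hF
    refine ⟨Submodule.smul_mem _ _ oneForm_mem_horForms, ?_⟩
    rw [lefInv, map_smul, ← sub_eq_zero]
    refine hF.eq_zero_of_apply_eq_zero (Submodule.sub_mem _ (Submodule.smul_mem _ _ ?_) ?_) ?_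
    · exact lef_pow_mem_horForms n (by push_cast; ring) oneForm_mem_horForms
    · simpa using hf
    · rw [Nat.sub_zero, Forms.sub_apply, Forms.smul_apply]
      exact sub_eq_zero.2 (div_mul_cancel₀ _ hne)
  | succ t ih =>
    have hg : ∀ i, ext1 (flatC Ω (v i)) f ∈ horForms Ω (2 * n - t : ℤ) := fun i =>
      ext1_mem_horForms (by push_cast; omega) _ hf
    have h1 := fun i => (ih (by omega) (hg i)).1
    have h2 := fun i => (ih (by omega) (hg i)).2
    refine ⟨Submodule.smul_mem _ _ (Submodule.sum_mem _ fun i _ => Submodule.add_mem _ ?_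
      (Submodule.smul_mem _ _ ?_)), ?_⟩
    · exact lef_mem_horForms (by push_cast; omega)
        (ins_mem_horForms (l := t - 1) (by omega) _ (h1 i))
    · exact ext1_mem_horForms (by push_cast; omega) _ (h1 i)
    · obtain ⟨s, rfl⟩ := Nat.exists_eq_add_of_le ht
      have h3 := hF.sum_ins_ext1 hf
      have e1 : t + 1 + s - t = s + 1 := by omega
      have e2 : t + 1 + s - (t + 1) = s := by omega
      rw [e1] at h2
      have h4 : ∀ i, ins (b i) (ext1 (flatC Ω (v i)) f) =
          (lef Ω ^ (s + 1)) (ins (b i) (lefInv Ω _ b v t (ext1 (flatC Ω (v i)) f))) +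
          ((s + 1 : ℕ) : ℝ) • (lef Ω ^ s) (ext1 (flatC Ω (b i))
            (lefInv Ω _ b v t (ext1 (flatC Ω (v i)) f))) := fun i => by
        rw [← ins_lef_pow, h2 i]
      rw [e2, lefInv, map_smul, map_sum]
      have h5 : ((2 * (t + 1 + s) : ℕ) : ℝ) - ((2 * (t + 1 + s : ℕ) - (t + 1 : ℕ) : ℤ) : ℝ) =
          t + 1 := by
        push_cast
        ring
      have h6 : (((t + 1 + s : ℕ) : ℝ) - t) = ((s + 1 : ℕ) : ℝ) := by
        push_cast
        ring
      rw [Finset.sum_congr rfl fun i _ => h4 i, h5] at h3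
      simp only [map_add, map_smul, h6, ← lef_pow_succ']
      rw [h3, smul_smul, inv_mul_cancel₀ (by positivity), one_smul]

/-- A horizontal form of degree `n + k` is in the image of `L ^ k`. -/
theorem lef_pow_surjective {n : ℕ} {b v : Fin (2 * n) → E} (hF : IsFrame Ω b v) (k : ℕ)
    {f : Forms E} (hf : f ∈ horForms Ω (n + k)) :
    ∃ g ∈ horForms Ω (n - k), (lef Ω ^ k) g = f := by
  by_cases hk : k ≤ n
  · have := lefInv_spec hF (t := n - k) (by omega) (f := f) (by
      convert hf using 2
      omega)
    rw [Nat.sub_sub_self hk] at this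
    refine ⟨_, ?_, this.2⟩
    have h := this.1
    push_cast [hk] at h
    exact h
  · refine ⟨0, Submodule.zero_mem _, ?_⟩
    rw [hF.eq_zero_of_lt (by push_cast; omega) hf, map_zero]

/-- The vectors `v i` with `ι_{v i} Ω` dual to `b i`. -/
def dualVectors (Ω : E [⋀^Fin 2]→L[ℝ] ℝ) {N : ℕ} (b : Fin N → E) (i : Fin N) : E :=
  ∑ j, (Matrix.of fun i j => flatC Ω (b i) (b j))⁻¹ i j • b j

/-- An invertible Gram matrix makes `w ↦ (Ω (b j, w))_j` surjective onto `ℝ^N`, so its kernel has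
dimension `p`. It contains the kernel of `Ω`, hence equals it, and the residues lie in it. The
condition on `b` is open in `Ω`, so one `b` serves a whole neighbourhood. -/
theorem isFrame_dualVectors {N p : ℕ} (hdim : finrank ℝ E = p + N)
    (hker : finrank ℝ (LinearMap.ker (flat Ω)) = p) (b : Fin N → E)
    (hdet : (Matrix.of fun i j => flatC Ω (b i) (b j)).det ≠ 0) :
    IsFrame Ω b (dualVectors Ω b) := by
  set M := Matrix.of fun i j => flatC Ω (b i) (b j) with hM
  have hu : IsUnit M.det := isUnit_iff_ne_zero.2 hdet
  have hd : ∀ i w, flatC Ω (dualVectors Ω b i) w = ∑ j, M⁻¹ i j * flatC Ω (b j) w := fun i w => by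
    rw [dualVectors, flatC_sum]
    simp [flatC_smul, hM]
  have hdual : ∀ i j, flatC Ω (dualVectors Ω b i) (b j) = if i = j then 1 else 0 := fun i j => by
    have := congrFun (congrFun (Matrix.nonsing_inv_mul M hu) i) j
    rw [Matrix.mul_apply, Matrix.one_apply] at this
    rw [hd, ← this]
    rfl
  refine ⟨hdual, fun w => ?_⟩
  let φ : E →ₗ[ℝ] (Fin N → ℝ) := LinearMap.pi fun j => flat Ω (b j)
  have hφ : Function.Surjective φ := fun y => by
    refine ⟨∑ i, (M⁻¹.mulVec y) i • b i, ?_⟩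
    have h1 : M.mulVec (M⁻¹.mulVec y) = y := by
      rw [Matrix.mulVec_mulVec, Matrix.mul_nonsing_inv M hu, Matrix.one_mulVec]
    funext j
    rw [map_sum, ← congrFun h1 j, Finset.sum_apply, Matrix.mulVec, dotProduct]
    refine Finset.sum_congr rfl fun i _ => ?_
    rw [map_smul, Pi.smul_apply, smul_eq_mul, mul_comm]
    rfl
  have hle : LinearMap.ker (flat Ω) ≤ LinearMap.ker φ := fun t ht => by
    rw [LinearMap.mem_ker] at ht ⊢
    funext j
    have h1 : flatC Ω t = 0 := by
      ext z
      exact LinearMap.congr_fun ht z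
    exact flatC_of_ker h1 (b j)
  have heq : LinearMap.ker (flat Ω) = LinearMap.ker φ := by
    refine Submodule.eq_of_le_of_finrank_eq hle ?_
    have h1 := φ.finrank_range_add_finrank_ker
    rw [LinearMap.range_eq_top.2 hφ, finrank_top, finrank_fin_fun] at h1
    omega
  have hw : w - ∑ i, flatC Ω (dualVectors Ω b i) w • b i ∈ LinearMap.ker φ := by
    set w' := w - ∑ i, flatC Ω (dualVectors Ω b i) w • b i with hw'
    have h1 : ∀ i, flatC Ω (dualVectors Ω b i) w' = 0 := fun i => by
      rw [hw', map_sub, map_sum]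
      simp [hdual]
    have h2 : M⁻¹.mulVec (φ w') = 0 := by
      funext i
      exact (hd i w').symm.trans (h1 i)
    have h3 : M.mulVec (M⁻¹.mulVec (φ w')) = φ w' := by
      rw [Matrix.mulVec_mulVec, Matrix.mul_nonsing_inv M hu, Matrix.one_mulVec]
    rw [LinearMap.mem_ker, ← h3, h2, Matrix.mulVec_zero]
  rw [← heq, LinearMap.mem_ker] at hw
  ext z
  exact LinearMap.congr_fun hw z

/-- Take a basis of a complement of the kernel. A null vector of the Gram matrix would be orthogonal
both to the complement and to the kernel, so it would lie in the kernel. -/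
theorem exists_det_ne_zero {N p : ℕ} (hdim : finrank ℝ E = p + N)
    (hker : finrank ℝ (LinearMap.ker (flat Ω)) = p) :
    ∃ b : Fin N → E, (Matrix.of fun i j => flatC Ω (b i) (b j)).det ≠ 0 := by
  obtain ⟨H, hH⟩ := (LinearMap.ker (flat Ω)).exists_isCompl
  have hHdim : finrank ℝ H = N := by
    have := Submodule.finrank_add_eq_of_isCompl hH
    omega
  let b := finBasisOfFinrankEq ℝ H hHdim
  refine ⟨fun i => b i, fun hdet => ?_⟩
  obtain ⟨c, hc, hMc⟩ := Matrix.exists_mulVec_eq_zero_iff.2 hdet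
  set h : H := ∑ i, c i • b i with hh
  have h1 : ∀ i, flatC Ω (b i : E) (h : E) = 0 := fun i => by
    have := congrFun hMc i
    simp only [Matrix.mulVec, dotProduct, Matrix.of_apply, Pi.zero_apply] at this
    rw [hh]
    push_cast
    rw [map_sum, ← this]
    simp [mul_comm]
  have h2 : (h : E) ∈ LinearMap.ker (flat Ω) := by
    rw [LinearMap.mem_ker]
    ext z
    change flatC Ω (h : E) z = 0
    have hz : z ∈ LinearMap.ker (flat Ω) ⊔ H := by rw [hH.sup_eq_top]; trivial
    obtain ⟨y, hy, x, hx, rfl⟩ := Submodule.mem_sup.1 hz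
    have hy' : flatC Ω y = 0 := by
      ext z
      exact LinearMap.congr_fun (LinearMap.mem_ker.1 hy) z
    rw [map_add, flatC_of_ker hy', zero_add]
    have hx' : x = ∑ i, b.repr ⟨x, hx⟩ i • (b i : E) := by
      have := congrArg Subtype.val (b.sum_repr ⟨x, hx⟩)
      push_cast at this
      exact this.symm
    rw [hx', map_sum]
    refine Finset.sum_eq_zero fun i _ => ?_
    rw [map_smul, flatC_swap, h1, neg_zero, smul_zero]
  have h3 : h = 0 := Subtype.ext (Submodule.disjoint_def.1 hH.disjoint _ h2 h.2)
  exact hc (funext fun i => Fintype.linearIndependent_iff.1 b.linearIndependent c h3 i)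

end Inverse

/-! ### The star operator at a point and its action on primitive forms -/

section StarOperator

open ContinuousAlternatingMap (curryLeft curryLeft_zero constOfIsEmpty curryLeft_apply_apply)

variable {E : Type*} [NormedAddCommGroup E] [NormedSpace ℝ E] [FiniteDimensional ℝ E]
  {Ω : E [⋀^Fin 2]→L[ℝ] ℝ}

theorem exteriorPower_induction {k : ℕ} {P : ⋀[ℝ]^k E → Prop} (h0 : P 0)
    (hadd : ∀ X Y, P X → P Y → P (X + Y)) (hsmul : ∀ (r : ℝ) X, P X → P (r • X))
    (h : ∀ u : Fin k → E, P (exteriorPower.ιMulti ℝ k u)) (X : ⋀[ℝ]^k E) : P X := by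
  have hX : X ∈ Submodule.span ℝ (Set.range (exteriorPower.ιMulti ℝ k (M := E))) := by
    rw [exteriorPower.ιMulti_span]
    trivial
  induction hX using Submodule.span_induction with
  | mem x hx =>
    obtain ⟨u, rfl⟩ := hx
    exact h u
  | zero => exact h0
  | add x y _ _ hx hy => exact hadd x y hx hy
  | smul r x _ hx => exact hsmul r x hx

/-- Left multiplication by a vector on multivectors. -/
def vecMul {k : ℕ} (u : E) : ⋀[ℝ]^k E →ₗ[ℝ] ⋀[ℝ]^(k + 1) E :=
  mulLeft (add_comm 1 k) (exteriorPower.ιMulti ℝ 1 ![u])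

theorem vecMul_ιMulti {k : ℕ} (u : E) (w : Fin k → E) :
    vecMul u (exteriorPower.ιMulti ℝ k w) =
      exteriorPower.ιMulti ℝ (k + 1) (Fin.cons u w : Fin (k + 1) → E) := by
  ext
  simp only [vecMul, mulLeft, ExteriorAlgebra.ιMulti_apply, exteriorPower.ιMulti_apply_coe,
    LinearMap.codRestrict_apply, LinearMap.comp_apply, LinearMap.mulLeft_apply,
    Submodule.subtype_apply, List.ofFn_succ, List.prod_cons, Fin.cons_zero, Fin.cons_succ]
  simp

/-- On decomposable multivectors this is the expansion of a determinant along its first column. -/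
theorem flatPow_vecMul (Ω : E [⋀^Fin 2]→L[ℝ] ℝ) {k : ℕ} (u : E) (X : ⋀[ℝ]^k E)
    (ξ : E [⋀^Fin k]→L[ℝ] ℝ) (hX : flatPow Ω k X = ξ.toAlternatingMap) :
    flatPow Ω (k + 1) (vecMul u X) = (oneWedge (flatC Ω u) ξ).toAlternatingMap := by
  ext w
  have key : ∀ X : ⋀[ℝ]^k E, flatPow Ω (k + 1) (vecMul u X) w = ∑ i : Fin (k + 1),
      (-1 : ℝ) ^ (i : ℕ) * (flatC Ω u (w i) * flatPow Ω k X (i.removeNth w)) := by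
    intro X
    induction X using exteriorPower_induction with
    | h0 => simp
    | hadd X Y hX hY =>
      simp only [map_add, AlternatingMap.add_apply, hX, hY, mul_add, Finset.sum_add_distrib]
    | hsmul r X hX =>
      simp only [map_smul, AlternatingMap.smul_apply, hX, smul_eq_mul, Finset.mul_sum]
      exact Finset.sum_congr rfl fun i _ => by ring
    | h x =>
      rw [vecMul_ιMulti, flatPow_ιMulti, Matrix.det_succ_column_zero]
      refine Finset.sum_congr rfl fun i _ => ?_
      rw [flatPow_ιMulti, mul_assoc]
      rfl
  rw [key, hX]
  exact (oneWedge_apply _ _ _).symm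

/-- The interior product with a multivector, as a form of degree `l`. -/
def contractForm {k l m : ℕ} (h : k + l = m) (η : E [⋀^Fin m]→L[ℝ] ℝ) : ⋀[ℝ]^k E →ₗ[ℝ] Forms E where
  toFun X := Forms.single l (toCont (contract h X η.toAlternatingMap))
  map_add' X Y := by
    rw [← map_add]
    congr 1
    ext v
    change exteriorPower.alternatingMapLinearEquiv η.toAlternatingMap (mulLeft h (X + Y) _) =
      exteriorPower.alternatingMapLinearEquiv η.toAlternatingMap (mulLeft h X _) +
        exteriorPower.alternatingMapLinearEquiv η.toAlternatingMap (mulLeft h Y _)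
    rw [← map_add]
    congr 1
    ext
    simp [mulLeft, add_mul]
  map_smul' r X := by
    rw [RingHom.id_apply, ← map_smul]
    congr 1
    ext v
    change exteriorPower.alternatingMapLinearEquiv η.toAlternatingMap (mulLeft h (r • X) _) =
      r • exteriorPower.alternatingMapLinearEquiv η.toAlternatingMap (mulLeft h X _)
    rw [← map_smul]
    congr 1
    ext
    simp [mulLeft]

theorem contractForm_apply {k l m : ℕ} (h : k + l = m) (η : E [⋀^Fin m]→L[ℝ] ℝ) (X : ⋀[ℝ]^k E) :
    contractForm h η X = Forms.single l (toCont (contract h X η.toAlternatingMap)) := rfl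

theorem append_cons_left {k l : ℕ} (u : E) (w : Fin k → E) (y : Fin l → E)
    (h : k + l + 1 = k + 1 + l) :
    Fin.append (Fin.cons u w : Fin (k + 1) → E) y ∘ Fin.cast h = Fin.cons u (Fin.append w y) := by
  funext i
  cases i using Fin.cases with
  | zero => exact Fin.append_left (Fin.cons u w : Fin (k + 1) → E) y 0
  | succ i =>
    rw [Fin.cons_succ]
    induction i using Fin.addCases with
    | left i =>
      rw [Fin.append_left]
      exact Fin.append_left (Fin.cons u w : Fin (k + 1) → E) y i.succ
    | right i =>
      rw [Fin.append_right]
      have : Fin.cast h (Fin.natAdd k i).succ = Fin.natAdd (k + 1) i := by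
        ext
        simp
        omega
      rw [Function.comp_apply, this, Fin.append_right]

theorem append_cons_right {k l : ℕ} (u : E) (w : Fin k → E) (y : Fin l → E) :
    (Fin.append w (Fin.cons u y : Fin (l + 1) → E) : Fin (k + (l + 1)) → E) =
      Fin.insertNth (α := fun _ => E) (⟨k, by omega⟩ : Fin (k + l + 1)) u (Fin.append w y) := by
  rw [Fin.eq_insertNth_iff]
  constructor
  · exact Fin.append_right w (Fin.cons u y : Fin (l + 1) → E) 0
  · funext i
    rw [Fin.removeNth]
    induction i using Fin.addCases with
    | left i =>
      have : (⟨k, by omega⟩ : Fin (k + l + 1)).succAbove (Fin.castAdd l i) =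
          Fin.castAdd (l + 1) i := by
        rw [Fin.succAbove_of_castSucc_lt]
        · rfl
        · simp [Fin.lt_def]
      rw [this, Fin.append_left, Fin.append_left]
    | right i =>
      have : (⟨k, by omega⟩ : Fin (k + l + 1)).succAbove (Fin.natAdd k i) =
          Fin.natAdd k i.succ := by
        rw [Fin.succAbove_of_le_castSucc]
        · rfl
        · simp [Fin.le_def]
      rw [this, Fin.append_right, Fin.append_right, Fin.cons_succ]

theorem ins_single (u : E) {l : ℕ} (ξ : E [⋀^Fin (l + 1)]→L[ℝ] ℝ) :
    ins u (Forms.single (l + 1) ξ) = Forms.single l (curryLeft ξ u) := by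
  ext1 j
  rw [ins_apply]
  by_cases hj : j = l
  · subst hj
    rw [Forms.single_same, Forms.single_same]
  · rw [Forms.single_of_ne (by omega), Forms.single_of_ne hj, curryLeft_zero]
    rfl

/-- Contraction with `u ∧ X` inserts `u` before the `k` vectors of `X`, whereas `ι_u ι_X` inserts it
after them. -/
theorem ins_contractForm {k l m : ℕ} (h : k + 1 + l = m) (h' : k + (l + 1) = m) (u : E)
    (X : ⋀[ℝ]^k E) (η : E [⋀^Fin m]→L[ℝ] ℝ) :
    contractForm h η (vecMul u X) = (-1 : ℝ) ^ k • ins u (contractForm h' η X) := by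
  subst h'
  induction X using exteriorPower_induction with
  | h0 => simp
  | hadd X Y hX hY => simp only [map_add, hX, hY, smul_add]
  | hsmul r X hX => simp only [map_smul, hX, smul_comm r]
  | h x =>
    rw [contractForm_apply, contractForm_apply, ins_single, ← map_smul]
    congr 1
    ext y
    have h1 : contract h (vecMul u (exteriorPower.ιMulti ℝ k x)) η.toAlternatingMap y =
        η (Fin.cons u (Fin.append x y)) := by
      rw [vecMul_ιMulti, contract_ιMulti, append_cons_left u x y h.symm]
      rfl
    have h2 : contract rfl (exteriorPower.ιMulti ℝ k x) η.toAlternatingMap (Fin.cons u y) =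
        η (Fin.append x (Fin.cons u y : Fin (l + 1) → E)) := by
      rw [contract_ιMulti]
      rfl
    have h3 := η.toAlternatingMap.neg_one_pow_smul_map_insertNth (⟨k, by omega⟩ : Fin (k + l + 1)) u
      (Fin.append x y)
    refine h1.trans (h3.symm.trans ?_)
    rw [zsmul_eq_mul]
    push_cast
    exact congrArg (fun z => (-1 : ℝ) ^ k * z) ((congrArg η (append_cons_right u x y)).symm.trans
      h2.symm)

/-- The star of the component of degree `k`. -/
def starF (Ω : E [⋀^Fin 2]→L[ℝ] ℝ) (n k : ℕ) (f : Forms E) : Forms E :=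
  Forms.single (2 * n - k) (starAt Ω n (f k))

theorem starF_eq {n k l : ℕ} (h : k + l = 2 * n) {f : Forms E} {X : ⋀[ℝ]^k E}
    (hX : flatPow Ω k X = (f k).toAlternatingMap) :
    starF Ω n k f = contractForm h (wedgePow Ω n) X := by
  obtain rfl : l = 2 * n - k := by omega
  rw [starF, starAt_eq Ω n (by omega) (f k) X hX]
  rfl

/-- The coefficient of `L ^ (s - r) f` in the star of `L ^ r f`, for a primitive form `f` of degree
`j = n - s`. -/
def starCoeff : ℕ → ℕ → ℕ → ℝ
  | 0, _, 0 => 1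
  | j + 1, s, 0 => (-1) ^ j * starCoeff j (s + 1) 0 * (s + 1)
  | j, s, r + 1 => starCoeff j s r * ((s - r) * (r + 1))

theorem starCoeff_ne_zero (j : ℕ) {s r : ℕ} (h : r ≤ s) : starCoeff j s r ≠ 0 := by
  induction r with
  | zero =>
    clear h
    induction j generalizing s with
    | zero => rw [starCoeff]; exact one_ne_zero
    | succ j ih =>
      rw [starCoeff]
      exact mul_ne_zero (mul_ne_zero (pow_ne_zero _ (by norm_num)) ih) (by positivity)
  | succ r ih =>
    rw [starCoeff]
    refine mul_ne_zero (ih (by omega)) (mul_ne_zero (sub_ne_zero.2 ?_) (by positivity))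
    exact_mod_cast (show s ≠ r by omega)

section Frame

variable {n : ℕ} {b v : Fin (2 * n) → E} (hF : IsFrame Ω b v)

include hF

/-- Euler's identity writes `f` through the products `ι_{v i} Ω ∧ ι_{b i} f`, and induction
represents each `ι_{b i} f`. Hence horizontal forms of degree at most `2 n` never meet the default
value of `starAt`. -/
theorem IsFrame.exists_flatPow {k : ℕ} {f : Forms E} (hf : f ∈ horForms Ω k) :
    ∃ X : ⋀[ℝ]^k E, flatPow Ω k X = (f k).toAlternatingMap := by
  induction k generalizing f with
  | zero =>
    refine ⟨f 0 ![] • exteriorPower.ιMulti ℝ 0 ![], ?_⟩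
    ext w
    rw [map_smul, AlternatingMap.smul_apply, flatPow_ιMulti]
    simp
    congr 1
    exact Subsingleton.elim _ _
  | succ k ih =>
    choose X hX using fun i => ih (ins_mem_horForms (l := k) (by push_cast; rfl) (b i) hf)
    have h1 := congrFun (hF.euler hf) (k + 1)
    rw [Forms.sum_apply, Forms.smul_apply] at h1
    refine ⟨((k + 1 : ℕ) : ℝ)⁻¹ • ∑ i, vecMul (v i) (X i), ?_⟩
    rw [map_smul, map_sum, Finset.sum_congr rfl fun i _ => flatPow_vecMul Ω (v i) (X i) _ (hX i),
      inv_smul_eq_iff₀ (by positivity)]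
    ext w
    have h2 := DFunLike.congr_fun h1 w
    rw [ContinuousAlternatingMap.sum_apply] at h2
    refine Eq.trans ?_ h2
    exact map_sum (⟨⟨fun g : E [⋀^Fin (k + 1)]→ₗ[ℝ] ℝ => g w, rfl⟩, fun _ _ => rfl⟩ :
      (E [⋀^Fin (k + 1)]→ₗ[ℝ] ℝ) →+ ℝ) _ _

theorem starF_add {k : ℕ} (hk : k ≤ 2 * n) {f g : Forms E} (hf : f ∈ horForms Ω k)
    (hg : g ∈ horForms Ω k) : starF Ω n k (f + g) = starF Ω n k f + starF Ω n k g := by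
  obtain ⟨X, hX⟩ := hF.exists_flatPow hf
  obtain ⟨Y, hY⟩ := hF.exists_flatPow hg
  have h : k + (2 * n - k) = 2 * n := by omega
  rw [starF_eq h hX, starF_eq h hY, ← map_add]
  refine starF_eq h ?_
  rw [map_add, hX, hY]
  rfl

theorem starF_smul {k : ℕ} (hk : k ≤ 2 * n) (r : ℝ) {f : Forms E} (hf : f ∈ horForms Ω k) :
    starF Ω n k (r • f) = r • starF Ω n k f := by
  obtain ⟨X, hX⟩ := hF.exists_flatPow hf
  have h : k + (2 * n - k) = 2 * n := by omega
  rw [starF_eq h hX, ← map_smul]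
  refine starF_eq h ?_
  rw [map_smul, hX]
  rfl

theorem starF_zero {k : ℕ} (hk : k ≤ 2 * n) : starF Ω n k (0 : Forms E) = 0 := by
  simpa using starF_smul hF hk 0 (Submodule.zero_mem (horForms Ω k))

theorem starF_sum {k : ℕ} (hk : k ≤ 2 * n) {ι : Type*} (s : Finset ι) {f : ι → Forms E}
    (hf : ∀ i, f i ∈ horForms Ω k) :
    starF Ω n k (∑ i ∈ s, f i) = ∑ i ∈ s, starF Ω n k (f i) := by
  classical
  induction s using Finset.induction_on with
  | empty => simp [starF_zero hF hk]
  | insert a s ha ih =>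
    rw [Finset.sum_insert ha, Finset.sum_insert ha,
      starF_add hF hk (hf a) (Submodule.sum_mem _ fun i _ => hf i), ih]

/-- If `X` represents `f`, then `u ∧ X` represents `ι_u Ω ∧ f`. With `starF_oneForm`, this rule
replaces the definition of the star in all computations with it. -/
theorem starF_ext1 {k : ℕ} (hk : k + 1 ≤ 2 * n) (u : E) {f : Forms E} (hf : f ∈ horForms Ω k) :
    starF Ω n (k + 1) (ext1 (flatC Ω u) f) = (-1 : ℝ) ^ k • ins u (starF Ω n k f) := by
  obtain ⟨X, hX⟩ := hF.exists_flatPow hf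
  have h : k + ((2 * n - (k + 1)) + 1) = 2 * n := by omega
  have h' : k + 1 + (2 * n - (k + 1)) = 2 * n := by omega
  rw [starF_eq h hX, ← ins_contractForm h' h]
  exact starF_eq h' (flatPow_vecMul Ω u X _ hX)

omit hF in
theorem wedge_const_right {a : ℕ} (h : a + 0 = a) (α : E [⋀^Fin a]→L[ℝ] ℝ)
    (β : E [⋀^Fin 0]→L[ℝ] ℝ) : wedge h α β = β ![] • α := by
  ext v
  have hs : ∀ σ : Equiv.Perm (Fin a), ((Equiv.Perm.sign σ : ℤ) : ℝ) *
      (α (fun i => v (σ (Fin.cast h (Fin.castAdd 0 i)))) *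
        β (fun i => v (σ (Fin.cast h (Fin.natAdd a i))))) = β ![] * α v := by
    intro σ
    have h1 : (fun i => v (σ (Fin.cast h (Fin.castAdd 0 i)))) = v ∘ σ := rfl
    rw [h1, show α (v ∘ σ) = _ from α.toAlternatingMap.map_perm v σ,
      Subsingleton.elim (fun i => v (σ (Fin.cast h (Fin.natAdd a i)))) ![]]
    have h2 : ((Equiv.Perm.sign σ : ℤ) : ℝ) * ((Equiv.Perm.sign σ : ℤ) : ℝ) = 1 := by
      rw [← Int.cast_mul, ← Units.val_mul, Int.units_mul_self]
      simp
    rw [Units.smul_def, zsmul_eq_mul]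
    change _ * (_ * α v * _) = _
    linear_combination β ![] * α v * h2
  rw [wedge_apply, Finset.sum_congr rfl fun σ _ => hs σ]
  simp [Fintype.card_perm]
  have : (a.factorial : ℝ) ≠ 0 := by positivity
  field_simp

theorem starF_oneForm : starF Ω n 0 (oneForm E) = (lef Ω ^ n) (oneForm E) := by
  have h : 0 + 2 * n = 2 * n := by omega
  have hX : flatPow Ω 0 (exteriorPower.ιMulti ℝ 0 ![]) = (oneForm E 0).toAlternatingMap := by
    ext w
    rw [flatPow_ιMulti]
    simp [oneForm, Forms.single_same]
  rw [starF_eq h hX, contractForm_apply, ← wedgeOp_wedgePow, oneForm,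
    wedgeOp_single (add_zero (2 * n))]
  congr 1
  ext y
  refine (contract_ιMulti h _ _ y).trans ?_
  rw [wedge_const_right]
  change wedgePow Ω n _ = (1 : ℝ) * wedgePow Ω n y
  rw [one_mul]
  congr 1
  funext i
  have : Fin.cast h.symm i = Fin.natAdd 0 i := by
    ext
    simp
  rw [Function.comp_apply, this, Fin.append_right]

theorem IsFrame.two_smul_lef (f : Forms E) :
    (2 : ℝ) • lef Ω f = ∑ i, ext1 (flatC Ω (v i)) (ext1 (flatC Ω (b i)) f) := by
  have h := sum_oneWedge_curryLeft (fun i => flatC Ω (v i)) b (k := 1) Ω fun w => by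
    rw [curryLeft_two, hF.residue]
    ext
    simp
  rw [lef, ← wedgeOp_smul_left, show (2 : ℝ) = ((1 + 1 : ℕ) : ℝ) by norm_num, ← h,
    wedgeOp_sum_left]
  refine Finset.sum_congr rfl fun i _ => ?_
  rw [wedgeOp_oneWedge, curryLeft_two, wedgeOp_ofSubsingleton]

/-- Apply `starF_ext1` twice to each term of `2 L f = ∑ i, ι_{v i} Ω ∧ ι_{b i} Ω ∧ f`; the signs
`(-1)^(k+1)` and `(-1)^k` multiply to `-1`. -/
theorem starF_lef {k : ℕ} (hk : k + 2 ≤ 2 * n) {f : Forms E} (hf : f ∈ horForms Ω k) :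
    starF Ω n (k + 2) (lef Ω f) = (-2⁻¹ : ℝ) • lam b v (starF Ω n k f) := by
  have hb : ∀ i, ext1 (flatC Ω (b i)) f ∈ horForms Ω (k + 1 : ℕ) := fun i =>
    ext1_mem_horForms (by push_cast; rfl) _ hf
  have h1 : (2 : ℝ) • starF Ω n (k + 2) (lef Ω f) = - lam b v (starF Ω n k f) := by
    rw [← starF_smul hF hk 2 (lef_mem_horForms (by push_cast; rfl) hf), hF.two_smul_lef,
      starF_sum hF hk _ fun i => ext1_mem_horForms (by push_cast; ring) _ (hb i), lam_apply,
      ← Finset.sum_neg_distrib]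
    refine Finset.sum_congr rfl fun i _ => ?_
    rw [starF_ext1 hF (k := k + 1) hk _ (hb i), starF_ext1 hF (by omega) _ hf, map_smul, smul_smul,
      ← pow_add, show k + 1 + k = 2 * k + 1 by ring, pow_succ, pow_mul]
    simp
  apply two_smul_cancel
  rw [h1, smul_smul]
  norm_num

/-- Primitive forms of degree `n - s` are annihilated by `lam`. -/
theorem lam_eq_zero_of_primitive {s : ℕ} {f : Forms E} (hf : f ∈ horForms Ω (n - s))
    (h : (lef Ω ^ (s + 1)) f = 0) : lam b v f = 0 := by
  have h1 := hF.lam_lef_pow hf s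
  -- In degree `n - s` the `sl₂` coefficient for the exponent `s + 1` vanishes, so `L^(s+1) (Λ f) =
  -- Λ (L^(s+1) f) = 0`. Since `Λ f` has degree `n - (s + 2)`, injectivity of `L^(s+2)` applies.
  have h2 : ((s : ℝ) + 1) * (2 * ((n - s : ℤ) : ℝ) + 2 * s - ((2 * n : ℕ) : ℝ)) = 0 := by
    push_cast
    ring
  rw [h, map_zero, h2, zero_smul, add_zero] at h1
  refine lef_pow_injective hF (s + 2) (m := n - s - 2) (by push_cast; ring)
    (lam_mem_horForms b v (by ring) hf).1 ?_
  rw [lef_pow_succ, ← h1, map_zero]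

omit hF in
-- Contracting `L^(s+2) f = 0` leaves only this term, since the other one contains `L^(s+1) f`. So
-- contraction preserves primitivity, with the exponent adapted to the lower degree.
theorem ins_primitive {s : ℕ} {f : Forms E} (h : (lef Ω ^ (s + 1)) f = 0) (w : E) :
    (lef Ω ^ (s + 2)) (ins w f) = 0 := by
  have h1 := ins_lef_pow Ω w (s + 1) f
  rw [lef_pow_succ, h, map_zero, map_zero, lef_pow_ext1, h, map_zero, smul_zero, add_zero] at h1
  exact h1.symm

/-- Induction through Euler's identity. The forms `ι_{b i} f` are primitive, so the star of `ι_{v i}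
Ω ∧ ι_{b i} f` is a multiple of `ι_{v i} L^(s+1) ι_{b i} f`. Commuting `ι_{v i}` past `L^(s+1)` and
summing gives `L^(s+1) Λ f`, which vanishes, and a multiple of `L^s f`. -/
theorem starF_primitive {j s : ℕ} (hn : j + s = n) {f : Forms E} (hf : f ∈ horForms Ω j)
    (hp : (lef Ω ^ (s + 1)) f = 0) : starF Ω n j f = starCoeff j s 0 • (lef Ω ^ s) f := by
  induction j generalizing s f with
  | zero =>
    obtain rfl : s = n := by omega
    rw [eq_smul_oneForm hf.1, starF_smul hF (k := 0) (by omega) _ oneForm_mem_horForms,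
      starF_oneForm hF,
      map_smul, starCoeff, one_smul]
  | succ j ih =>
    rw [starCoeff]
    set c := starCoeff j (s + 1) 0
    have hb : ∀ i, ins (b i) f ∈ horForms Ω j := fun i => ins_mem_horForms (by push_cast; rfl) _ hf
    have he := hF.euler hf
    have hlam := lam_eq_zero_of_primitive hF (s := s) (by
      convert hf using 2
      omega) hp
    have h1 : ((j + 1 : ℕ) : ℝ) • starF Ω n (j + 1) f =
        ((j + 1 : ℕ) : ℝ) • ((-1) ^ j * c * (s + 1)) • (lef Ω ^ s) f := by
      have he' := hF.euler hf
      rw [Int.cast_natCast] at he'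
      rw [← starF_smul hF (by omega) _ hf, ← he',
        starF_sum hF (by omega) _ fun i => ext1_mem_horForms (by push_cast; rfl) _ (hb i)]
      have h2 : ∀ i, starF Ω n (j + 1) (ext1 (flatC Ω (v i)) (ins (b i) f)) =
          ((-1) ^ j * c) • ((lef Ω ^ (s + 1)) (ins (v i) (ins (b i) f)) +
            ((s + 1 : ℕ) : ℝ) • (lef Ω ^ s) (ext1 (flatC Ω (v i)) (ins (b i) f))) := fun i => by
        rw [starF_ext1 hF (by omega) _ (hb i), ih (by omega) (hb i) (ins_primitive hp _), map_smul,
          ins_lef_pow, smul_smul]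
      rw [Finset.sum_congr rfl fun i _ => h2 i, ← Finset.smul_sum, Finset.sum_add_distrib,
        ← map_sum, ← lam_apply, hlam, map_zero, zero_add, ← Finset.smul_sum, ← map_sum, he',
        map_smul]
      push_cast
      module
    exact smul_right_injective _ (by positivity : ((j + 1 : ℕ) : ℝ) ≠ 0) h1

/-- On a primitive form `f` of degree `n - s`, the star of `L ^ r f` is a nonzero multiple of
`L ^ (s - r) f`. -/
theorem starF_lef_pow {j s : ℕ} (hn : j + s = n) {r : ℕ} (hr : r ≤ s) {f : Forms E}
    (hf : f ∈ horForms Ω j) (hp : (lef Ω ^ (s + 1)) f = 0) :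
    starF Ω n (j + 2 * r) ((lef Ω ^ r) f) = starCoeff j s r • (lef Ω ^ (s - r)) f := by
  induction r with
  | zero => exact starF_primitive hF hn hf hp
  | succ r ih =>
    obtain ⟨q, rfl⟩ := Nat.exists_eq_add_of_le hr
    have hlam := lam_eq_zero_of_primitive hF (s := r + 1 + q) (by
      convert hf using 2
      omega) hp
    have e1 : r + 1 + q - r = q + 1 := by omega
    have e2 : r + 1 + q - (r + 1) = q := by omega
    rw [lef_pow_succ, show j + 2 * (r + 1) = j + 2 * r + 2 by ring,
      starF_lef hF (by omega) (lef_pow_mem_horForms r (by push_cast; rfl) hf), ih (by omega), e1,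
      e2,
      map_smul, hF.lam_lef_pow hf, hlam, map_zero, zero_add, smul_smul, smul_smul,
      starCoeff]
    -- The `sl₂` coefficient is `(s - r) (2 j + 2 (s - r - 1) - 2 n) = -2 (s - r) (r + 1)` because
    -- `j = n - s`; the factor `-1/2` from `starF_lef` turns it into the recursion of `starCoeff`.
    congr 1
    rw [← hn]
    push_cast
    ring

/-- Descending induction: `⋆ f = 0` forces `⋆ (ι_{v i} Ω ∧ f) = 0`, hence `ι_{v i} Ω ∧ f = 0` for
all `i`, and `sum_ins_ext1` recovers `f` below the top degree. In the top degree `f = L^n g` with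
`g` of degree `0`, and `⋆ f` is a nonzero multiple of `g`. -/
theorem starF_injective {k : ℕ} (hk : k ≤ 2 * n) {f : Forms E} (hf : f ∈ horForms Ω k)
    (h : starF Ω n k f = 0) : f = 0 := by
  obtain ⟨d, hd⟩ := Nat.exists_eq_add_of_le hk
  induction d generalizing k f with
  | zero =>
    obtain rfl : k = 2 * n := by omega
    obtain ⟨g, hg, rfl⟩ := lef_pow_surjective hF n (f := f) (by
      convert hf using 2
      push_cast
      ring)
    have hg0 : g ∈ horForms Ω (0 : ℕ) := by
      convert hg using 2
      simp
    have hc := starCoeff_ne_zero 0 (le_refl n)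
    have h1 := starF_lef_pow hF (by omega) (le_refl n) hg0
      (hF.eq_zero_of_lt (m := 2 * n + 2) (by push_cast; omega)
      (lef_pow_mem_horForms (n + 1) (by push_cast; ring) hg0))
    rw [zero_add, h, Nat.sub_self, pow_zero, Module.End.one_apply, eq_comm, smul_eq_zero] at h1
    rw [h1.resolve_left hc, map_zero]
  | succ d ih =>
    have h1 : ∀ i, ext1 (flatC Ω (v i)) f = 0 := fun i => by
      refine ih (k := k + 1) (by omega) (ext1_mem_horForms (by push_cast; rfl) _ hf) ?_ (by omega)
      rw [starF_ext1 hF (by omega) _ hf, h, map_zero, smul_zero]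
    have h2 := hF.sum_ins_ext1 hf
    rw [Finset.sum_eq_zero fun i _ => by rw [h1, map_zero], eq_comm, smul_eq_zero] at h2
    refine h2.resolve_left ?_
    rw [hd]
    push_cast
    have : (0 : ℝ) ≤ d := d.cast_nonneg
    intro h3
    linarith

end Frame

end StarOperator

/-! ### Abstract form of the equivalence: graded modules with hard Lefschetz -/

section LefschetzModule

/-- A graded module with a differential `D` and a commuting operator `L` of degree `2` satisfying the
hard Lefschetz property around the degree `n`. -/
structure IsLefschetzModule {A : Type*} [AddCommGroup A] [Module ℝ A] (L D : A →ₗ[ℝ] A)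
    (𝒜 : ℤ → Submodule ℝ A) (n : ℕ) : Prop where
  eq_zero_of_neg : ∀ m < 0, ∀ x ∈ 𝒜 m, x = 0
  L_mem : ∀ m, ∀ x ∈ 𝒜 m, L x ∈ 𝒜 (m + 2)
  D_mem : ∀ m, ∀ x ∈ 𝒜 m, D x ∈ 𝒜 (m + 1)
  D_D : ∀ x, D (D x) = 0
  D_L : ∀ x, D (L x) = L (D x)
  injective : ∀ k : ℕ, ∀ x ∈ 𝒜 (n - k), (L ^ k) x = 0 → x = 0
  surjective : ∀ k : ℕ, ∀ y ∈ 𝒜 (n + k), ∃ x ∈ 𝒜 (n - k), (L ^ k) x = y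

/-- A relation `S x y`, to be read as `y = ⋆ x`, that is additive and maps the powers of `L` on a
primitive element to nonzero multiples of the complementary powers. -/
structure IsLefschetzStar {A : Type*} [AddCommGroup A] [Module ℝ A] (L : A →ₗ[ℝ] A)
    (𝒜 : ℤ → Submodule ℝ A) (n : ℕ) (S : A → A → Prop) : Prop where
  add : ∀ x y x' y', S x y → S x' y' → S (x + x') (y + y')
  primitive : ∀ s j : ℕ, j ≤ s → ∃ c : ℝ, c ≠ 0 ∧ ∀ p ∈ 𝒜 (n - s), (L ^ (s + 1)) p = 0 →
    S ((L ^ j) p) (c • (L ^ (s - j)) p)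

variable {A : Type*} [AddCommGroup A] [Module ℝ A] {L D : A →ₗ[ℝ] A} {𝒜 : ℤ → Submodule ℝ A} {n : ℕ}

namespace IsLefschetzModule

variable (hL : IsLefschetzModule L D 𝒜 n)

include hL

theorem L_pow_mem (k : ℕ) {m l : ℤ} (h : l = m + 2 * k) {x : A} (hx : x ∈ 𝒜 m) :
    (L ^ k) x ∈ 𝒜 l := by
  subst h
  induction k with
  | zero => simpa using hx
  | succ k ih =>
    rw [pow_succ', Module.End.mul_apply]
    convert hL.L_mem _ _ ih using 2
    push_cast
    ring

theorem D_L_pow (k : ℕ) (x : A) : D ((L ^ k) x) = (L ^ k) (D x) := by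
  induction k with
  | zero => rfl
  | succ k ih => rw [pow_succ', Module.End.mul_apply, Module.End.mul_apply, hL.D_L, ih]

omit hL in
theorem L_pow_L (k : ℕ) (x : A) : (L ^ k) (L x) = (L ^ (k + 1)) x := by
  rw [pow_succ, Module.End.mul_apply]

/-- `L^(s+1) x` has degree `n + (s + 2)`, so it equals some `L^(s+2) x'`; subtract `L x'` from `x`.
-/
theorem exists_primitive_decomposition {s : ℕ} {x : A} (hx : x ∈ 𝒜 (n - s)) :
    ∃ x₀ ∈ 𝒜 (n - s), ∃ x' ∈ 𝒜 (n - (s + 2 : ℕ)), x = x₀ + L x' ∧ (L ^ (s + 1)) x₀ = 0 := by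
  obtain ⟨x', hx', h⟩ := hL.surjective (s + 2) ((L ^ (s + 1)) x)
    (hL.L_pow_mem (s + 1) (by push_cast; ring) hx)
  have hLx' : L x' ∈ 𝒜 (n - s) := by
    convert hL.L_mem _ _ hx' using 2
    push_cast
    ring
  refine ⟨x - L x', Submodule.sub_mem _ hx hLx', x', hx', by abel, ?_⟩
  rw [map_sub, L_pow_L, h, sub_self]

variable {S : A → A → Prop} (hS : IsLefschetzStar L 𝒜 n S)

include hS

/-- Decompose `x = x₀ + L x'`. The primitive part contributes a multiple of `L^(t-j) x₀`. By
induction the star of `L^(j+1) x'` lies in the image of the power `(t + 2) - (j + 1) = (t - j) + 1`.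
-/
theorem exists_star_L_pow {t : ℕ} {x : A} (hx : x ∈ 𝒜 (n - t)) {j : ℕ} (hj : j ≤ t) :
    ∃ y ∈ 𝒜 (n - t), S ((L ^ j) x) ((L ^ (t - j)) y) := by
  -- `N` bounds the number of steps in which the degree `n - t` drops by `2`; for `N = 0` the degree
  -- is negative.
  suffices H : ∀ N : ℕ, ∀ t : ℕ, n < t + N → ∀ x ∈ 𝒜 (n - t), ∀ j ≤ t,
      ∃ y ∈ 𝒜 (n - t), S ((L ^ j) x) ((L ^ (t - j)) y) from H (n + 1) t (by omega) x hx j hj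
  intro N
  induction N with
  | zero =>
    intro t ht x hx j hj
    obtain ⟨c, hc, h⟩ := hS.primitive t j hj
    obtain rfl := hL.eq_zero_of_neg _ (by omega) x hx
    refine ⟨0, Submodule.zero_mem _, ?_⟩
    simpa using h 0 (Submodule.zero_mem _) (map_zero _)
  | succ N ih =>
    intro t ht x hx j hj
    obtain ⟨x₀, hx₀, x', hx', rfl, h₀⟩ := hL.exists_primitive_decomposition hx
    obtain ⟨c, hc, h⟩ := hS.primitive t j hj
    obtain ⟨y, hy, hy'⟩ := ih (t + 2) (by omega) x' hx' (j + 1) (by omega)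
    have hLy : L y ∈ 𝒜 (n - t) := by
      convert hL.L_mem _ _ hy using 2
      push_cast
      ring
    refine ⟨c • x₀ + L y, Submodule.add_mem _ (Submodule.smul_mem _ _ hx₀) hLy, ?_⟩
    have h1 := hS.add _ _ _ _ (h x₀ hx₀ h₀) hy'
    rw [show t + 2 - (j + 1) = t - j + 1 by omega] at h1
    rwa [map_add, map_add, map_smul, L_pow_L, L_pow_L]

/-- A harmonic element of degree `n + s` is the image under `L ^ s` of a closed element. -/
theorem exists_closed_of_harmonic {s : ℕ} {x : A} (hx : x ∈ 𝒜 (n + s)) (hD : D x = 0)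
    (hstar : ∀ y ∈ 𝒜 (n - s), S x y → D y = 0) : ∃ x' ∈ 𝒜 (n - s), (L ^ s) x' = x ∧ D x' = 0 := by
  obtain ⟨x', hx', rfl⟩ := hL.surjective s x hx
  refine ⟨x', hx', rfl, ?_⟩
  obtain ⟨x₀, hx₀, x₁, hx₁, rfl, h₀⟩ := hL.exists_primitive_decomposition hx'
  obtain ⟨c, hc, h⟩ := hS.primitive s s le_rfl
  obtain ⟨y, hy, hy'⟩ := hL.exists_star_L_pow hS hx₁ (show s + 1 ≤ s + 2 by omega)
  have hLy : L y ∈ 𝒜 (n - s) := by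
    convert hL.L_mem _ _ hy using 2
    push_cast
    ring
  -- This exhibits `c x₀ + L y` as the star of `x = L^s x₀ + L^(s+1) x₁`.
  have h1 := hS.add _ _ _ _ (h x₀ hx₀ h₀) hy'
  rw [Nat.sub_self, pow_zero, Module.End.one_apply, show s + 2 - (s + 1) = 1 by omega, pow_one,
    ← L_pow_L, ← map_add] at h1
  have h2 := hstar _ (Submodule.add_mem _ (Submodule.smul_mem _ _ hx₀) hLy) h1
  rw [map_add, map_smul, hL.D_L] at h2
  -- Closedness of `c x₀ + L y` replaces `c D x₀` by `-L D y`, so `c D x' = L ζ`. Applying `L^s`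
  -- gives `L^(s+1) ζ = c D x = 0`, and `ζ` has degree `n - (s + 1)`.
  set ζ := c • D x₁ - D y with hζ
  have h3 : c • D (x₀ + L x₁) = L ζ := by
    rw [map_add, hL.D_L, hζ, map_sub, map_smul, smul_add, eq_neg_of_add_eq_zero_left h2]
    abel
  have h4 : ζ = 0 := by
    refine hL.injective (s + 1) ζ (Submodule.sub_mem _ (Submodule.smul_mem _ _ ?_) ?_) ?_
    · convert hL.D_mem _ _ hx₁ using 2
      push_cast
      ring
    · convert hL.D_mem _ _ hy using 2
      push_cast
      ring
    · rw [← L_pow_L, ← h3, map_smul, ← hL.D_L_pow, hD, smul_zero]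
  rw [h4, map_zero, smul_eq_zero] at h3
  exact h3.resolve_left hc

section Surjective

variable (hsurj : ∀ s : ℕ, s ≤ n → ∀ x ∈ 𝒜 (n + s), D x = 0 →
  ∃ y ∈ 𝒜 (n - s), D y = 0 ∧ ∃ η ∈ 𝒜 (n + s - 1), x = (L ^ s) y + D η)

include hsurj

omit hS in
-- For `s > n` there is nothing in degree `n + s`, the image under `L^s` of a negative degree. The
-- induction below can therefore pass from `s` to `s + 2` without a bound.
theorem exists_closed_add_exact (s : ℕ) {x : A} (hx : x ∈ 𝒜 (n + s)) (hD : D x = 0) :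
    ∃ y ∈ 𝒜 (n - s), D y = 0 ∧ ∃ η ∈ 𝒜 (n + s - 1), x = (L ^ s) y + D η := by
  by_cases hs : s ≤ n
  · exact hsurj s hs x hx hD
  · obtain ⟨y, hy, rfl⟩ := hL.surjective s x hx
    obtain rfl := hL.eq_zero_of_neg _ (by omega) y hy
    exact ⟨0, hy, map_zero _, 0, Submodule.zero_mem _, by simp⟩

/-- Control of all the `L^j z`, and not only of `z`, is what the induction needs: the star of `L^j
(L z)` is the case `j + 1` for `z`, two degrees lower. The case `j = s` also settles the degrees
above `n`. -/
theorem exists_harmonic_L_pow {s : ℕ} {x : A} (hx : x ∈ 𝒜 (n - s)) (hD : D x = 0) :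
    ∃ z ∈ 𝒜 (n - s), D z = 0 ∧ (∃ θ ∈ 𝒜 (n - s - 1), x = z + D θ) ∧
      ∀ j ≤ s, ∃ w, S ((L ^ j) z) w ∧ D w = 0 := by
  suffices H : ∀ N : ℕ, ∀ s : ℕ, n < s + N → ∀ x ∈ 𝒜 (n - s), D x = 0 →
      ∃ z ∈ 𝒜 (n - s), D z = 0 ∧ (∃ θ ∈ 𝒜 (n - s - 1), x = z + D θ) ∧
        ∀ j ≤ s, ∃ w, S ((L ^ j) z) w ∧ D w = 0 from H (n + 1) s (by omega) x hx hD
  clear hx hD x s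
  intro N
  induction N with
  | zero =>
    intro s hs x hx hD
    obtain rfl := hL.eq_zero_of_neg _ (by omega) x hx
    refine ⟨0, hx, hD, ⟨0, Submodule.zero_mem _, by simp⟩, fun j hj => ⟨0, ?_, map_zero _⟩⟩
    obtain ⟨c, -, h⟩ := hS.primitive s j hj
    simpa using h 0 (Submodule.zero_mem _) (map_zero _)
  | succ N ih =>
    intro s hs x hx hD
    obtain ⟨y, hy, hDy, η, hη, h1⟩ := hL.exists_closed_add_exact hsurj (s + 2)
      (hL.L_pow_mem (s + 1) (by push_cast; ring) hx) (by rw [hL.D_L_pow, hD, map_zero])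
    -- The degree of `η` is `n + (s + 1)`, so hard Lefschetz on forms makes the exact term `D η`
    -- divisible by `L^(s+1)`.
    obtain ⟨θ, hθ, rfl⟩ := hL.surjective (s + 1) η (by
      convert hη using 2
      push_cast
      ring)
    obtain ⟨z, hz, hDz, ⟨φ, hφ, rfl⟩, hstar⟩ := ih (s + 2) (by omega) y hy hDy
    have hL' : ∀ u ∈ 𝒜 (n - (s + 2 : ℕ)), L u ∈ 𝒜 (n - s) := fun u hu => by
      convert hL.L_mem _ _ hu using 2
      push_cast
      ring
    -- With `y = z + D φ`, the element `x - L y - D θ` is the closed primitive part `p`: its image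
    -- under `L^(s+1)` is `L^(s+1) x - L^(s+2) y - D η = 0`.
    have hp : x - L (z + D φ) - D θ ∈ 𝒜 (n - s) := by
      refine Submodule.sub_mem _ (Submodule.sub_mem _ hx (hL' _ hy)) ?_
      convert hL.D_mem _ _ hθ using 2
      push_cast
      ring
    have hDp : D (x - L (z + D φ) - D θ) = 0 := by
      rw [map_sub, map_sub, hD, hL.D_L, hDy, hL.D_D, map_zero, sub_zero, sub_zero]
    have hLp : (L ^ (s + 1)) (x - L (z + D φ) - D θ) = 0 := by
      rw [map_sub, map_sub, h1, L_pow_L, hL.D_L_pow]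
      abel
    -- The representative is `p + L z`; it differs from `x` by `D (θ + L φ)`.
    refine ⟨x - L (z + D φ) - D θ + L z, Submodule.add_mem _ hp (hL' _ hz), ?_,
      ⟨θ + L φ, Submodule.add_mem _ ?_ ?_, ?_⟩, fun j hj => ?_⟩
    · rw [map_add, hDp, hL.D_L, hDz, map_zero, zero_add]
    · convert hθ using 2
      push_cast
      ring
    · convert hL.L_mem _ _ hφ using 2
      push_cast
      ring
    · simp only [map_add, hL.D_L]
      abel
    · obtain ⟨c, -, h⟩ := hS.primitive s j hj
      obtain ⟨w, hw, hDw⟩ := hstar (j + 1) (by omega)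
      have h2 := hS.add _ _ _ _ (h _ hp hLp) hw
      rw [← L_pow_L, ← map_add] at h2
      refine ⟨_, h2, ?_⟩
      rw [map_add, map_smul, hL.D_L_pow, hDp, map_zero, smul_zero, hDw, zero_add]

/-- If `L ^ s` is surjective on cohomology for all `s ≤ n`, every class has a harmonic
representative. -/
theorem exists_harmonic {m : ℤ} {x : A} (hx : x ∈ 𝒜 m) (hD : D x = 0) :
    ∃ z ∈ 𝒜 m, D z = 0 ∧ (∃ θ ∈ 𝒜 (m - 1), x = z + D θ) ∧ ∃ w, S z w ∧ D w = 0 := by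
  rcases le_total m n with hm | hm
  · obtain ⟨s, hs⟩ := Int.eq_ofNat_of_zero_le (sub_nonneg.2 hm)
    obtain rfl : m = n - s := by omega
    obtain ⟨z, hz, hDz, h, hstar⟩ := hL.exists_harmonic_L_pow hS hsurj hx hD
    exact ⟨z, hz, hDz, h, hstar 0 (Nat.zero_le _)⟩
  · obtain ⟨s, hs⟩ := Int.eq_ofNat_of_zero_le (sub_nonneg.2 hm)
    obtain rfl : m = n + s := by omega
    obtain ⟨y, hy, hDy, η, hη, rfl⟩ := hL.exists_closed_add_exact hsurj s hx hD
    obtain ⟨z, hz, hDz, ⟨φ, hφ, rfl⟩, hstar⟩ := hL.exists_harmonic_L_pow hS hsurj hy hDy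
    refine ⟨(L ^ s) z, hL.L_pow_mem s (by ring) hz, by rw [hL.D_L_pow, hDz, map_zero],
      ⟨(L ^ s) φ + η, Submodule.add_mem _ (hL.L_pow_mem s (by ring) hφ) hη, ?_⟩, hstar s le_rfl⟩
    rw [map_add, map_add, hL.D_L_pow]
    abel

end Surjective

end IsLefschetzModule

end LefschetzModule

/-! ### The exterior derivative in arbitrary preferred charts -/

section Charts

variable {E : Type*} [NormedAddCommGroup E] [NormedSpace ℝ E]
  {M : Type*} [TopologicalSpace M] [ChartedSpace E M] [IsManifold 𝓘(ℝ, E) ∞ M]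

theorem two_le_infty : minSmoothness ℝ 2 ≤ (∞ : WithTop ℕ∞) := by
  rw [minSmoothness_of_isRCLikeNormedField]
  exact WithTop.coe_le_coe.2 (le_top : (2 : ℕ∞) ≤ ⊤)

theorem mdifferentiable_chartAt (x : M) : (chartAt E x).MDifferentiable 𝓘(ℝ, E) 𝓘(ℝ, E) :=
  have : IsManifold 𝓘(ℝ, E) 1 M := IsManifold.of_le (n := ∞) (by simp)
  mdifferentiable_chart x

theorem inChart_comp_derivAt {k : ℕ} (ξ : DiffForm E M k) (x₀ : M) {x : M}
    (hx : x ∈ (chartAt E x₀).source) :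
    (inChart x₀ ξ (chartAt E x₀ x)).compContinuousLinearMap (derivAt (chartAt E x₀) x) = ξ x :=
  comp_eq_of_eq_id ξ ((chartAt E x₀).left_inv hx) ((mdifferentiable_chartAt x₀).symm_comp_deriv hx)

theorem derivAt_comp_derivSymmAt (x₀ : M) {u : E} (hu : u ∈ (chartAt E x₀).target) :
    (derivAt (chartAt E x₀) ((chartAt E x₀).symm u)).comp (derivSymmAt (chartAt E x₀) u) =
      ContinuousLinearMap.id ℝ E :=
  (mdifferentiable_chartAt x₀).comp_symm_deriv hu

theorem derivSymmAt_comp_derivAt (x₀ : M) {u : E} (hu : u ∈ (chartAt E x₀).target) :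
    (derivSymmAt (chartAt E x₀) u).comp (derivAt (chartAt E x₀) ((chartAt E x₀).symm u)) =
      ContinuousLinearMap.id ℝ E := by
  have h := (mdifferentiable_chartAt x₀).symm_comp_deriv ((chartAt E x₀).map_target hu)
  have h2 : derivSymmAt (chartAt E x₀) u =
      derivSymmAt (chartAt E x₀) (chartAt E x₀ ((chartAt E x₀).symm u)) := by
    rw [(chartAt E x₀).right_inv hu]
  rw [h2]
  exact h

theorem fderiv_transition (x₀ y : M) {u : E} (hu : u ∈ (chartAt E x₀).target)
    (hy : (chartAt E x₀).symm u ∈ (chartAt E y).source) :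
    fderiv ℝ (chartAt E y ∘ (chartAt E x₀).symm) u =
      (derivAt (chartAt E y) ((chartAt E x₀).symm u)).comp (derivSymmAt (chartAt E x₀) u) := by
  rw [← mfderiv_eq_fderiv]
  exact mfderiv_comp u ((mdifferentiable_chartAt y).mdifferentiableAt hy)
    ((mdifferentiable_chartAt x₀).mdifferentiableAt_symm hu)

theorem contDiffAt_transition (x₀ y : M) {u : E} (hu : u ∈ (chartAt E x₀).target)
    (hy : (chartAt E x₀).symm u ∈ (chartAt E y).source) :
    ContDiffAt ℝ ∞ (chartAt E y ∘ (chartAt E x₀).symm) u := by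
  rw [← contMDiffAt_iff_contDiffAt]
  exact ContMDiffAt.comp u (contMDiffOn_chart.contMDiffAt
    ((chartAt E y).open_source.mem_nhds hy)) (contMDiffOn_chart_symm.contMDiffAt
    ((chartAt E x₀).open_target.mem_nhds hu))

theorem inChart_eq_pullback {k : ℕ} (ξ : DiffForm E M k) (x₀ y : M) {u : E}
    (hu : u ∈ (chartAt E x₀).target) (hy : (chartAt E x₀).symm u ∈ (chartAt E y).source) :
    inChart x₀ ξ u = (inChart y ξ ((chartAt E y ∘ (chartAt E x₀).symm) u)).compContinuousLinearMap
      (fderiv ℝ (chartAt E y ∘ (chartAt E x₀).symm) u) := by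
  rw [fderiv_transition x₀ y hu hy, inChart, ← inChart_comp_derivAt ξ y hy]
  rfl

/-- The exterior derivative may be computed in any preferred chart. -/
theorem inChart_extD {k : ℕ} {ξ : DiffForm E M k} (hξ : IsSmooth ξ) (x₀ : M) {u : E}
    (hu : u ∈ (chartAt E x₀).target) : inChart x₀ (extD ξ) u = extDeriv (inChart x₀ ξ) u := by
  set y := (chartAt E x₀).symm u with hy
  have hys : y ∈ (chartAt E y).source := mem_chart_source E y
  -- `extD ξ` at `y` is computed in the chart at `y`. Near `u`, the expression of `ξ` in the chart
  -- at `x₀` is the pullback of its expression there under the transition map, and `extDeriv` is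
  -- natural under pullback.
  have h1 : inChart x₀ ξ =ᶠ[nhds u] fun u =>
      (inChart y ξ ((chartAt E y ∘ (chartAt E x₀).symm) u)).compContinuousLinearMap
        (fderiv ℝ (chartAt E y ∘ (chartAt E x₀).symm) u) := by
    have h2 : ∀ᶠ u' in nhds u, u' ∈ (chartAt E x₀).target :=
      (chartAt E x₀).open_target.mem_nhds hu
    have h3 : ∀ᶠ u' in nhds u, (chartAt E x₀).symm u' ∈ (chartAt E y).source :=
      ((chartAt E x₀).continuousAt_symm hu).preimage_mem_nhds
        ((chartAt E y).open_source.mem_nhds hys)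
    filter_upwards [h2, h3] with u' hu' hy'
    exact inChart_eq_pullback ξ x₀ y hu' hy'
  have h2 := extDeriv_pullback (f := chartAt E y ∘ (chartAt E x₀).symm) (x := u)
    (hξ.differentiableAt y) (contDiffAt_transition x₀ y hu hys) two_le_infty
  rw [h1.extDeriv_eq, h2, fderiv_transition x₀ y hu hys]
  rfl

theorem IsSmooth.extD [FiniteDimensional ℝ E] {k : ℕ} {ξ : DiffForm E M k} (hξ : IsSmooth ξ) :
    IsSmooth (extD ξ) := fun x₀ => by
  have h1 : ContDiffOn ℝ ∞ (fderiv ℝ (inChart x₀ ξ)) (chartAt E x₀).target :=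
    (hξ x₀).fderiv_of_isOpen (chartAt E x₀).open_target (by simp)
  refine ((ContinuousAlternatingMap.alternatizeUncurryFinCLM
    (n := k) ℝ E ℝ).contDiff.comp_contDiffOn h1).congr fun u hu => ?_
  rw [inChart_extD hξ x₀ hu, Function.comp_apply,
    ContinuousAlternatingMap.alternatizeUncurryFinCLM_apply, extDeriv]

theorem extD_extD {k : ℕ} {ξ : DiffForm E M k} (hξ : IsSmooth ξ) : extD (extD ξ) = 0 := by
  funext x
  have hx := mem_chart_target E x
  have h1 : inChart x (extD ξ) =ᶠ[nhds (chartAt E x x)] extDeriv (inChart x ξ) := by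
    filter_upwards [(chartAt E x).open_target.mem_nhds hx] with u hu
    exact inChart_extD hξ x hu
  change ContinuousAlternatingMap.compContinuousLinearMap _ _ = _
  rw [h1.extDeriv_eq, extDeriv_extDeriv_apply (r := ∞)
    ((hξ x).contDiffAt ((chartAt E x).open_target.mem_nhds hx)) two_le_infty]
  rfl

theorem extD_mem_basicForms [FiniteDimensional ℝ E] {p : ℕ} {F : Foliation E M p} {k : ℕ}
    {ξ : DiffForm E M k} (hξ : ξ ∈ basicForms F k) : extD ξ ∈ basicForms F (k + 1) := by
  have h := (isBasic_iff ξ).1 hξ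
  refine (isBasic_iff _).2 ⟨h.1.extD, fun T hT => ⟨?_, ?_⟩⟩
  · exact (interior_eq_zero_iff T (extD ξ)).1 (h.2 T hT).2
  · rw [extD_extD h.1]
    rfl

end Charts

/-! ### Tangent fields, horizontality of basic forms, transverse frames -/

section TransverseStructure

variable {E : Type*} [NormedAddCommGroup E] [NormedSpace ℝ E] [FiniteDimensional ℝ E]
  {M : Type*} [TopologicalSpace M] [ChartedSpace E M] [IsManifold 𝓘(ℝ, E) ∞ M]
  {p : ℕ} {F : Foliation E M p}

omit [FiniteDimensional ℝ E] in
theorem mdifferentiable_of_mem_maximalAtlas {φ : OpenPartialHomeomorph M E}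
    (hφ : φ ∈ IsManifold.maximalAtlas 𝓘(ℝ, E) ∞ M) : φ.MDifferentiable 𝓘(ℝ, E) 𝓘(ℝ, E) :=
  ⟨(contMDiffOn_of_mem_maximalAtlas hφ).mdifferentiableOn (by simp),
    (contMDiffOn_symm_of_mem_maximalAtlas hφ).mdifferentiableOn (by simp)⟩

omit [FiniteDimensional ℝ E] in
theorem Foliation.finrank_tangent (F : Foliation E M p) (x : M) :
    finrank ℝ (F.tangent x) = p := by
  obtain ⟨φ, hφ, hx, K, hK, h⟩ := F.exists_flat_chart x
  have hbij := (mdifferentiable_of_mem_maximalAtlas hφ).mfderiv_bijective hx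
  let e : E ≃ₗ[ℝ] E := LinearEquiv.ofBijective (derivAt φ x).toLinearMap hbij
  have h1 : (F.tangent x : Submodule ℝ E) = K.comap (e : E →ₗ[ℝ] E) := by
    ext v
    exact h x hx v
  have h2 := Submodule.comap_equiv_eq_map_symm e K
  refine Eq.trans ?_ hK
  rw [h1, h2]
  exact LinearEquiv.finrank_map_eq e.symm K

/-- Every vector tangent to a leaf extends to a smooth vector field tangent to the foliation. -/
theorem Foliation.exists_isTangent [T2Space M] (F : Foliation E M p) {x : M}
    {v : TangentSpace 𝓘(ℝ, E) x} (hv : v ∈ F.tangent x) :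
    ∃ T : VField E M, F.IsTangent T ∧ T x = v := by
  obtain ⟨φ, hφ, hx, K, hK, h⟩ := F.exists_flat_chart x
  have : IsManifold 𝓘(ℝ, E) 1 M := IsManifold.of_le (n := ∞) (by simp)
  have hd := mdifferentiable_of_mem_maximalAtlas hφ
  -- The constant field with value `dφ_x v ∈ K`. Its pullback is tangent to the leaves throughout
  -- the flat chart, and a bump function extends it to `M`.
  let W : (u : E) → TangentSpace 𝓘(ℝ, E) u := fun _ => derivAt φ x v
  let V : VField E M := VectorField.mpullback 𝓘(ℝ, E) 𝓘(ℝ, E) φ W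
  have hinv : ∀ y ∈ φ.source, (mfderiv 𝓘(ℝ, E) 𝓘(ℝ, E) φ y).IsInvertible := fun y hy =>
    ⟨hd.mfderiv hy, rfl⟩
  have hV : ∀ y ∈ φ.source, derivAt φ y (V y) = derivAt φ x v := fun y hy =>
    (hinv y hy).self_apply_inverse _
  have hVs : ContMDiffOn 𝓘(ℝ, E) 𝓘(ℝ, E).tangent ∞
      (fun y => (⟨y, V y⟩ : TangentBundle 𝓘(ℝ, E) M)) φ.source := fun y hy => by
    refine ContMDiffAt.contMDiffWithinAt ?_
    refine ContMDiffAt.mpullback_vectorField_preimage (n := ∞) ?_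
      ((contMDiffOn_of_mem_maximalAtlas hφ).contMDiffAt (φ.open_source.mem_nhds hy)) (hinv y hy)
      (by simp)
    exact contMDiffAt_vectorSpace_iff_contDiffAt.2 contDiffAt_const
  obtain ⟨f, -, hf⟩ := (SmoothBumpFunction.nhds_basis_tsupport (I := 𝓘(ℝ, E)) x).mem_iff.1
    (φ.open_source.mem_nhds hx)
  refine ⟨(f : M → ℝ) • V, ⟨?_, fun y => ?_⟩, ?_⟩
  · exact ContMDiffOn.smul_section_of_tsupport f.contMDiff.contMDiffOn φ.open_source hf hVs
  · by_cases hy : y ∈ φ.source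
    · refine Submodule.smul_mem _ _ ((h y hy _).2 ?_)
      rw [hV y hy]
      exact (h x hx v).1 hv
    · have : f y = 0 := image_eq_zero_of_notMem_tsupport fun hy' => hy (hf hy')
      change f y • V y ∈ _
      rw [this, zero_smul]
      exact Submodule.zero_mem _
  · change f x • V x = v
    rw [f.eq_one, one_smul]
    exact hd.mfderiv_injective hx (hV x hx)

/-- Basic forms are defined by means of global tangent fields; extending a single tangent vector to
such a field makes the condition pointwise. -/
theorem apply_eq_zero_of_mem_tangent [T2Space M] {k : ℕ} {ξ : DiffForm E M k}
    (hξ : ξ ∈ basicForms F k) {x : M} {t : E} (ht : t ∈ F.tangent x) (w : Fin k → E) (i : Fin k)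
    (hi : w i = t) : ξ x w = 0 := by
  obtain ⟨T, hT, rfl⟩ := F.exists_isTangent ht
  exact (((isBasic_iff ξ).1 hξ).2 T hT).1 x w i hi

variable [T2Space M] {Ω : DiffForm E M 2} (hΩ : IsTransverselySymplectic F Ω)

include hΩ

theorem IsTransverselySymplectic.mem_tangent_iff {x : M} {t : E} :
    t ∈ F.tangent x ↔ flatC (Ω x) t = 0 := by
  constructor
  · intro ht
    ext w
    exact apply_eq_zero_of_mem_tangent hΩ.basic ht ![t, w] 0 rfl
  · intro h
    exact hΩ.nondegenerate x t fun w => DFunLike.congr_fun h w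

theorem IsTransverselySymplectic.finrank_ker (x : M) :
    finrank ℝ (LinearMap.ker (flat (Ω x))) = p := by
  have h : LinearMap.ker (flat (Ω x)) = (F.tangent x : Submodule ℝ E) := by
    ext t
    rw [LinearMap.mem_ker]
    refine Iff.trans ?_ hΩ.mem_tangent_iff.symm
    constructor
    · intro h
      ext w
      exact DFunLike.congr_fun h w
    · intro h
      ext w
      exact DFunLike.congr_fun h w
  rw [h]
  exact F.finrank_tangent x

theorem IsTransverselySymplectic.single_mem_horForms {k : ℕ} {ξ : DiffForm E M k}
    (hξ : ξ ∈ basicForms F k) (x : M) : Forms.single k (ξ x) ∈ horForms (Ω x) k := by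
  refine ⟨single_mem_degForms k _, fun t ht => ?_⟩
  ext l w
  rw [ins_apply]
  by_cases hl : l + 1 = k
  · subst hl
    rw [Forms.single_same]
    exact apply_eq_zero_of_mem_tangent hξ (hΩ.mem_tangent_iff.2 ht) (Matrix.vecCons t w) 0 rfl
  · rw [Forms.single_of_ne hl, ContinuousAlternatingMap.curryLeft_zero]
    rfl

theorem IsTransverselySymplectic.exists_isFrame {n : ℕ} (hdim : finrank ℝ E = p + 2 * n) (x : M) :
    ∃ b v : Fin (2 * n) → E, IsFrame (Ω x) b v := by
  obtain ⟨b, hb⟩ := exists_det_ne_zero hdim (hΩ.finrank_ker x)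
  exact ⟨b, _, isFrame_dualVectors hdim (hΩ.finrank_ker x) b hb⟩

end TransverseStructure

/-! ### Pullback to charts and smooth dependence of the inverse on the point -/

section Families

open ContinuousAlternatingMap (curryLeft)

variable {E : Type*} [NormedAddCommGroup E] [NormedSpace ℝ E]

/-- The pullback of forms of all degrees under a linear map. -/
def Forms.comap (A : E →L[ℝ] E) : Forms E →ₗ[ℝ] Forms E where
  toFun f k := (f k).compContinuousLinearMap A
  map_add' _ _ := rfl
  map_smul' _ _ := rfl

theorem Forms.comap_apply (A : E →L[ℝ] E) (f : Forms E) (k : ℕ) :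
    Forms.comap A f k = (f k).compContinuousLinearMap A := rfl

theorem Forms.comap_single (A : E →L[ℝ] E) {k : ℕ} (ξ : E [⋀^Fin k]→L[ℝ] ℝ) :
    Forms.comap A (Forms.single k ξ) = Forms.single k (ξ.compContinuousLinearMap A) := by
  ext1 l
  rw [Forms.comap_apply]
  by_cases hl : l = k
  · subst hl
    rw [Forms.single_same, Forms.single_same]
  · rw [Forms.single_of_ne hl, Forms.single_of_ne hl]
    rfl

theorem ins_comap (A : E →L[ℝ] E) (t : E) (f : Forms E) :
    ins t (Forms.comap A f) = Forms.comap A (ins (A t) f) := by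
  ext k w
  change f (k + 1) (A ∘ Matrix.vecCons t w) = f (k + 1) (Matrix.vecCons (A t) (A ∘ w))
  congr 1
  funext i
  cases i using Fin.cases <;> rfl

variable [FiniteDimensional ℝ E]

theorem comap_lef (A : E →L[ℝ] E) (Ω : E [⋀^Fin 2]→L[ℝ] ℝ) (f : Forms E) :
    Forms.comap A (lef Ω f) = lef (Ω.compContinuousLinearMap A) (Forms.comap A f) := by
  ext1 k
  rw [Forms.comap_apply]
  by_cases hk : 2 ≤ k
  · obtain ⟨j, rfl⟩ := Nat.exists_eq_add_of_le hk
    rw [lef, lef, wedgeOp_apply rfl, wedgeOp_apply rfl, wedge_comp]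
    rfl
  · rw [lef, lef, wedgeOp_of_lt (by omega), wedgeOp_of_lt (by omega)]
    rfl

theorem comap_lef_pow (A : E →L[ℝ] E) (Ω : E [⋀^Fin 2]→L[ℝ] ℝ) (k : ℕ) (f : Forms E) :
    Forms.comap A ((lef Ω ^ k) f) =
      (lef (Ω.compContinuousLinearMap A) ^ k) (Forms.comap A f) := by
  induction k with
  | zero => rfl
  | succ k ih => rw [lef_pow_succ, lef_pow_succ, comap_lef, ih]

theorem flatC_comp_eq_zero_iff {A B : E →L[ℝ] E} (hAB : A.comp B = ContinuousLinearMap.id ℝ E)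
    (Ω : E [⋀^Fin 2]→L[ℝ] ℝ) (t : E) :
    flatC (Ω.compContinuousLinearMap A) t = 0 ↔ flatC Ω (A t) = 0 := by
  have h : ∀ w, flatC (Ω.compContinuousLinearMap A) t w = flatC Ω (A t) (A w) := fun w => by
    rw [flatC_apply, flatC_apply]
    change Ω (A ∘ ![t, w]) = _
    congr 1
    ext i
    fin_cases i <;> rfl
  constructor
  · intro ht
    ext w
    have h1 := h (B w)
    rw [ht, show A (B w) = w from DFunLike.congr_fun hAB w] at h1
    exact h1.symm
  · intro ht
    ext w
    rw [h, ht]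
    rfl

theorem comap_mem_horForms {A B : E →L[ℝ] E} (hAB : A.comp B = ContinuousLinearMap.id ℝ E)
    {Ω : E [⋀^Fin 2]→L[ℝ] ℝ} {m : ℤ} {f : Forms E} (hf : f ∈ horForms Ω m) :
    Forms.comap A f ∈ horForms (Ω.compContinuousLinearMap A) m := by
  refine ⟨fun k hk => ?_, fun t ht => ?_⟩
  · rw [Forms.comap_apply, hf.1 k hk]
    rfl
  · rw [ins_comap, hf.2 _ ((flatC_comp_eq_zero_iff hAB Ω t).1 ht), map_zero]

theorem mem_ker_flat {Ω : E [⋀^Fin 2]→L[ℝ] ℝ} {t : E} :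
    t ∈ LinearMap.ker (flat Ω) ↔ flatC Ω t = 0 := by
  rw [LinearMap.mem_ker]
  constructor
  · intro h
    ext w
    exact DFunLike.congr_fun h w
  · intro h
    ext w
    exact DFunLike.congr_fun h w

theorem finrank_ker_comp {A B : E →L[ℝ] E} (hAB : A.comp B = ContinuousLinearMap.id ℝ E)
    (hBA : B.comp A = ContinuousLinearMap.id ℝ E) (Ω : E [⋀^Fin 2]→L[ℝ] ℝ) :
    finrank ℝ (LinearMap.ker (flat (Ω.compContinuousLinearMap A))) =
      finrank ℝ (LinearMap.ker (flat Ω)) := by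
  let e : E ≃L[ℝ] E := ContinuousLinearEquiv.equivOfInverse A B
    (fun w => DFunLike.congr_fun hBA w) (fun w => DFunLike.congr_fun hAB w)
  have h : LinearMap.ker (flat (Ω.compContinuousLinearMap A)) =
      (LinearMap.ker (flat Ω)).comap (e.toLinearEquiv : E →ₗ[ℝ] E) := by
    ext t
    rw [Submodule.mem_comap, mem_ker_flat, mem_ker_flat]
    exact flatC_comp_eq_zero_iff hAB Ω t
  rw [h, Submodule.comap_equiv_eq_map_symm]
  exact LinearEquiv.finrank_map_eq _ _

omit [FiniteDimensional ℝ E] in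
/-- Smoothness at a point, in each degree, of a family of forms. -/
def Forms.SmoothAt (f : E → Forms E) (u₀ : E) : Prop :=
  ∀ k, ContDiffAt ℝ ∞ (fun u => f u k) u₀

variable {u₀ : E}

theorem Forms.SmoothAt.single {k : ℕ} {ξ : E → E [⋀^Fin k]→L[ℝ] ℝ}
    (hξ : ContDiffAt ℝ ∞ ξ u₀) : Forms.SmoothAt (fun u => Forms.single k (ξ u)) u₀ := by
  intro l
  by_cases hl : l = k
  · subst hl
    simpa only [Forms.single_same] using hξ
  · simpa only [Forms.single_of_ne hl] using contDiffAt_const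

theorem Forms.SmoothAt.add {f g : E → Forms E} (hf : Forms.SmoothAt f u₀)
    (hg : Forms.SmoothAt g u₀) : Forms.SmoothAt (fun u => f u + g u) u₀ :=
  fun k => (hf k).add (hg k)

theorem Forms.SmoothAt.smul {r : E → ℝ} (hr : ContDiffAt ℝ ∞ r u₀) {f : E → Forms E}
    (hf : Forms.SmoothAt f u₀) : Forms.SmoothAt (fun u => r u • f u) u₀ :=
  fun k => hr.smul (hf k)

theorem Forms.SmoothAt.sum {ι : Type*} (s : Finset ι) {f : ι → E → Forms E}
    (hf : ∀ i, Forms.SmoothAt (f i) u₀) : Forms.SmoothAt (fun u => ∑ i ∈ s, f i u) u₀ :=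
  fun k => by
    simp only [Forms.sum_apply]
    exact _root_.ContDiffAt.sum fun i _ => hf i k

theorem contDiffAt_clm_of_bilinear {U V W : Type*} [NormedAddCommGroup U] [NormedSpace ℝ U]
    [FiniteDimensional ℝ U] [NormedAddCommGroup V] [NormedSpace ℝ V] [FiniteDimensional ℝ V]
    [NormedAddCommGroup W] [NormedSpace ℝ W] (B : U →ₗ[ℝ] V →ₗ[ℝ] W) {x : E → U} {y : E → V}
    (hx : ContDiffAt ℝ ∞ x u₀) (hy : ContDiffAt ℝ ∞ y u₀) :
    ContDiffAt ℝ ∞ (fun u => B (x u) (y u)) u₀ := by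
  have h1 : ContDiffAt ℝ ∞ (fun u => B.toContinuousBilinearMap (x u)) u₀ :=
    B.toContinuousBilinearMap.contDiff.contDiffAt.comp u₀ hx
  exact h1.clm_apply hy

theorem Forms.SmoothAt.interior {v : E → E} (hv : ContDiffAt ℝ ∞ v u₀) {f : E → Forms E}
    (hf : Forms.SmoothAt f u₀) : Forms.SmoothAt (fun u => ins (v u) (f u)) u₀ := fun k =>
  contDiffAt_clm_of_bilinear (LinearMap.mk₂ ℝ
    (fun (ξ : E [⋀^Fin (k + 1)]→L[ℝ] ℝ) v => curryLeft ξ v) (fun _ _ _ => rfl) (fun _ _ _ => rfl)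
    (fun ξ v w => map_add (curryLeft ξ) v w) (fun r ξ v => map_smul (curryLeft ξ) r v))
    (hf (k + 1)) hv

theorem Forms.SmoothAt.exterior {θ : E → E →L[ℝ] ℝ} (hθ : ContDiffAt ℝ ∞ θ u₀)
    {f : E → Forms E} (hf : Forms.SmoothAt f u₀) :
    Forms.SmoothAt (fun u => ext1 (θ u) (f u)) u₀ := fun k => by
  cases k with
  | zero => exact contDiffAt_const
  | succ k => exact contDiffAt_clm_of_bilinear oneWedge hθ (hf k)

theorem contDiffAt_flatC {Ω : E → E [⋀^Fin 2]→L[ℝ] ℝ} (hΩ : ContDiffAt ℝ ∞ Ω u₀) {v : E → E}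
    (hv : ContDiffAt ℝ ∞ v u₀) : ContDiffAt ℝ ∞ (fun u => flatC (Ω u) (v u)) u₀ :=
  contDiffAt_clm_of_bilinear (LinearMap.mk₂ ℝ (fun (Ω : E [⋀^Fin 2]→L[ℝ] ℝ) v => flatC Ω v)
    (fun _ _ _ => rfl) (fun _ _ _ => rfl) (fun Ω v w => flatC_add Ω v w)
    (fun r Ω v => flatC_smul Ω r v)) hΩ hv

theorem Forms.SmoothAt.lefschetz {Ω : E → E [⋀^Fin 2]→L[ℝ] ℝ} (hΩ : ContDiffAt ℝ ∞ Ω u₀)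
    {f : E → Forms E} (hf : Forms.SmoothAt f u₀) :
    Forms.SmoothAt (fun u => lef (Ω u) (f u)) u₀ := fun k => by
  by_cases hk : 2 ≤ k
  · obtain ⟨j, rfl⟩ := Nat.exists_eq_add_of_le hk
    have h1 : ContDiffAt ℝ ∞ (fun u => wedgeL (show 2 + j = 2 + j from rfl) (Ω u)) u₀ := by
      fun_prop
    refine (h1.clm_apply (hf j)).congr_of_eventuallyEq (Filter.Eventually.of_forall fun u => ?_)
    exact wedgeOp_apply rfl _ _
  · simp only [lef, wedgeOp_of_lt (not_le.1 hk)]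
    exact contDiffAt_const

theorem Forms.SmoothAt.lefschetz_pow {Ω : E → E [⋀^Fin 2]→L[ℝ] ℝ} (hΩ : ContDiffAt ℝ ∞ Ω u₀)
    {f : E → Forms E} (hf : Forms.SmoothAt f u₀) (k : ℕ) :
    Forms.SmoothAt (fun u => (lef (Ω u) ^ k) (f u)) u₀ := by
  induction k with
  | zero => exact hf
  | succ k ih =>
    simp only [lef_pow_succ]
    exact ih.lefschetz hΩ

theorem Forms.SmoothAt.apply_const {f : E → Forms E} (hf : Forms.SmoothAt f u₀) (k : ℕ)
    (b : Fin k → E) : ContDiffAt ℝ ∞ (fun u => f u k b) u₀ := by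
  let ev : (E [⋀^Fin k]→L[ℝ] ℝ) →ₗ[ℝ] ℝ :=
    { toFun := fun ξ => ξ b
      map_add' := fun _ _ => rfl
      map_smul' := fun _ _ => rfl }
  exact (LinearMap.toContinuousLinearMap ev).contDiff.contDiffAt.comp u₀ (hf k)

omit [FiniteDimensional ℝ E] in
theorem contDiffAt_det {N : ℕ} {A : E → Matrix (Fin N) (Fin N) ℝ}
    (hA : ∀ i j, ContDiffAt ℝ ∞ (fun u => A u i j) u₀) :
    ContDiffAt ℝ ∞ (fun u => (A u).det) u₀ := by
  simp only [Matrix.det_apply']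
  exact ContDiffAt.sum fun σ _ => contDiffAt_const.mul (contDiffAt_prod fun i _ => hA _ _)

omit [FiniteDimensional ℝ E] in
-- Cramer's rule: the entries are quotients of determinants.
theorem contDiffAt_matrix_inv {N : ℕ} {A : E → Matrix (Fin N) (Fin N) ℝ}
    (hA : ∀ i j, ContDiffAt ℝ ∞ (fun u => A u i j) u₀) (h : (A u₀).det ≠ 0) (i j : Fin N) :
    ContDiffAt ℝ ∞ (fun u => (A u)⁻¹ i j) u₀ := by
  simp only [Matrix.inv_def, Matrix.smul_apply, Ring.inverse_eq_inv', smul_eq_mul,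
    Matrix.adjugate_apply]
  refine ((contDiffAt_det hA).inv h).mul (contDiffAt_det fun k l => ?_)
  by_cases hk : k = j
  · subst hk
    simpa using contDiffAt_const
  · simpa [Matrix.updateRow_ne hk] using hA k l

theorem contDiffAt_dualVectors {N : ℕ} {b : Fin N → E} {Ω : E → E [⋀^Fin 2]→L[ℝ] ℝ}
    (hΩ : ContDiffAt ℝ ∞ Ω u₀)
    (h : (Matrix.of fun i j => flatC (Ω u₀) (b i) (b j)).det ≠ 0) (i : Fin N) :
    ContDiffAt ℝ ∞ (fun u => dualVectors (Ω u) b i) u₀ := by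
  have h1 : ∀ i j, ContDiffAt ℝ ∞ (fun u => flatC (Ω u) (b i) (b j)) u₀ := fun i j =>
    (contDiffAt_flatC hΩ contDiffAt_const).clm_apply contDiffAt_const
  exact ContDiffAt.sum fun j _ => (contDiffAt_matrix_inv (u₀ := u₀)
    (A := fun u => Matrix.of fun i j => flatC (Ω u) (b i) (b j)) h1 h i j).smul contDiffAt_const

/-- The recursion of `lefInv` uses only operations that preserve smoothness and one division by
`(L^n 1) (b)`, which is nonzero at `u₀` because `b` belongs to a frame there. This is the purpose of
an explicit inverse. -/
theorem Forms.SmoothAt.lefschetzInv {n : ℕ} {b : Fin (2 * n) → E} {v : E → Fin (2 * n) → E}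
    (hv : ∀ i, ContDiffAt ℝ ∞ (fun u => v u i) u₀) {Ω : E → E [⋀^Fin 2]→L[ℝ] ℝ}
    (hΩ : ContDiffAt ℝ ∞ Ω u₀) (hF : IsFrame (Ω u₀) b (v u₀)) (t : ℕ) {f : E → Forms E}
    (hf : Forms.SmoothAt f u₀) :
    Forms.SmoothAt (fun u => lefInv (Ω u) n b (v u) t (f u)) u₀ := by
  have hone : Forms.SmoothAt (fun _ => oneForm E) u₀ := fun k => contDiffAt_const
  induction t generalizing f with
  | zero =>
    exact Forms.SmoothAt.smul ((hf.apply_const _ b).div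
      ((hone.lefschetz_pow hΩ n).apply_const _ b)
      (top_form_apply_ne_zero hF)) hone
  | succ t ih =>
    have h1 : ∀ i, Forms.SmoothAt
        (fun u => lefInv (Ω u) n b (v u) t (ext1 (flatC (Ω u) (v u i)) (f u))) u₀ :=
      fun i => ih (hf.exterior (contDiffAt_flatC hΩ (hv i)))
    exact Forms.SmoothAt.smul contDiffAt_const (Forms.SmoothAt.sum _ fun i =>
      (((h1 i).interior contDiffAt_const).lefschetz hΩ).add (Forms.SmoothAt.smul contDiffAt_const
        ((h1 i).exterior (contDiffAt_flatC hΩ contDiffAt_const))))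

end Families

/-! ### Hard Lefschetz surjectivity for basic forms -/

section Solve

variable {E : Type*} [NormedAddCommGroup E] [NormedSpace ℝ E] [FiniteDimensional ℝ E]
  {M : Type*} [TopologicalSpace M] [ChartedSpace E M] [IsManifold 𝓘(ℝ, E) ∞ M] [T2Space M]
  {p n : ℕ} (hdim : finrank ℝ E = p + 2 * n) {F : Foliation E M p} {Ω : DiffForm E M 2}
  (hΩ : IsTransverselySymplectic F Ω)

omit [IsManifold 𝓘(ℝ, E) ∞ M] [T2Space M] in
theorem single_powForm_wedgeForm {k a c : ℕ} (h : 2 * k + a = c) (ξ : DiffForm E M a) (x : M) :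
    Forms.single c (wedgeForm h (powForm Ω k) ξ x) = (lef (Ω x) ^ k) (Forms.single a (ξ x)) := by
  rw [← wedgeOp_wedgePow, wedgeOp_single h]
  rfl

omit [FiniteDimensional ℝ E] in
theorem apply_eq_zero_of_ins {k : ℕ} {ξ : E [⋀^Fin k]→L[ℝ] ℝ} {t : E}
    (h : ins t (Forms.single k ξ) = 0) (w : Fin k → E) (i : Fin k) (hi : w i = t) : ξ w = 0 := by
  cases k with
  | zero => exact i.elim0
  | succ k =>
    have h1 := congrFun h k
    rw [ins_apply, Forms.single_same] at h1
    have h2 := ξ.toAlternatingMap.map_insertNth i t (i.removeNth w)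
    rw [← hi, Fin.insertNth_self_removeNth] at h2
    have h3 : ξ (Matrix.vecCons (w i) (i.removeNth w)) = 0 := hi ▸ DFunLike.congr_fun h1 _
    refine h2.trans ?_
    rw [show ξ.toAlternatingMap (Matrix.vecCons (w i) (i.removeNth w)) = 0 from h3, smul_zero]

include hdim hΩ

/-- A pointwise solution of `Ω ^ k ∧ θ = ξ`, where `ξ` is basic, is smooth. -/
theorem isSmooth_of_lef_pow_eq {k : ℕ} (hk : k ≤ n) {ξ : DiffForm E M (n + k)}
    (hξ : ξ ∈ basicForms F (n + k)) {θ : DiffForm E M (n - k)}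
    (h : ∀ x, (lef (Ω x) ^ k) (Forms.single (n - k) (θ x)) = Forms.single (n + k) (ξ x)) :
    IsSmooth θ := by
  intro x₀ u₀ hu₀
  have hnhds := (chartAt E x₀).open_target.mem_nhds hu₀
  have hA : ∀ u ∈ (chartAt E x₀).target, (derivSymmAt (chartAt E x₀) u).comp
      (derivAt (chartAt E x₀) ((chartAt E x₀).symm u)) = ContinuousLinearMap.id ℝ E :=
    fun u hu => derivSymmAt_comp_derivAt x₀ hu
  have hker : ∀ u ∈ (chartAt E x₀).target,
      finrank ℝ (LinearMap.ker (flat (inChart x₀ Ω u))) = p := fun u hu =>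
    (finrank_ker_comp (hA u hu) (derivAt_comp_derivSymmAt x₀ hu) _).trans (hΩ.finrank_ker _)
  have hΩs : ContDiffAt ℝ ∞ (inChart x₀ Ω) u₀ := (hΩ.basic.smooth x₀).contDiffAt hnhds
  have hξs : ContDiffAt ℝ ∞ (inChart x₀ ξ) u₀ := (hξ.smooth x₀).contDiffAt hnhds
  -- `b` is chosen at `u₀` and kept constant nearby; only the dual vectors vary with the point.
  obtain ⟨b, hb⟩ := exists_det_ne_zero hdim (hker u₀ hu₀)
  have hdet : ∀ᶠ u in nhds u₀,
      (Matrix.of fun i j => flatC (inChart x₀ Ω u) (b i) (b j)).det ≠ 0 := by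
    have h1 : ContDiffAt ℝ ∞
        (fun u => (Matrix.of fun i j => flatC (inChart x₀ Ω u) (b i) (b j)).det) u₀ :=
      contDiffAt_det fun i j =>
        (contDiffAt_flatC hΩs contDiffAt_const).clm_apply contDiffAt_const
    exact h1.continuousAt.eventually_ne hb
  have hsol : inChart x₀ θ =ᶠ[nhds u₀] fun u =>
      lefInv (inChart x₀ Ω u) n b (dualVectors (inChart x₀ Ω u) b) (n - k)
        (Forms.single (n + k) (inChart x₀ ξ u)) (n - k) := by
    filter_upwards [hdet, hnhds] with u hdu hu
    have hF := isFrame_dualVectors hdim (hker u hu) b hdu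
    have hhor : Forms.single (n + k) (inChart x₀ ξ u) ∈ horForms (inChart x₀ Ω u)
        (2 * n - (n - k : ℕ) : ℤ) := by
      have h1 := comap_mem_horForms (hA u hu)
        (hΩ.single_mem_horForms hξ ((chartAt E x₀).symm u))
      rw [Forms.comap_single] at h1
      rw [show (2 * n - (n - k : ℕ) : ℤ) = (n + k : ℕ) by omega]
      exact h1
    have hspec := lefInv_spec hF (Nat.sub_le n k) hhor
    rw [Nat.sub_sub_self hk] at hspec
    have hθ : (lef (inChart x₀ Ω u) ^ k) (Forms.single (n - k) (inChart x₀ θ u)) =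
        Forms.single (n + k) (inChart x₀ ξ u) := by
      have h1 := congrArg (Forms.comap (derivSymmAt (chartAt E x₀) u))
        (h ((chartAt E x₀).symm u))
      rw [comap_lef_pow, Forms.comap_single, Forms.comap_single] at h1
      exact h1
    -- `θ` is not assumed horizontal, but `L^k` is injective on all forms of degree `n - k`, so `θ`
    -- must agree with the explicit solution.
    have h2 : Forms.single (n - k) (inChart x₀ θ u) - lefInv (inChart x₀ Ω u) n b
        (dualVectors (inChart x₀ Ω u) b) (n - k) (Forms.single (n + k) (inChart x₀ ξ u)) = 0 :=
      lef_pow_injective hF k (m := (n - k : ℕ)) (by omega)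
        (Submodule.sub_mem _ (single_mem_degForms _ _) hspec.1.1)
        (by rw [map_sub, hθ, hspec.2, sub_self])
    rw [← sub_eq_zero.1 h2, Forms.single_same]
  refine (ContDiffAt.congr_of_eventuallyEq ?_ hsol).contDiffWithinAt
  exact (Forms.SmoothAt.single hξs).lefschetzInv (fun i => contDiffAt_dualVectors hΩs hb i) hΩs
    (isFrame_dualVectors hdim (hker u₀ hu₀) b hb) (n - k) (n - k)

/-- Choose horizontal solutions pointwise; uniqueness makes them one smooth form `θ`. It is basic
since `Ω^k ∧ dθ = dξ` is horizontal and `L^k` is injective. -/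
theorem exists_wedgeForm_powForm_eq {k : ℕ} (hk : k ≤ n) (hd : 2 * k + (n - k) = n + k)
    {ξ : DiffForm E M (n + k)} (hξ : ξ ∈ basicForms F (n + k)) :
    ∃ θ ∈ basicForms F (n - k), wedgeForm hd (powForm Ω k) θ = ξ := by
  have hex : ∀ x, ∃ g ∈ horForms (Ω x) (n - k : ℤ),
      (lef (Ω x) ^ k) g = Forms.single (n + k) (ξ x) := fun x => by
    obtain ⟨b, v, hF⟩ := hΩ.exists_isFrame hdim x
    exact lef_pow_surjective hF k (by simpa using hΩ.single_mem_horForms hξ x)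
  choose g hg hgξ using hex
  let θ : DiffForm E M (n - k) := fun x => g x (n - k)
  have hgθ : ∀ x, g x = Forms.single (n - k) (θ x) := fun x => eq_single (by
    convert (hg x).1 using 2
    omega)
  have h : ∀ x, (lef (Ω x) ^ k) (Forms.single (n - k) (θ x)) = Forms.single (n + k) (ξ x) :=
    fun x => by rw [← hgθ, hgξ]
  have hθξ : wedgeForm hd (powForm Ω k) θ = ξ := by
    funext x
    have h1 := congrFun ((single_powForm_wedgeForm (Ω := Ω) hd θ x).trans (h x)) (n + k)
    rwa [Forms.single_same, Forms.single_same] at h1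
  have hsm := isSmooth_of_lef_pow_eq hdim hΩ hk hξ h
  have hpow := powForm_mem_closedBasicForms (F := F) ⟨hΩ.basic, hΩ.closed⟩ k
  have hd' : 2 * k + (n - k + 1) = n + k + 1 := by omega
  have hdθ : wedgeForm hd' (powForm Ω k) (extD θ) = extD ξ := by
    have h1 := extD_wedgeForm hd hpow.1.smooth hsm
    rw [hθξ, hpow.2, wedgeForm_zero_left, zero_add, pow_mul] at h1
    simpa using h1.symm
  refine ⟨θ, (isBasic_iff θ).2 ⟨hsm, fun T hT => ⟨fun x w i hi => ?_, ?_⟩⟩, hθξ⟩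
  · have ht := hΩ.mem_tangent_iff.1 (hT.mem x)
    have h1 := (hg x).2 _ ht
    rw [hgθ] at h1
    exact apply_eq_zero_of_ins h1 w i hi
  · funext x
    obtain ⟨b, v, hF⟩ := hΩ.exists_isFrame hdim x
    set t : E := T x with hTx
    have ht : flatC (Ω x) t = 0 := hΩ.mem_tangent_iff.1 (hT.mem x)
    have h1 := congrArg (ins t) (single_powForm_wedgeForm (Ω := Ω) hd' (extD θ) x)
    rw [hdθ, (hΩ.single_mem_horForms (extD_mem_basicForms hξ) x).2 _ ht] at h1
    -- As `t` lies in the kernel of `Ω`, `ι_t` commutes with `L^k`, so `L^k (ι_t dθ) = ι_t dξ = 0`.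
    -- Injectivity in degree `n - k` does not require `ι_t dθ` to be horizontal.
    have h2 : ins t (Forms.single (n - k + 1) (extD θ x)) = 0 := by
      refine lef_pow_injective hF k (m := (n - k : ℕ)) (by omega)
        (ins_mem_degForms (by push_cast; rfl) _ (single_mem_degForms _ _)) ?_
      cases k with
      | zero => exact h1.symm
      | succ k =>
        rw [ins_lef_pow, ht, ext1_zero_left, map_zero, smul_zero, add_zero] at h1
        exact h1.symm
    rw [ins_single] at h2
    have h3 := congrFun h2 (n - k)
    rw [Forms.single_same] at h3
    exact h3

end Solve

/-! ### The basic complex as a Lefschetz module with star -/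

section BasicComplex

variable {E : Type*} [NormedAddCommGroup E] [NormedSpace ℝ E] [FiniteDimensional ℝ E]
  {M : Type*} [TopologicalSpace M] [ChartedSpace E M] [IsManifold 𝓘(ℝ, E) ∞ M]
  {p n : ℕ} {F : Foliation E M p} {Ω : DiffForm E M 2}

variable (F) in
/-- The product over all degrees of the spaces of basic forms. -/
abbrev BasicComplex : Type _ := ∀ k : ℕ, basicForms F k

namespace BasicComplex

/-- The differential of the basic complex. -/
def d : BasicComplex F →ₗ[ℝ] BasicComplex F where
  toFun a
    | 0 => 0
    | k + 1 => ⟨extD (a k).1, extD_mem_basicForms (a k).2⟩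
  map_add' a b := by
    funext k
    cases k with
    | zero => exact (add_zero _).symm
    | succ k => exact Subtype.ext (extD_add (a k).2.smooth (b k).2.smooth)
  map_smul' r a := by
    funext k
    cases k with
    | zero => exact (smul_zero (A := basicForms F 0) r).symm
    | succ k => exact Subtype.ext (extD_smul r _)

/-- The operator `ξ ↦ Ω ∧ ξ` on basic forms. -/
def wedgeΩ (hΩ : IsTransverselySymplectic F Ω) : BasicComplex F →ₗ[ℝ] BasicComplex F where
  toFun a
    | 0 => 0
    | 1 => 0
    | k + 2 => ⟨wedgeForm (add_comm 2 k) Ω (a k).1,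
        wedgeForm_mem_basicForms _ ⟨hΩ.basic, hΩ.closed⟩ (a k).2⟩
  map_add' a b := by
    funext k
    match k with
    | 0 => exact (add_zero _).symm
    | 1 => exact (add_zero _).symm
    | k + 2 => exact Subtype.ext (funext fun x => wedge_add_right _ _ _ _)
  map_smul' r a := by
    funext k
    match k with
    | 0 => exact (smul_zero (A := basicForms F 0) r).symm
    | 1 => exact (smul_zero (A := basicForms F 1) r).symm
    | k + 2 => exact Subtype.ext (funext fun x => wedge_smul_right _ _ _ _)

variable (F) in
/-- The elements of degree `m`. -/
def deg (m : ℤ) : Submodule ℝ (BasicComplex F) where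
  carrier := {a | ∀ k : ℕ, (k : ℤ) ≠ m → a k = 0}
  zero_mem' _ _ := rfl
  add_mem' ha hb k hk := by rw [Pi.add_apply, ha k hk, hb k hk, add_zero]
  smul_mem' r a ha k hk := by rw [Pi.smul_apply, ha k hk, smul_zero]

/-- The value of a basic form at a point. -/
def ev (x : M) : BasicComplex F →ₗ[ℝ] Forms E where
  toFun a k := (a k).1 x
  map_add' _ _ := rfl
  map_smul' _ _ := rfl

/-- The inclusion of the basic forms of degree `k`. -/
def incl (k : ℕ) : basicForms F k →ₗ[ℝ] BasicComplex F :=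
  LinearMap.single ℝ (fun k => basicForms F k) k

theorem incl_same {k : ℕ} (ξ : basicForms F k) : incl k ξ k = ξ := Pi.single_eq_same _ _

theorem incl_of_ne {k l : ℕ} (h : l ≠ k) (ξ : basicForms F k) : incl k ξ l = 0 :=
  Pi.single_eq_of_ne h _

theorem incl_mem_deg {k : ℕ} (ξ : basicForms F k) : incl k ξ ∈ deg F k := fun l hl =>
  incl_of_ne (by exact_mod_cast hl) ξ

theorem eq_incl {k : ℕ} {a : BasicComplex F} (ha : a ∈ deg F k) : a = incl k (a k) := by
  funext l
  by_cases hl : l = k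
  · subst hl
    rw [incl_same]
  · rw [incl_of_ne hl, ha l (by exact_mod_cast hl)]

theorem ext_ev {a b : BasicComplex F} (h : ∀ x, ev x a = ev x b) : a = b :=
  funext fun k => Subtype.ext (funext fun x => congrFun (h x) k)

theorem ev_incl (x : M) {k : ℕ} (ξ : basicForms F k) :
    ev x (incl k ξ) = Forms.single k (ξ.1 x) := by
  ext1 l
  change (incl k ξ l).1 x = _
  by_cases hl : l = k
  · subst hl
    rw [incl_same, Forms.single_same]
  · rw [incl_of_ne hl, Forms.single_of_ne hl]
    rfl

theorem ev_wedgeΩ (hΩ : IsTransverselySymplectic F Ω) (x : M) (a : BasicComplex F) :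
    ev x (wedgeΩ hΩ a) = lef (Ω x) (ev x a) := by
  ext1 k
  match k with
  | 0 => exact (wedgeOp_of_lt (by omega) _ _).symm
  | 1 => exact (wedgeOp_of_lt (by omega) _ _).symm
  | k + 2 => exact (wedgeOp_apply (add_comm 2 k) (Ω x) (ev x a)).symm

theorem ev_wedgeΩ_pow (hΩ : IsTransverselySymplectic F Ω) (x : M) (k : ℕ) (a : BasicComplex F) :
    ev x ((wedgeΩ hΩ ^ k) a) = (lef (Ω x) ^ k) (ev x a) := by
  induction k with
  | zero => rfl
  | succ k ih => rw [pow_succ', Module.End.mul_apply, ev_wedgeΩ, ih, lef_pow_succ]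

theorem ev_mem_degForms (x : M) {m : ℤ} {a : BasicComplex F} (ha : a ∈ deg F m) :
    ev x a ∈ degForms E m := fun k hk => by
  change (a k).1 x = 0
  rw [ha k hk]
  rfl

theorem d_apply_succ (a : BasicComplex F) (k : ℕ) : (d a (k + 1)).1 = extD (a k).1 := rfl

theorem d_eq_zero_iff {k : ℕ} {a : BasicComplex F} (ha : a ∈ deg F k) :
    d a = 0 ↔ extD (a k).1 = 0 := by
  constructor
  · intro h
    rw [← d_apply_succ, h]
    rfl
  · intro h
    funext l
    cases l with
    | zero => rfl
    | succ l =>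
      refine Subtype.ext ?_
      rw [d_apply_succ]
      by_cases hl : l = k
      · subst hl
        exact h
      · rw [ha l (by exact_mod_cast hl)]
        exact extD_zero

/-- In degree `0` the primitive `θ` would have degree `-1`, in accordance with the convention that
only the zero form is exact there. -/
theorem isBasicExact_iff {k : ℕ} (ξ : basicForms F k) :
    IsBasicExact F ξ.1 ↔ ∃ θ ∈ deg F (k - 1), incl k ξ = d θ := by
  cases k with
  | zero =>
    constructor
    · intro h
      refine ⟨0, Submodule.zero_mem _, ?_⟩
      rw [show ξ = 0 from Subtype.ext h, map_zero, map_zero]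
    · rintro ⟨θ, -, h⟩
      have h1 := congrArg Subtype.val (congrFun h 0)
      rw [incl_same] at h1
      exact h1
  | succ k =>
    constructor
    · rintro ⟨η, hη, h⟩
      refine ⟨incl k ⟨η, hη⟩, by simpa using incl_mem_deg _, ?_⟩
      funext l
      cases l with
      | zero => exact incl_of_ne (by omega) ξ
      | succ l =>
        refine Subtype.ext ?_
        rw [d_apply_succ]
        by_cases hl : l = k
        · subst hl
          rw [incl_same, incl_same]
          exact h.symm
        · rw [incl_of_ne (by omega), incl_of_ne hl]
          exact extD_zero.symm
    · rintro ⟨θ, -, h⟩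
      refine ⟨(θ k).1, (θ k).2, ?_⟩
      rw [← d_apply_succ, ← h, incl_same]

variable [T2Space M] (hdim : finrank ℝ E = p + 2 * n) (hΩ : IsTransverselySymplectic F Ω)

include hΩ in
theorem ev_mem_horForms (x : M) {k : ℕ} {a : BasicComplex F} (ha : a ∈ deg F k) :
    ev x a ∈ horForms (Ω x) k := by
  rw [eq_incl ha, ev_incl]
  exact hΩ.single_mem_horForms (a k).2 x

include hdim hΩ in
theorem eq_zero_of_lt {k : ℕ} (hk : 2 * n < k) {a : BasicComplex F} (ha : a ∈ deg F k) : a = 0 :=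
  ext_ev fun x => by
    obtain ⟨b, v, hF⟩ := hΩ.exists_isFrame hdim x
    rw [hF.eq_zero_of_lt (by exact_mod_cast hk) (ev_mem_horForms hΩ x ha), map_zero]

include hdim in
-- Injectivity is checked at each point. Surjectivity needs the smooth basic solution of
-- `exists_wedgeForm_powForm_eq` for `k ≤ n`; beyond that the target degree exceeds `2 n` and is
-- zero.
theorem isLefschetzModule : IsLefschetzModule (wedgeΩ hΩ) d (deg F) n where
  eq_zero_of_neg m hm a ha := funext fun k => ha k (by omega)
  L_mem m a ha k hk := by
    match k with
    | 0 => rfl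
    | 1 => rfl
    | k + 2 =>
      refine Subtype.ext ?_
      change wedgeForm _ Ω (a k).1 = 0
      rw [ha k (by push_cast at hk; omega)]
      exact wedgeForm_zero_right _ _
  D_mem m a ha k hk := by
    cases k with
    | zero => rfl
    | succ k =>
      refine Subtype.ext ?_
      rw [d_apply_succ, ha k (by push_cast at hk; omega)]
      exact extD_zero
  D_D a := by
    funext k
    match k with
    | 0 => rfl
    | 1 => exact Subtype.ext extD_zero
    | k + 2 => exact Subtype.ext (extD_extD (a k).2.smooth)
  D_L a := by
    funext k
    match k with
    | 0 => rfl
    | 1 => exact Subtype.ext extD_zero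
    | 2 => exact Subtype.ext (extD_zero.trans (wedgeForm_zero_right _ _).symm)
    | k + 3 =>
      refine Subtype.ext ?_
      have h := extD_wedgeForm (add_comm 2 k) hΩ.basic.smooth (a k).2.smooth
      rw [hΩ.closed, wedgeForm_zero_left, zero_add, neg_one_sq, one_smul] at h
      exact h
  injective k a ha h := ext_ev fun x => by
    obtain ⟨b, v, hF⟩ := hΩ.exists_isFrame hdim x
    rw [map_zero]
    refine lef_pow_injective hF k (sub_add_cancel _ _) (ev_mem_degForms x ha) ?_
    rw [← ev_wedgeΩ_pow hΩ, h, map_zero]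
  surjective k a ha := by
    by_cases hk : k ≤ n
    · obtain ⟨θ, hθ, h⟩ := exists_wedgeForm_powForm_eq hdim hΩ hk
        (show 2 * k + (n - k) = n + k by omega)
        (a (n + k)).2
      refine ⟨incl (n - k) ⟨θ, hθ⟩, ?_, ext_ev fun x => ?_⟩
      · convert incl_mem_deg (⟨θ, hθ⟩ : basicForms F (n - k)) using 2
        omega
      · rw [ev_wedgeΩ_pow, ev_incl, ←
          single_powForm_wedgeForm (show 2 * k + (n - k) = n + k by omega), h, ← ev_incl, ← eq_incl]
        exact_mod_cast ha
    · refine ⟨0, Submodule.zero_mem _, ?_⟩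
      rw [map_zero]
      exact (eq_zero_of_lt hdim hΩ (k := n + k) (by omega) (by exact_mod_cast ha)).symm

omit [T2Space M] in
variable (F Ω n) in
/-- The relation `b = ⋆ a` in degrees at most `2 n`. -/
def IsStar (a b : BasicComplex F) : Prop :=
  ∀ x, ∀ m ≤ 2 * n, starF (Ω x) n m (ev x a) = Forms.single (2 * n - m) (ev x b (2 * n - m))

omit [IsManifold 𝓘(ℝ, E) ∞ M] [ChartedSpace E M] [TopologicalSpace M] [T2Space M] in
theorem starF_eq_starF_single (α : E [⋀^Fin 2]→L[ℝ] ℝ) (k : ℕ) (f : Forms E) :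
    starF α n k f = starF α n k (Forms.single k (f k)) := by
  rw [starF, starF, Forms.single_same]

include hdim in
-- With a relation in place of an operator, the star of a basic form need not be known to be basic
-- beforehand; on primitive pieces `starF_lef_pow` exhibits it as a basic form.
theorem isLefschetzStar : IsLefschetzStar (wedgeΩ hΩ) (deg F) n (IsStar n F Ω) where
  add a b a' b' h h' x m hm := by
    obtain ⟨u, v, hF⟩ := hΩ.exists_isFrame hdim x
    have h1 := h x m hm
    have h2 := h' x m hm
    rw [starF_eq_starF_single] at h1 h2 ⊢
    rw [map_add, map_add, Forms.add_apply, Forms.add_apply, map_add, map_add, ← h1, ← h2]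
    exact starF_add hF hm (hΩ.single_mem_horForms (a m).2 x) (hΩ.single_mem_horForms (a' m).2 x)
  primitive s j hj := by
    have h0 : IsStar n F Ω 0 0 := fun x m hm => by
      obtain ⟨u, v, hF⟩ := hΩ.exists_isFrame hdim x
      rw [map_zero, starF_zero hF hm, Forms.zero_apply, map_zero]
    -- For `s > n` the truncated `n - s` is harmless: the degree is negative and `a = 0`.
    refine ⟨starCoeff (n - s) s j, starCoeff_ne_zero _ hj, fun a ha hp => ?_⟩
    by_cases hs : s ≤ n
    · have ha' : a ∈ deg F (n - s : ℕ) := by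
        convert ha using 2
        omega
      intro x m hm
      obtain ⟨u, v, hF⟩ := hΩ.exists_isFrame hdim x
      have hf := ev_mem_horForms hΩ x ha'
      have hpf : (lef (Ω x) ^ (s + 1)) (ev x a) = 0 := by
        rw [← ev_wedgeΩ_pow hΩ, hp, map_zero]
      rw [map_smul, ev_wedgeΩ_pow, ev_wedgeΩ_pow]
      have hg : starCoeff (n - s) s j • (lef (Ω x) ^ (s - j)) (ev x a) ∈
          degForms E (2 * n - (n - s + 2 * j : ℕ) : ℤ) :=
        Submodule.smul_mem _ _ (lef_pow_mem_degForms (s - j) (by omega) hf.1)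
      by_cases hmj : m = n - s + 2 * j
      · subst hmj
        rw [starF_lef_pow hF (by omega) hj hf hpf]
        refine eq_single ?_
        convert hg using 2
        omega
      · rw [hg (2 * n - m) (by omega), map_zero, starF_eq_starF_single,
          lef_pow_mem_degForms j rfl hf.1 m (by omega), map_zero, starF_zero hF hm]
    · rw [show a = 0 from funext fun k => ha k (by omega), map_zero, map_zero, smul_zero]
      exact h0

end BasicComplex

end BasicComplex

/-! ### Harmonic forms: closed forms with closed star -/

section Harmonic

variable {E : Type*} [NormedAddCommGroup E] [NormedSpace ℝ E] [FiniteDimensional ℝ E]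
  {M : Type*} [TopologicalSpace M] [ChartedSpace E M] [IsManifold 𝓘(ℝ, E) ∞ M]
  {p n : ℕ} {F : Foliation E M p} {Ω : DiffForm E M 2}

omit [IsManifold 𝓘(ℝ, E) ∞ M] in
theorem star_zero {k : ℕ} : star n Ω (0 : DiffForm E M k) = 0 := by
  funext x
  change starAt (Ω x) n 0 = 0
  by_cases hk : k ≤ 2 * n
  · rw [starAt_eq (Ω x) n hk 0 0 (map_zero _)]
    ext w
    have h := contract_sub (Nat.add_sub_cancel' hk) 0 0 (wedgePow (Ω x) n).toAlternatingMap
    rw [sub_zero, sub_self] at h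
    exact DFunLike.congr_fun h w
  · rw [starAt, dif_neg fun h => hk h.1]

omit [IsManifold 𝓘(ℝ, E) ∞ M] in
theorem star_of_lt {k : ℕ} (hk : 2 * n < k) (ξ : DiffForm E M k) : star n Ω ξ = 0 := by
  funext x
  change starAt (Ω x) n (ξ x) = 0
  rw [starAt, dif_neg fun h => absurd h.1 (by omega)]

omit [IsManifold 𝓘(ℝ, E) ∞ M] in
theorem codiff_eq_zero_of_extD_star {k : ℕ} {ξ : DiffForm E M k} (h : extD (star n Ω ξ) = 0) :
    codiff n Ω ξ = 0 := by
  rw [codiff, h, star_zero, smul_zero]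

namespace BasicComplex

theorem star_eq_of_isStar {k : ℕ} (hk : k ≤ 2 * n) {ξ : basicForms F k} {b : BasicComplex F}
    (h : IsStar n F Ω (incl k ξ) b) : star n Ω ξ.1 = (b (2 * n - k)).1 := by
  funext x
  have h1 := congrFun (h x k hk) (2 * n - k)
  rw [ev_incl, starF, Forms.single_same, Forms.single_same, Forms.single_same] at h1
  exact h1

variable [T2Space M] (hdim : finrank ℝ E = p + 2 * n) (hΩ : IsTransverselySymplectic F Ω)

theorem isHarmonic_of_isStar {k : ℕ} {ξ : basicForms F k} (hξ : extD ξ.1 = 0)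
    {b : BasicComplex F} (h : IsStar n F Ω (incl k ξ) b) (hb : d b = 0) : IsHarmonic n Ω ξ.1 := by
  refine ⟨hξ, codiff_eq_zero_of_extD_star ?_⟩
  by_cases hk : k ≤ 2 * n
  · rw [star_eq_of_isStar hk h, ← d_apply_succ, hb]
    rfl
  · rw [star_of_lt (by omega), extD_zero]

include hdim hΩ

/-- The star of a harmonic form is closed. -/
theorem d_eq_zero_of_isHarmonic {k l : ℕ} (hkl : k + l = 2 * n) {ξ : basicForms F k}
    (hξ : IsHarmonic n Ω ξ.1) {b : BasicComplex F} (hb : b ∈ deg F l)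
    (h : IsStar n F Ω (incl k ξ) b) : d b = 0 := by
  obtain rfl : l = 2 * n - k := by omega
  by_cases hk : k = 0
  -- For `k = 0` the codifferential is always zero and gives no information, but `d b` has degree `2
  -- n + 1`, where there are no nonzero basic forms.
  · subst hk
    refine eq_zero_of_lt hdim hΩ (k := 2 * n + 1) (by omega) ?_
    exact (isLefschetzModule hdim hΩ).D_mem _ _ hb
  · rw [d_eq_zero_iff hb]
    funext x
    obtain ⟨u, v, hF⟩ := hΩ.exists_isFrame hdim x
    have hco := congrFun hξ.coclosed x
    rw [codiff, star_eq_of_isStar (by omega) h] at hco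
    have h1 : (-1 : ℝ) ^ k • starAt (Ω x) n (extD (b (2 * n - k)).1 x) = 0 := hco
    have h2 := (smul_eq_zero.1 h1).resolve_left (pow_ne_zero _ (by norm_num))
    -- Since `k ≥ 1`, the degree `2 n - k + 1` is at most `2 n`, so the star is injective on the
    -- horizontal form `d ⋆ ξ`.
    have h3 : Forms.single (2 * n - k + 1) (extD (b (2 * n - k)).1 x) = 0 := by
      refine starF_injective hF (by omega)
        (hΩ.single_mem_horForms (extD_mem_basicForms (b (2 * n - k)).2) x) ?_
      rw [starF, Forms.single_same, h2, map_zero]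
    have h4 := congrFun h3 (2 * n - k + 1)
    rwa [Forms.single_same] at h4

/-- A harmonic form of degree `n + k` is the image under `L ^ k` of a closed basic form. -/
theorem exists_lefschetz_eq_of_isHarmonic {k : ℕ} (hd : 2 * k + (n - k) = n + k)
    {ξ : closedBasicForms F (n + k)} (hξ : IsHarmonic n Ω ξ.1) :
    ∃ η : closedBasicForms F (n - k), lefschetz hΩ k hd (basicClass η) = basicClass ξ := by
  have hmod := isLefschetzModule hdim hΩ
  have hcast : ((n - k : ℕ) : ℤ) = n - k := by omega
  have hmem : incl (n + k) ⟨ξ.1, ξ.2.1⟩ ∈ deg F (n + k) := by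
    exact_mod_cast incl_mem_deg (⟨ξ.1, ξ.2.1⟩ : basicForms F (n + k))
  obtain ⟨a, ha, hLa, hda⟩ := hmod.exists_closed_of_harmonic (isLefschetzStar hdim hΩ) hmem
    ((d_eq_zero_iff (incl_mem_deg _)).2 (by rw [incl_same]; exact ξ.2.2)) fun y hy hS =>
      d_eq_zero_of_isHarmonic hdim hΩ (l := n - k) (by omega) hξ (by rwa [hcast]) hS
  rw [← hcast] at ha
  refine ⟨⟨(a (n - k)).1, (a (n - k)).2, (d_eq_zero_iff ha).1 hda⟩, ?_⟩
  change basicClass _ = _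
  congr 1
  refine Subtype.ext (funext fun x => ?_)
  have h1 := congrArg (ev x) hLa
  rw [ev_wedgeΩ_pow, eq_incl ha, ev_incl, ev_incl, ← single_powForm_wedgeForm hd] at h1
  have h2 := congrFun h1 (n + k)
  rw [Forms.single_same, Forms.single_same] at h2
  exact h2

/-- The abstract `exists_harmonic` asks for equations `x = L^s y + D η` between forms;
`isBasicExact_iff` translates them from and to equality of classes. -/
theorem exists_isHarmonic_basicClass_eq
    (hsurj : ∀ (k : ℕ) (hd : 2 * k + (n - k) = n + k), k ≤ n →
      Function.Surjective (lefschetz hΩ k hd))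
    {k : ℕ} (ξ : closedBasicForms F k) :
    ∃ η : closedBasicForms F k, basicClass η = basicClass ξ ∧ IsHarmonic n Ω η.1 := by
  have hclosed : d (incl k ⟨ξ.1, ξ.2.1⟩) = 0 :=
    (d_eq_zero_iff (incl_mem_deg _)).2 (by rw [incl_same]; exact ξ.2.2)
  obtain ⟨z, hz, hdz, ⟨θ, hθ, hξz⟩, w, hw, hdw⟩ :=
    (isLefschetzModule hdim hΩ).exists_harmonic (isLefschetzStar hdim hΩ) (fun s hs x hx hdx => by
      have hx' : x ∈ deg F (n + s : ℕ) := by exact_mod_cast hx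
      obtain ⟨c, hc⟩ := hsurj s (by omega) hs (basicClass
        ⟨(x (n + s)).1, (x (n + s)).2, (d_eq_zero_iff hx').1 hdx⟩)
      obtain ⟨η, rfl⟩ := Submodule.mkQ_surjective _ c
      have hex := (Submodule.Quotient.eq _).1 hc.symm
      obtain ⟨θ, hθ, h⟩ := (isBasicExact_iff ⟨_, (Subtype.property (_ - _ :
        closedBasicForms F (n + s))).1⟩).1 hex
      refine ⟨incl (n - s) ⟨η.1, η.2.1⟩, ?_, ?_, θ, by exact_mod_cast hθ, ?_⟩
      · convert incl_mem_deg (⟨η.1, η.2.1⟩ : basicForms F (n - s)) using 2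
        omega
      · exact (d_eq_zero_iff (incl_mem_deg _)).2 (by rw [incl_same]; exact η.2.2)
      · rw [← h]
        refine ext_ev fun x' => ?_
        refine ((congrArg (ev x') (eq_incl hx')).trans (ev_incl _ _)).trans ?_
        rw [map_add, ev_wedgeΩ_pow, ev_incl, ev_incl,
          ← single_powForm_wedgeForm (show 2 * s + (n - s) = n + s by omega), ← map_add]
        congr 1
        exact (add_sub_cancel _ _).symm) (incl_mem_deg ⟨ξ.1, ξ.2.1⟩) hclosed
  rw [eq_incl hz] at hw
  have hzc := (d_eq_zero_iff hz).1 hdz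
  refine ⟨⟨(z k).1, (z k).2, hzc⟩, ?_, isHarmonic_of_isStar hzc hw hdw⟩
  symm
  refine (Submodule.Quotient.eq _).2 ((isBasicExact_iff ⟨_, (Subtype.property (_ - _ :
    closedBasicForms F k)).1⟩).2 ⟨θ, hθ, ?_⟩)
  have h1 : d θ = incl k ⟨ξ.1, ξ.2.1⟩ - z := by
    rw [hξz]
    abel
  rw [h1]
  conv_rhs => rw [eq_incl hz]
  rw [← map_sub]
  rfl

end BasicComplex

end Harmonic

end BasicHodge
end

theorem mainTheorem4 {E : Type*} [NormedAddCommGroup E] [NormedSpace ℝ E] [FiniteDimensional ℝ E]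
    {M : Type*} [TopologicalSpace M] [ChartedSpace E M] [IsManifold 𝓘(ℝ, E) ∞ M]
    [T2Space M] [SecondCountableTopology M]
    (p n : ℕ) (hdim : Module.finrank ℝ E = p + 2 * n) (F : BasicHodge.Foliation E M p)
    (Ω : BasicHodge.DiffForm E M 2) (hΩ : BasicHodge.IsTransverselySymplectic F Ω) :
    (∀ (k : ℕ) (c : BasicHodge.BasicCohomology F k), ∃ ξ : BasicHodge.closedBasicForms F k,
        BasicHodge.basicClass ξ = c ∧ BasicHodge.IsHarmonic n Ω ξ.1) ↔
      ∀ (k : ℕ) (hk : k ≤ n), Function.Surjective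
        (BasicHodge.lefschetz hΩ k (show 2 * k + (n - k) = n + k by omega)) := by
  constructor
  · intro h k hk c
    obtain ⟨ξ, rfl, hξ⟩ := h (n + k) c
    obtain ⟨η, hη⟩ :=
      BasicHodge.BasicComplex.exists_lefschetz_eq_of_isHarmonic hdim hΩ (by omega) hξ
    exact ⟨BasicHodge.basicClass η, hη⟩
  · intro h k c
    obtain ⟨ξ, rfl⟩ := Submodule.mkQ_surjective _ c
    exact BasicHodge.BasicComplex.exists_isHarmonic_basicClass_eq hdim hΩ (fun k _ hk => h k hk) ξ
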